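/- Let $H\in(0,1)$ and $K\in(0,1]$ satisfy $2HK=1$. There is a constant $C_{H,K}>0$, depending only on $H$ and $K$, such that the following holds. Let $B=\{B_t,\,t\ge 0\}$ be a bi-fractional Brownian motion with indices $H,K$ on a probability space $(\Omega,\mathscr F,P)$, that is, a centred Gaussian process with a.s. continuous paths, $B_0=0$ and $$E[B_tB_s]=2^{-K}\left[(t^{2H}+s^{2H})^K-|t-s|^{2HK}\right],\qquad s,t\ge 0,$$ let $T>0$, and let $f:\mathbb R\to\mathbb R$ be a bounded (Borel) measurable function. Then for every $0\le t\le T$ the quadratic covariation $$[f(B),B]_t:=\lim_{\varepsilon\downarrow 0}\frac1\varepsilon\int_0^t\{f(B_{s+\varepsilon})-f(B_s)\}(B_{s+\varepsilon}-B_s)\,ds$$ exists as a limit in $L^2(\Omega)$, and $$E\left|[f(B),B]_t\right|^2\le\left(C_{H,K}\sup_{x\in\mathbb R}|f(x)|\right)^2 t .$$ -/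

import Mathlib

open MeasureTheory ProbabilityTheory Filter Topology
open scoped NNReal ENNReal

/-- The covariance function of bi-fractional Brownian motion with indices `H` and `K`:
`R(t, s) = 2^{-K} ((t^{2H} + s^{2H})^K - |t - s|^{2HK})`. -/
noncomputable def biFBmCov (H K t s : ℝ) : ℝ :=
  1 / (2 : ℝ) ^ K *
    ((t ^ (2 * H) + s ^ (2 * H)) ^ K - |t - s| ^ (2 * H * K))

/-- `B` restricted to the times `t ≥ 0` is a bi-fractional Brownian motion with indices `H` and
`K` under `P`: a centred Gaussian process started at `0`, with covariance `biFBmCov H K` and almost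
surely continuous paths.  The values of `B` at negative times play no role. -/
structure IsBiFBm {Ω : Type*} [MeasurableSpace Ω] (P : Measure Ω) (H K : ℝ)
    (B : ℝ → Ω → ℝ) : Prop where
  gaussian : IsGaussianProcess (fun (t : ℝ≥0) (ω : Ω) => B (t : ℝ) ω) P
  zero : ∀ᵐ ω ∂P, B 0 ω = 0
  mean : ∀ t : ℝ, 0 ≤ t → ∫ ω, B t ω ∂P = 0
  cov : ∀ t s : ℝ, 0 ≤ t → 0 ≤ s → ∫ ω, B t ω * B s ω ∂P = biFBmCov H K t s
  continuous_paths : ∀ᵐ ω ∂P, ContinuousOn (fun t : ℝ => B t ω) (Set.Ici 0)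

/-- `J_ε(f, t) = (1/ε) ∫_0^t (f(B_{s+ε}) - f(B_s)) (B_{s+ε} - B_s) ds`. -/
noncomputable def covApprox {Ω : Type*} (B : ℝ → Ω → ℝ) (f : ℝ → ℝ) (t ε : ℝ) (ω : Ω) : ℝ :=
  1 / ε * ∫ s in (0 : ℝ)..t, (f (B (s + ε) ω) - f (B s ω)) * (B (s + ε) ω - B s ω)

/-- The random variable `Q` is the quadratic covariation `[f(B), B]_t` in `L²(P)`: the
`L²`-limit of `J_ε(f, t)` as `ε ↓ 0`. -/
structure IsL2QuadCov {Ω : Type*} [MeasurableSpace Ω] (P : Measure Ω) (B : ℝ → Ω → ℝ)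
    (f : ℝ → ℝ) (t : ℝ) (Q : Ω → ℝ) : Prop where
  approx_memLp : ∀ᶠ ε in 𝓝[>] (0 : ℝ), MemLp (covApprox B f t ε) 2 P
  memLp : MemLp Q 2 P
  tendsto : Tendsto (fun ε : ℝ => eLpNorm (fun ω => covApprox B f t ε ω - Q ω) 2 P)
    (𝓝[>] (0 : ℝ)) (𝓝 0)

/-!
Write `α = 2H ∈ [1, 2)`. Since `2HK = 1`, the covariance is `2^{-K} (‖(t, s)‖_α - |t - s|)` with the
`ℓ^α` norm of the plane. Hence `E B_t² = t`, increments have variance comparable to their length,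
and the covariance of the increments over two intervals `[v₁, v₂]` and `[u₁, u₂]` with `v₂ ≤ u₁` is
at most `(v₂ - v₁) (u₂ - u₁) / u₁` in absolute value: the norm is homogeneous of degree `1` and its
mixed second derivative is of order `1 / u₁`. This is `CriticalIndices.abs_incrCov_le_mul_div`.

*Uniform bound.* The approximation `J_ε(f)` is the difference of a backward and a forward sum, that
is, of `ε⁻¹ ∫ f(B_{s+τ}) (B_{s+ε} - B_s) ds` for `τ = ε` and `τ = 0`. The second moment of such a
sum is a double integral of `E [f(B_y) f(B_x) X Y]` with two increments `X`, `Y`. Near the diagonal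
Hölder's inequality suffices. Away from it `X` and `Y` are projected onto the span of `B_x` and
`B_y`; the residuals are independent of `(B_x, B_y)`, and this bounds the expectation by the
covariances of the increments with the values of the process, times the `L⁴` norms of `f(B_x)` and
`f(B_y)`, without any regularity of `f`
(`IsGaussianSpace.abs_integral_mul_mul_le_of_regression`). The resulting kernel is homogeneous of
degree `-1` and integrable, whence `E J_ε(f)² ≤ C S² (b - a)` over an interval `[a, b]`, uniformly
in `ε`, if the fourth moments of `f(B_u)` are at most `S⁴`
(`IsRegularBiFBm.integral_covApproxOn_sq_le`). For bounded `f` this is the asserted inequality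
before passing to the limit.

*Convergence.* For a test function `φ` and an interval away from time `0`, a Taylor expansion and
the convergence of quadratic variations, which follows from the weak correlation of the squared
increments, give `J_ε(φ) → 2^{1-K} ∫ φ'(B_s) ds` in `L²`
(`IsRegularBiFBm.eventually_integral_covApproxOn_sub_sq_le`). A bounded measurable `f` is
approximated by test functions in `L⁴` of a Gaussian measure dominating the laws of `B_s` for
`s ≥ δ`. The uniform bound, used for `f - φ` on `[δ, t]` and for `f` on `[0, δ]`, shows that
`J_ε(f)` comes arbitrarily close to elements of `L²`; by completeness it converges.

The process is first replaced by a version that is jointly measurable and has only continuous paths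
(`IsBiFBm.exists_isRegularBiFBm`).
-/

/-! ### The `ℓ^p` norm on the quadrant -/

/-- The `ℓ^p` norm of the vector `(u, v)`, for `u, v ≥ 0`. -/
noncomputable def ellNorm (p u v : ℝ) : ℝ := (u ^ p + v ^ p) ^ (1 / p)

namespace ellNorm

variable {p u v : ℝ}

theorem comm (p u v : ℝ) : ellNorm p u v = ellNorm p v u := by
  simp [ellNorm, add_comm]

theorem add_le (hp : 1 ≤ p) {a b c d : ℝ} (ha : 0 ≤ a) (hb : 0 ≤ b) (hc : 0 ≤ c) (hd : 0 ≤ d) :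
    ellNorm p (a + c) (b + d) ≤ ellNorm p a b + ellNorm p c d := by
  have h := Real.Lp_add_le_of_nonneg (s := Finset.univ) (f := ![a, b]) (g := ![c, d]) hp
    (by intro i _; fin_cases i <;> simpa) (by intro i _; fin_cases i <;> simpa)
  simpa [ellNorm, Fin.sum_univ_two] using h

theorem zero_right (hp : 1 ≤ p) (hu : 0 ≤ u) : ellNorm p u 0 = u := by
  have : p ≠ 0 := by linarith
  rw [ellNorm, Real.zero_rpow this, add_zero, ← Real.rpow_mul hu, mul_one_div_cancel this,
    Real.rpow_one]

theorem mono_right (hp : 1 ≤ p) {w : ℝ} (hu : 0 ≤ u) (hv : 0 ≤ v) (h : v ≤ w) :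
    ellNorm p u v ≤ ellNorm p u w := by
  unfold ellNorm
  have h1 := Real.rpow_nonneg hu p
  have h2 := Real.rpow_nonneg hv p
  have h3 := Real.rpow_le_rpow hv h (by linarith : 0 ≤ p)
  exact Real.rpow_le_rpow (by linarith) (by linarith) (by positivity)

theorem left_le (hp : 1 ≤ p) (hu : 0 ≤ u) (hv : 0 ≤ v) : u ≤ ellNorm p u v := by
  simpa [zero_right hp hu] using mono_right hp hu le_rfl hv

theorem right_le (hp : 1 ≤ p) (hu : 0 ≤ u) (hv : 0 ≤ v) : v ≤ ellNorm p u v := by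
  rw [comm]; exact left_le hp hv hu

theorem le_add_left (hp : 1 ≤ p) {w : ℝ} (hu : 0 ≤ u) (hv : 0 ≤ v) (h : v ≤ w) :
    ellNorm p u w ≤ ellNorm p u v + (w - v) := by
  have := add_le hp hu hv le_rfl (sub_nonneg.2 h)
  rw [comm p 0, zero_right hp (sub_nonneg.2 h)] at this
  simpa using this

theorem diag (hp : 1 ≤ p) (hu : 0 ≤ u) : ellNorm p u u = (2 : ℝ) ^ (1 / p) * u := by
  have : p ≠ 0 := by linarith
  rw [ellNorm, ← two_mul, Real.mul_rpow (by norm_num) (Real.rpow_nonneg hu _), ← Real.rpow_mul hu,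
    mul_one_div_cancel this, Real.rpow_one]

theorem hasDerivAt_right (hp : 1 ≤ p) (hu : 0 < u) (hv : 0 ≤ v) :
    HasDerivAt (ellNorm p u) (v ^ (p - 1) * (ellNorm p u v) ^ (1 - p)) v := by
  have hp0 : p ≠ 0 := by linarith
  have hS : 0 < u ^ p + v ^ p := add_pos_of_pos_of_nonneg (Real.rpow_pos_of_pos hu _)
    (Real.rpow_nonneg hv _)
  have h1 := (Real.hasDerivAt_rpow_const (x := v) (p := p) (Or.inr hp)).const_add (u ^ p)
  have h2 := h1.rpow_const (p := 1 / p) (Or.inl hS.ne')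
  refine h2.congr_deriv ?_
  rw [ellNorm, ← Real.rpow_mul hS.le]
  have : 1 / p * (1 - p) = 1 / p - 1 := by field_simp
  rw [this]
  field_simp

/-- The mixed second derivative of the `ℓ^p` norm on `[u₁, ∞) × [0, ∞)` is at most `1 / u₁`, in the
form of a bound on mixed second differences. -/
theorem abs_mixed_difference_le (hp : 1 ≤ p) (hp2 : p ≤ 2) {u₁ u₂ v₁ v₂ : ℝ} (hu : 0 < u₁)
    (hu' : u₁ ≤ u₂) (hv : 0 ≤ v₁) (hv' : v₁ ≤ v₂) :
    |ellNorm p u₂ v₂ - ellNorm p u₁ v₂ - (ellNorm p u₂ v₁ - ellNorm p u₁ v₁)| ≤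
      (u₂ - u₁) / u₁ * (v₂ - v₁) := by
  have hu2 : 0 < u₂ := hu.trans_le hu'
  refine norm_image_sub_le_of_norm_deriv_le_segment' (f := fun v => ellNorm p u₂ v - ellNorm p u₁ v)
    (fun v hv0 => ((hasDerivAt_right hp hu2 (hv.trans hv0.1)).sub
      (hasDerivAt_right hp hu (hv.trans hv0.1))).hasDerivWithinAt) ?_ v₂ ⟨hv', le_rfl⟩
  intro v hv0
  have hv0 : 0 ≤ v := hv.trans hv0.1
  set a := ellNorm p u₂ v
  set b := ellNorm p u₁ v
  have hb : u₁ ≤ b := left_le hp hu.le hv0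
  have ha : u₂ ≤ a := left_le hp hu2.le hv0
  have hvb : v ≤ b := right_le hp hu.le hv0
  have hba : b ≤ a := by
    simp only [a, b]
    rw [comm p u₂, comm p u₁]
    exact mono_right hp hv0 hu.le hu'
  have hab : a - b ≤ u₂ - u₁ := by
    have := le_add_left hp hv0 hu.le hu'
    rw [comm p v, comm p v] at this
    linarith
  have hb0 : 0 < b := hu.trans_le hb
  have ha0 : 0 < a := hb0.trans_le hba
  have h1 : a ^ (1 - p) ≤ b ^ (1 - p) := Real.rpow_le_rpow_of_nonpos hb0 hba (by linarith)
  have h2 : v ^ (p - 1) ≤ b ^ (p - 1) := Real.rpow_le_rpow hv0 hvb (by linarith)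
  have h3 : b / a ≤ (b / a) ^ (p - 1) := by
    conv_lhs => rw [← Real.rpow_one (b / a)]
    exact Real.rpow_le_rpow_of_exponent_ge (by positivity) ((div_le_one ha0).2 hba) (by linarith)
  have h4 : b ^ (p - 1) * b ^ (1 - p) = 1 := by
    rw [← Real.rpow_add hb0]; simp
  have h5 : b ^ (p - 1) * a ^ (1 - p) = (b / a) ^ (p - 1) := by
    rw [Real.div_rpow hb0.le ha0.le, div_eq_mul_inv, ← Real.rpow_neg ha0.le]; simp
  rw [Real.norm_eq_abs, abs_sub_comm, ← mul_sub,
    abs_of_nonneg (mul_nonneg (Real.rpow_nonneg hv0 _) (sub_nonneg.2 h1))]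
  calc v ^ (p - 1) * (b ^ (1 - p) - a ^ (1 - p))
      ≤ b ^ (p - 1) * (b ^ (1 - p) - a ^ (1 - p)) :=
        mul_le_mul_of_nonneg_right h2 (sub_nonneg.2 h1)
    _ = 1 - (b / a) ^ (p - 1) := by rw [mul_sub, h4, h5]
    _ ≤ 1 - b / a := by linarith
    _ = (a - b) / a := by field_simp
    _ ≤ (u₂ - u₁) / u₁ := div_le_div₀ (by linarith) hab hu (by linarith)

end ellNorm

/-! ### The covariance function for `2HK = 1` -/

theorem biFBmCov_comm (H K t s : ℝ) : biFBmCov H K t s = biFBmCov H K s t := by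
  simp [biFBmCov, abs_sub_comm, add_comm]

/-- The covariance of the increments of the process over `[v₁, v₂]` and `[u₁, u₂]`. -/
noncomputable def incrCov (H K v₁ v₂ u₁ u₂ : ℝ) : ℝ :=
  biFBmCov H K v₂ u₂ - biFBmCov H K v₂ u₁ - biFBmCov H K v₁ u₂ + biFBmCov H K v₁ u₁

/-- Admissible indices of the critical bi-fractional Brownian motion. -/
structure CriticalIndices (H K : ℝ) : Prop where
  H_pos : 0 < H
  H_lt_one : H < 1
  K_pos : 0 < K
  K_le_one : K ≤ 1
  two_mul_mul : 2 * H * K = 1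

namespace CriticalIndices

variable {H K : ℝ}

theorem one_le_two_mul_H (hc : CriticalIndices H K) : 1 ≤ 2 * H := by
  nlinarith [hc.H_pos, hc.K_le_one, hc.two_mul_mul]

theorem K_eq (hc : CriticalIndices H K) : K = 1 / (2 * H) := by
  have := hc.H_pos
  rw [eq_div_iff (by positivity)]; linarith [hc.two_mul_mul]

theorem half_le_coeff (hc : CriticalIndices H K) : 1 / 2 ≤ 1 / (2 : ℝ) ^ K := by
  have : (2 : ℝ) ^ K ≤ 2 ^ (1 : ℝ) := Real.rpow_le_rpow_of_exponent_le (by norm_num) hc.K_le_one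
  rw [Real.rpow_one] at this
  exact one_div_le_one_div_of_le (by positivity) this

theorem coeff_le_one (hc : CriticalIndices H K) : 1 / (2 : ℝ) ^ K ≤ 1 := by
  rw [div_le_one (by positivity)]
  exact Real.one_le_rpow (by norm_num) hc.K_pos.le

theorem biFBmCov_eq (hc : CriticalIndices H K) (t s : ℝ) :
    biFBmCov H K t s = 1 / (2 : ℝ) ^ K * (ellNorm (2 * H) t s - |t - s|) := by
  rw [biFBmCov, hc.two_mul_mul, Real.rpow_one, ellNorm, ← hc.K_eq]

theorem coeff_mul_ellNorm_diag (hc : CriticalIndices H K) {t : ℝ} (ht : 0 ≤ t) :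
    1 / (2 : ℝ) ^ K * ellNorm (2 * H) t t = t := by
  rw [ellNorm.diag hc.one_le_two_mul_H ht, ← hc.K_eq]
  have : (0 : ℝ) < 2 ^ K := by positivity
  field_simp

theorem biFBmCov_self (hc : CriticalIndices H K) {t : ℝ} (ht : 0 ≤ t) : biFBmCov H K t t = t := by
  rw [hc.biFBmCov_eq, sub_self, abs_zero, sub_zero, hc.coeff_mul_ellNorm_diag ht]

theorem add_div_two_le_coeff_mul_ellNorm (hc : CriticalIndices H K) {u v : ℝ} (hu : 0 ≤ u)
    (hv : 0 ≤ v) :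
    (u + v) / 2 ≤ 1 / (2 : ℝ) ^ K * ellNorm (2 * H) u v := by
  have h := ellNorm.add_le hc.one_le_two_mul_H hu hv hv hu
  rw [add_comm v u, ellNorm.comm _ v u] at h
  have h2 := hc.coeff_mul_ellNorm_diag (add_nonneg hu hv)
  have := mul_le_mul_of_nonneg_left h (by positivity : 0 ≤ 1 / (2 : ℝ) ^ K)
  linarith

theorem coeff_mul_ellNorm_le (hc : CriticalIndices H K) {s r : ℝ} (hr : 0 ≤ r) (h : r ≤ s) :
    1 / (2 : ℝ) ^ K * ellNorm (2 * H) s r ≤ 1 / (2 : ℝ) ^ K * (s - r) + r := by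
  have h1 := ellNorm.le_add_left hc.one_le_two_mul_H hr hr h
  rw [ellNorm.comm] at h1
  have h2 := hc.coeff_mul_ellNorm_diag hr
  have := mul_le_mul_of_nonneg_left h1 (by positivity : 0 ≤ 1 / (2 : ℝ) ^ K)
  linarith

/-- The normalised `ℓ^{2H}` norm is a power mean of exponent at most `2`, hence at most the
quadratic mean. -/
theorem coeff_mul_ellNorm_le_quadratic (hc : CriticalIndices H K) {s ε : ℝ} (hs : 0 < s)
    (hε : 0 ≤ ε) :
    1 / (2 : ℝ) ^ K * ellNorm (2 * H) (s + ε) s ≤ s + ε / 2 + ε ^ 2 / (4 * s) := by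
  have hH := hc.one_le_two_mul_H
  have h2H : 2 * H ≤ 2 := by linarith [hc.H_lt_one]
  have hu : 0 ≤ s + ε := by linarith
  set p := 2 * H
  have hp0 : 0 < p := by linarith
  set m := 1 / (2 : ℝ) ^ K * ellNorm p (s + ε) s
  have hN : 0 ≤ ellNorm p (s + ε) s := hu.trans (ellNorm.left_le hH hu hs.le)
  have hm : m = ((1 / 2) * (s + ε) ^ p + (1 / 2) * s ^ p) ^ (1 / p) := by
    simp only [m]
    rw [ellNorm, hc.K_eq, ← mul_add, Real.mul_rpow (by norm_num) (by positivity),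
      Real.div_rpow (by norm_num) (by norm_num), Real.one_rpow]
  have hm0 : 0 ≤ m := by positivity
  have h1 : m ^ 2 ≤ (1 / 2) * (s + ε) ^ 2 + (1 / 2) * s ^ 2 := by
    have := (convexOn_rpow ((one_le_div hp0).2 h2H)).2 (Set.mem_Ici.2 (Real.rpow_nonneg hu p))
      (Set.mem_Ici.2 (Real.rpow_nonneg hs.le p)) (by norm_num : (0 : ℝ) ≤ 1 / 2)
      (by norm_num : (0 : ℝ) ≤ 1 / 2) (by norm_num)
    simp only [smul_eq_mul] at this
    rw [← Real.rpow_mul hu, ← Real.rpow_mul hs.le, mul_div_cancel₀ _ hp0.ne', Real.rpow_two,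
      Real.rpow_two] at this
    rwa [hm, ← Real.rpow_two, ← Real.rpow_mul (by positivity), show 1 / p * 2 = 2 / p by ring]
  have h2 : (1 / 2) * (s + ε) ^ 2 + (1 / 2) * s ^ 2 ≤ (s + ε / 2 + ε ^ 2 / (4 * s)) ^ 2 := by
    have e : (s + ε / 2 + ε ^ 2 / (4 * s)) ^ 2 - ((1 / 2) * (s + ε) ^ 2 + (1 / 2) * s ^ 2)
        = ε ^ 2 / 4 + ε ^ 3 / (4 * s) + ε ^ 4 / (16 * s ^ 2) := by
      field_simp
      ring
    have : 0 ≤ ε ^ 2 / 4 + ε ^ 3 / (4 * s) + ε ^ 4 / (16 * s ^ 2) := by positivity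
    linarith
  exact (pow_le_pow_iff_left₀ hm0 (by positivity) two_ne_zero).1 (h1.trans h2)

theorem biFBmCov_of_le (hc : CriticalIndices H K) {s r : ℝ} (h : r ≤ s) :
    biFBmCov H K s r = 1 / (2 : ℝ) ^ K * (ellNorm (2 * H) s r - (s - r)) := by
  rw [hc.biFBmCov_eq, abs_of_nonneg (sub_nonneg.2 h)]

theorem biFBmCov_zero_right (hc : CriticalIndices H K) {t : ℝ} (ht : 0 ≤ t) :
    biFBmCov H K t 0 = 0 := by
  rw [hc.biFBmCov_of_le ht, ellNorm.zero_right hc.one_le_two_mul_H ht]; ring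

/-- With `2HK = 1` the variance of an increment is comparable to its length: this lower bound is
the non-degeneracy behind the regression on two values of the process. -/
theorem sub_le_incrCov_self (hc : CriticalIndices H K) {r s : ℝ} (hr : 0 ≤ r) (h : r ≤ s) :
    s - r ≤ incrCov H K r s r s := by
  rw [incrCov, hc.biFBmCov_self (hr.trans h), hc.biFBmCov_self hr, biFBmCov_comm H K r s,
    hc.biFBmCov_of_le h]
  have := hc.coeff_mul_ellNorm_le hr h
  linarith

theorem incrCov_self_le (hc : CriticalIndices H K) {r s : ℝ} (hr : 0 ≤ r) (h : r ≤ s) :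
    incrCov H K r s r s ≤ 2 * (1 / (2 : ℝ) ^ K) * (s - r) := by
  rw [incrCov, hc.biFBmCov_self (hr.trans h), hc.biFBmCov_self hr, biFBmCov_comm H K r s,
    hc.biFBmCov_of_le h]
  have := hc.add_div_two_le_coeff_mul_ellNorm (hr.trans h) hr
  linarith

theorem incrCov_self_le_two_mul (hc : CriticalIndices H K) {r s : ℝ} (hr : 0 ≤ r) (h : r ≤ s) :
    incrCov H K r s r s ≤ 2 * (s - r) := by
  have := mul_le_mul_of_nonneg_right hc.coeff_le_one (sub_nonneg.2 h)
  linarith [hc.incrCov_self_le hr h]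

/-- Away from time `0` the variance of a short increment is `2^{1-K} ε` up to second order. -/
theorem abs_incrCov_self_sub_le (hc : CriticalIndices H K) {s ε : ℝ} (hs : 0 < s) (hε : 0 ≤ ε) :
    |incrCov H K s (s + ε) s (s + ε) - 2 * (1 / (2 : ℝ) ^ K) * ε| ≤ ε ^ 2 / (2 * s) := by
  have h := hc.incrCov_self_le hs.le (by linarith : s ≤ s + ε)
  rw [add_sub_cancel_left] at h
  rw [abs_of_nonpos (by linarith), incrCov, hc.biFBmCov_self (by linarith : 0 ≤ s + ε),
    hc.biFBmCov_self hs.le, biFBmCov_comm H K s, hc.biFBmCov_of_le (by linarith : s ≤ s + ε)]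
  have h2 := hc.coeff_mul_ellNorm_le_quadratic hs hε
  have h3 : ε ^ 2 / (2 * s) = 2 * (ε ^ 2 / (4 * s)) := by field_simp; norm_num
  rw [h3]
  linarith

/-- A value of the process and a later increment are negatively correlated, with correlation
coefficient at least `-1 / 4`. -/
theorem sq_biFBmCov_sub_le (hc : CriticalIndices H K) {r s : ℝ} (hr : 0 ≤ r) (h : r ≤ s) :
    (biFBmCov H K s r - r) ^ 2 ≤ r * (s - r) / 16 ∧ |biFBmCov H K s r - r| ≤ s - r := by
  have h1 := hc.coeff_mul_ellNorm_le hr h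
  have h2 := hc.add_div_two_le_coeff_mul_ellNorm (hr.trans h) hr
  have h3 := mul_le_mul_of_nonneg_left (ellNorm.left_le hc.one_le_two_mul_H (hr.trans h) hr)
    (by positivity : 0 ≤ 1 / (2 : ℝ) ^ K)
  rw [hc.biFBmCov_of_le h]
  have hc1 := hc.half_le_coeff
  have hc2 := hc.coeff_le_one
  generalize 1 / (2 : ℝ) ^ K = c at *
  set n := ellNorm (2 * H) s r
  have hd : 0 ≤ s - r := sub_nonneg.2 h
  have hq0 : c * (n - (s - r)) - r ≤ 0 := by linarith
  have hq1 : r - c * (n - (s - r)) ≤ (1 - c) * r := by linarith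
  have hq2 : r - c * (n - (s - r)) ≤ (c - 1 / 2) * (s - r) := by linarith
  constructor
  · have : (r - c * (n - (s - r))) ^ 2 ≤ ((1 - c) * r) * ((c - 1 / 2) * (s - r)) := by
      rw [sq]
      exact mul_le_mul hq1 hq2 (by linarith) (mul_nonneg (by linarith) hr)
    have h5 : (1 - c) * (c - 1 / 2) ≤ 1 / 16 := by nlinarith [sq_nonneg (c - 3 / 4)]
    have := mul_le_mul_of_nonneg_right h5 (mul_nonneg hr hd)
    nlinarith
  · rw [abs_of_nonpos hq0]
    nlinarith

theorem incrCov_of_le (hc : CriticalIndices H K) {v₁ v₂ u₁ u₂ : ℝ} (hv : v₁ ≤ v₂)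
    (h : v₂ ≤ u₁) (hu : u₁ ≤ u₂) :
    incrCov H K v₁ v₂ u₁ u₂ = 1 / (2 : ℝ) ^ K * (ellNorm (2 * H) u₂ v₂ - ellNorm (2 * H) u₁ v₂ -
      (ellNorm (2 * H) u₂ v₁ - ellNorm (2 * H) u₁ v₁)) := by
  rw [incrCov, biFBmCov_comm _ _ v₂, biFBmCov_comm _ _ v₂, biFBmCov_comm _ _ v₁,
    biFBmCov_comm _ _ v₁, hc.biFBmCov_of_le (by linarith), hc.biFBmCov_of_le (by linarith),
    hc.biFBmCov_of_le (by linarith), hc.biFBmCov_of_le (by linarith)]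
  ring

/-- Disjoint increments are weakly correlated: after the term `|t - s|` cancels, only the mixed
difference of the `ℓ^{2H}` norm remains. -/
theorem abs_incrCov_le_mul_div (hc : CriticalIndices H K) {v₁ v₂ u₁ u₂ : ℝ} (hv0 : 0 ≤ v₁)
    (hv : v₁ ≤ v₂) (h : v₂ ≤ u₁) (hu0 : 0 < u₁) (hu : u₁ ≤ u₂) :
    |incrCov H K v₁ v₂ u₁ u₂| ≤ (u₂ - u₁) * (v₂ - v₁) / u₁ := by
  rw [hc.incrCov_of_le hv h hu, abs_mul, abs_of_nonneg (by positivity : 0 ≤ 1 / (2 : ℝ) ^ K)]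
  have h2 := ellNorm.abs_mixed_difference_le hc.one_le_two_mul_H (by linarith [hc.H_lt_one])
    hu0 hu hv0 hv
  calc _ ≤ 1 * |_| := mul_le_mul_of_nonneg_right hc.coeff_le_one (abs_nonneg _)
    _ ≤ _ := by rw [one_mul]; exact h2.trans (le_of_eq (by ring))

theorem abs_incrCov_le (hc : CriticalIndices H K) {v₁ v₂ u₁ u₂ : ℝ} (hv0 : 0 ≤ v₁)
    (hv : v₁ ≤ v₂) (h : v₂ ≤ u₁) (hu : u₁ ≤ u₂) :
    |incrCov H K v₁ v₂ u₁ u₂| ≤ v₂ - v₁ ∧ |incrCov H K v₁ v₂ u₁ u₂| ≤ u₂ - u₁ := by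
  have hp := hc.one_le_two_mul_H
  have hv2 : 0 ≤ v₂ := hv0.trans hv
  have hu1 : 0 ≤ u₁ := hv2.trans h
  have hu2 : 0 ≤ u₂ := hu1.trans hu
  rw [hc.incrCov_of_le hv h hu, abs_mul, abs_of_nonneg (by positivity : 0 ≤ 1 / (2 : ℝ) ^ K)]
  have key : ∀ x y : ℝ, |x| ≤ y → 1 / (2 : ℝ) ^ K * |x| ≤ y := fun x y hxy =>
    (mul_le_mul_of_nonneg_right hc.coeff_le_one (abs_nonneg _)).trans (by rwa [one_mul])
  have a1 := ellNorm.mono_right hp hu2 hv0 hv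
  have a2 := ellNorm.mono_right hp hu1 hv0 hv
  have a3 := ellNorm.le_add_left hp hu2 hv0 hv
  have a4 := ellNorm.le_add_left hp hu1 hv0 hv
  have b1 := ellNorm.mono_right hp hv2 hu1 hu
  have b2 := ellNorm.mono_right hp hv0 hu1 hu
  have b3 := ellNorm.le_add_left hp hv2 hu1 hu
  have b4 := ellNorm.le_add_left hp hv0 hu1 hu
  simp only [ellNorm.comm _ v₂, ellNorm.comm _ v₁] at b1 b2 b3 b4
  constructor <;> refine key _ _ (abs_le.2 ⟨?_, ?_⟩) <;> linarith

/-- The covariance form of a value of the process and a later increment is bounded below by half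
of that of two independent Gaussians of variances `r` and `s - r`. -/
theorem half_le_quadraticForm (hc : CriticalIndices H K) {r s : ℝ} (hr : 0 ≤ r) (h : r ≤ s)
    (x y : ℝ) :
    1 / 2 * (x ^ 2 * r + y ^ 2 * (s - r)) ≤ x ^ 2 * biFBmCov H K r r +
      2 * (x * y) * (biFBmCov H K s r - r) + y ^ 2 * incrCov H K r s r s := by
  have h1 := hc.sub_le_incrCov_self hr h
  have h2 := (hc.sq_biFBmCov_sub_le hr h).1
  rw [hc.biFBmCov_self hr]
  set q := biFBmCov H K s r - r
  have hd : 0 ≤ s - r := sub_nonneg.2 h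
  have h3 : (4 * (x * y) * q) ^ 2 ≤ (x ^ 2 * r + y ^ 2 * (s - r)) ^ 2 := by
    have e1 : (4 * (x * y) * q) ^ 2 = 16 * (x * y) ^ 2 * q ^ 2 := by ring
    have e2 := mul_le_mul_of_nonneg_left h2 (by positivity : 0 ≤ 16 * (x * y) ^ 2)
    nlinarith [sq_nonneg (x ^ 2 * r - y ^ 2 * (s - r)), mul_nonneg (mul_nonneg (sq_nonneg x) hr)
      (mul_nonneg (sq_nonneg y) hd)]
  have h4 := abs_le.1 (abs_le_of_sq_le_sq h3 (by positivity))
  nlinarith [mul_le_mul_of_nonneg_left h1 (sq_nonneg y)]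

end CriticalIndices

section

/-! ### Gaussian spaces -/

variable {Ω : Type*} [MeasurableSpace Ω] {P : Measure Ω}

/-- A Gaussian space: a linear space of real random variables, any finitely many of which are
jointly Gaussian and centred.  Its elements are functions, not classes modulo null sets. -/
structure IsGaussianSpace (E : Submodule ℝ (Ω → ℝ)) (P : Measure Ω) : Prop where
  gaussian : IsGaussianProcess (fun (X : E) (ω : Ω) => (X : Ω → ℝ) ω) P
  mean : ∀ X ∈ E, ∫ ω, X ω ∂P = 0

/-- The linear span of a centred Gaussian process is a Gaussian space. -/
theorem ProbabilityTheory.IsGaussianProcess.isGaussianSpace_span {T : Type*} {X : T → Ω → ℝ}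
    (hX : IsGaussianProcess X P) (hm : ∀ t, ∫ ω, X t ω ∂P = 0) :
    IsGaussianSpace (Submodule.span ℝ (Set.range X)) P := by
  classical
  have key : ∀ Y ∈ Submodule.span ℝ (Set.range X), ∃ (I : Finset T) (L : (I → ℝ) →L[ℝ] ℝ),
      ∀ ω, Y ω = L (I.restrict (X · ω)) := by
    intro Y hY
    obtain ⟨c, rfl⟩ := (Finsupp.mem_span_range_iff_exists_finsupp).1 hY
    refine ⟨c.support, ∑ i : c.support, c i • ContinuousLinearMap.proj i, fun ω => ?_⟩
    simp only [Finsupp.sum, Finset.sum_apply, Pi.smul_apply, smul_eq_mul,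
      sum_apply, smul_apply, ContinuousLinearMap.proj_apply,
      Finset.restrict_def]
    exact (Finset.sum_coe_sort c.support (fun i => c i * X i ω)).symm
  have hG : IsGaussianProcess
      (fun (Y : Submodule.span ℝ (Set.range X)) (ω : Ω) => (Y : Ω → ℝ) ω) P :=
    hX.of_isGaussianProcess fun Y => key Y.1 Y.2
  refine ⟨hG, fun Y hY => ?_⟩
  induction hY using Submodule.span_induction with
  | mem Y h => obtain ⟨t, rfl⟩ := h; exact hm t
  | zero => simp
  | add Y Z hY hZ h1 h2 =>
    have hi : ∀ Y ∈ Submodule.span ℝ (Set.range X), Integrable Y P := fun Y hY =>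
      (hG.hasGaussianLaw_eval ⟨Y, hY⟩).integrable
    simp only [Pi.add_apply]
    rw [integral_add (hi _ hY) (hi _ hZ), h1, h2, add_zero]
  | smul a Y hY h => simp [integral_const_mul, h]

/-- The moment of order `2k` of the standard Gaussian distribution. -/
noncomputable def gaussMoment (k : ℕ) : ℝ := ∫ x, x ^ (2 * k) ∂gaussianReal 0 1

theorem gaussMoment_nonneg (k : ℕ) : 0 ≤ gaussMoment k :=
  integral_nonneg fun x => (even_two_mul k).pow_nonneg x

/-- Cauchy–Schwarz inequality in the form in which upper bounds of the norms are given. -/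
theorem abs_integral_mul_le {X Y : Ω → ℝ} {a b : ℝ} (ha : 0 < a) (hb : 0 < b)
    (hX : Integrable (fun ω => X ω ^ 2) P) (hY : Integrable (fun ω => Y ω ^ 2) P)
    (hXa : ∫ ω, X ω ^ 2 ∂P ≤ a ^ 2) (hYb : ∫ ω, Y ω ^ 2 ∂P ≤ b ^ 2) :
    |∫ ω, X ω * Y ω ∂P| ≤ a * b := by
  rw [← Real.norm_eq_abs]
  calc ‖∫ ω, X ω * Y ω ∂P‖
      ≤ ∫ ω, (b / (2 * a) * X ω ^ 2 + a / (2 * b) * Y ω ^ 2) ∂P := by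
        refine norm_integral_le_of_norm_le ((hX.const_mul _).add (hY.const_mul _))
          (ae_of_all _ fun ω => ?_)
        rw [Real.norm_eq_abs, abs_mul, ← sq_abs (X ω), ← sq_abs (Y ω)]
        have : b / (2 * a) * |X ω| ^ 2 + a / (2 * b) * |Y ω| ^ 2 - |X ω| * |Y ω| =
            (b * |X ω| - a * |Y ω|) ^ 2 / (2 * a * b) := by field_simp; ring
        have h2 : 0 ≤ (b * |X ω| - a * |Y ω|) ^ 2 / (2 * a * b) := by positivity
        linarith
    _ = b / (2 * a) * ∫ ω, X ω ^ 2 ∂P + a / (2 * b) * ∫ ω, Y ω ^ 2 ∂P := by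
        rw [integral_add (hX.const_mul _) (hY.const_mul _), integral_const_mul, integral_const_mul]
    _ ≤ b / (2 * a) * a ^ 2 + a / (2 * b) * b ^ 2 := by gcongr
    _ = a * b := by field_simp; ring

/-- Hölder's inequality for four factors in `L⁴`, with given upper bounds of the norms. -/
theorem abs_integral_mul_mul_mul_le {X Y Z W : Ω → ℝ} {a b c d : ℝ} (ha : 0 < a) (hb : 0 < b)
    (hc : 0 < c) (hd : 0 < d)
    (hX : Integrable (fun ω => X ω ^ 4) P) (hY : Integrable (fun ω => Y ω ^ 4) P)
    (hZ : Integrable (fun ω => Z ω ^ 4) P) (hW : Integrable (fun ω => W ω ^ 4) P)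
    (hXa : ∫ ω, X ω ^ 4 ∂P ≤ a ^ 4) (hYb : ∫ ω, Y ω ^ 4 ∂P ≤ b ^ 4)
    (hZc : ∫ ω, Z ω ^ 4 ∂P ≤ c ^ 4) (hWd : ∫ ω, W ω ^ 4 ∂P ≤ d ^ 4) :
    |∫ ω, X ω * Y ω * (Z ω * W ω) ∂P| ≤ a * b * c * d := by
  have hp : ∀ x y z w : ℝ, |x * y * (z * w)| ≤ (x ^ 4 + y ^ 4 + z ^ 4 + w ^ 4) / 4 := by
    intro x y z w
    refine abs_le.2 ⟨?_, ?_⟩ <;>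
    nlinarith [sq_nonneg (x * y + z * w), sq_nonneg (x * y - z * w), sq_nonneg (x ^ 2 - y ^ 2),
      sq_nonneg (z ^ 2 - w ^ 2)]
  rw [← Real.norm_eq_abs]
  set q := a * b * c * d / 4
  have hi : Integrable (fun ω => q * (1 / a ^ 4 * X ω ^ 4 + 1 / b ^ 4 * Y ω ^ 4 +
      1 / c ^ 4 * Z ω ^ 4 + 1 / d ^ 4 * W ω ^ 4)) P :=
    ((((hX.const_mul _).add (hY.const_mul _)).add (hZ.const_mul _)).add
      (hW.const_mul _)).const_mul _
  calc ‖∫ ω, X ω * Y ω * (Z ω * W ω) ∂P‖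
      ≤ ∫ ω, q * (1 / a ^ 4 * X ω ^ 4 + 1 / b ^ 4 * Y ω ^ 4 +
      1 / c ^ 4 * Z ω ^ 4 + 1 / d ^ 4 * W ω ^ 4) ∂P := by
        refine norm_integral_le_of_norm_le hi (ae_of_all _ fun ω => ?_)
        have := hp (X ω / a) (Y ω / b) (Z ω / c) (W ω / d)
        have e : X ω * Y ω * (Z ω * W ω) =
            (a * b * c * d) * (X ω / a * (Y ω / b) * (Z ω / c * (W ω / d))) := by
          field_simp
        rw [e, Real.norm_eq_abs, abs_mul, abs_of_pos (by positivity : 0 < a * b * c * d)]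
        refine (mul_le_mul_of_nonneg_left this (by positivity)).trans (le_of_eq ?_)
        simp only [q, div_pow]
        ring
    _ = q * (1 / a ^ 4 * ∫ ω, X ω ^ 4 ∂P + 1 / b ^ 4 * ∫ ω, Y ω ^ 4 ∂P +
      1 / c ^ 4 * ∫ ω, Z ω ^ 4 ∂P + 1 / d ^ 4 * ∫ ω, W ω ^ 4 ∂P) := by
        rw [integral_const_mul, integral_add _ (hW.const_mul _), integral_add _ (hZ.const_mul _),
          integral_add (hX.const_mul _) (hY.const_mul _)]
        · simp only [integral_const_mul]
        · exact (hX.const_mul _).add (hY.const_mul _)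
        · exact ((hX.const_mul _).add (hY.const_mul _)).add (hZ.const_mul _)
    _ ≤ q * (1 / a ^ 4 * a ^ 4 + 1 / b ^ 4 * b ^ 4 + 1 / c ^ 4 * c ^ 4 + 1 / d ^ 4 * d ^ 4) := by
        gcongr
    _ = a * b * c * d := by simp only [q]; field_simp; ring

/-- Solution of the normal equations of a linear regression on two variables, in terms of a lower
bound `½ (x² A + y² D)` of the covariance form of these variables. -/
theorem exists_normalEquations {uu uv vv A D : ℝ} (hA : 0 < A) (hD : 0 < D)
    (h : ∀ x y : ℝ, 1 / 2 * (x ^ 2 * A + y ^ 2 * D) ≤ x ^ 2 * uu + 2 * (x * y) * uv + y ^ 2 * vv)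
    (p q : ℝ) : ∃ a b : ℝ, a * uu + b * uv = p ∧ a * uv + b * vv = q ∧
      a ^ 2 * uu + 2 * (a * b) * uv + b ^ 2 * vv ≤ 2 * (p ^ 2 / A + q ^ 2 / D) := by
  have huu : 0 < uu := by have := h 1 0; norm_num at this; linarith
  have hdet : 0 < uu * vv - uv ^ 2 := by
    have h1 := h (-uv) uu
    have h2 : 0 < 1 / 2 * ((-uv) ^ 2 * A + uu ^ 2 * D) := by positivity
    have h3 : (-uv) ^ 2 * uu + 2 * (-uv * uu) * uv + uu ^ 2 * vv = uu * (uu * vv - uv ^ 2) := by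
      ring
    rw [h3] at h1
    exact pos_of_mul_pos_right (h2.trans_le h1) huu.le
  set a := (p * vv - q * uv) / (uu * vv - uv ^ 2)
  set b := (q * uu - p * uv) / (uu * vv - uv ^ 2)
  have e1 : a * uu + b * uv = p := by
    simp only [a, b]; rw [div_mul_eq_mul_div, div_mul_eq_mul_div, ← add_div, div_eq_iff hdet.ne']
    ring
  have e2 : a * uv + b * vv = q := by
    simp only [a, b]; rw [div_mul_eq_mul_div, div_mul_eq_mul_div, ← add_div, div_eq_iff hdet.ne']
    ring
  refine ⟨a, b, e1, e2, ?_⟩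
  have h1 := h a b
  have e3 : a ^ 2 * uu + 2 * (a * b) * uv + b ^ 2 * vv = a * p + b * q := by
    rw [← e1, ← e2]; ring
  rw [e3] at h1 ⊢
  have h2 : a * p ≤ 1 / 4 * (a ^ 2 * A) + p ^ 2 / A := by
    have : 1 / 4 * (a ^ 2 * A) + p ^ 2 / A - a * p = (a * A - 2 * p) ^ 2 / (4 * A) := by
      field_simp; ring
    have : 0 ≤ (a * A - 2 * p) ^ 2 / (4 * A) := by positivity
    linarith
  have h3 : b * q ≤ 1 / 4 * (b ^ 2 * D) + q ^ 2 / D := by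
    have : 1 / 4 * (b ^ 2 * D) + q ^ 2 / D - b * q = (b * D - 2 * q) ^ 2 / (4 * D) := by
      field_simp; ring
    have : 0 ≤ (b * D - 2 * q) ^ 2 / (4 * D) := by positivity
    linarith
  linarith

namespace IsGaussianSpace

variable {E : Submodule ℝ (Ω → ℝ)} {X Y U V : Ω → ℝ}

theorem hasGaussianLaw (hE : IsGaussianSpace E P) (hX : X ∈ E) : HasGaussianLaw X P :=
  hE.gaussian.hasGaussianLaw_eval ⟨X, hX⟩

theorem memLp (hE : IsGaussianSpace E P) (hX : X ∈ E) {p : ℝ≥0∞} (hp : p ≠ ∞) : MemLp X p P :=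
  (hE.hasGaussianLaw hX).memLp hp

theorem integrable_pow (hE : IsGaussianSpace E P) (hX : X ∈ E) (n : ℕ) :
    Integrable (fun ω => X ω ^ n) P := by
  have := hE.gaussian.isProbabilityMeasure
  rcases eq_or_ne n 0 with rfl | hn
  · simp
  have := (hE.memLp hX (ENNReal.natCast_ne_top n)).integrable_norm_pow hn
  rw [← integrable_norm_iff ((hE.hasGaussianLaw hX).aemeasurable.pow_const n).aestronglyMeasurable]
  simpa [norm_pow] using this

theorem integrable_mul (hE : IsGaussianSpace E P) (hX : X ∈ E) (hY : Y ∈ E) :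
    Integrable (fun ω => X ω * Y ω) P :=
  (hE.memLp hX (p := 2) ENNReal.ofNat_ne_top).integrable_mul
    (hE.memLp hY (p := 2) ENNReal.ofNat_ne_top)

theorem covariance_eq (hE : IsGaussianSpace E P) (hX : X ∈ E) (hY : Y ∈ E) :
    cov[X, Y; P] = ∫ ω, X ω * Y ω ∂P := by
  have := hE.gaussian.isProbabilityMeasure
  rw [covariance_eq_sub (hE.memLp hX (by norm_num)) (hE.memLp hY (by norm_num)), hE.mean X hX]
  simp

theorem map_eq (hE : IsGaussianSpace E P) (hX : X ∈ E) :
    P.map X = gaussianReal 0 (∫ ω, X ω ^ 2 ∂P).toNNReal := by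
  rw [(hE.hasGaussianLaw hX).map_eq_gaussianReal, hE.mean X hX,
    variance_of_integral_eq_zero (hE.hasGaussianLaw hX).aemeasurable (hE.mean X hX)]

theorem integral_pow_two_mul (hE : IsGaussianSpace E P) (hX : X ∈ E) (k : ℕ) :
    ∫ ω, X ω ^ (2 * k) ∂P = gaussMoment k * (∫ ω, X ω ^ 2 ∂P) ^ k := by
  set v := ∫ ω, X ω ^ 2 ∂P
  have hv : 0 ≤ v := integral_nonneg fun ω => sq_nonneg _
  have h1 : ∫ ω, X ω ^ (2 * k) ∂P = ∫ x, x ^ (2 * k) ∂(P.map X) :=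
    (integral_map (hE.hasGaussianLaw hX).aemeasurable
      (continuous_pow _).aestronglyMeasurable).symm
  have h2 : gaussianReal 0 v.toNNReal = (gaussianReal 0 1).map (√v * ·) := by
    rw [gaussianReal_map_const_mul]
    congr 1
    · simp
    · ext; simp [Real.sq_sqrt hv, hv]
  rw [h1, hE.map_eq hX, h2, integral_map (by fun_prop)
    (continuous_pow _).aestronglyMeasurable]
  simp only [mul_pow]
  rw [integral_const_mul, pow_mul, Real.sq_sqrt hv, mul_comm, gaussMoment]

/-- Orthogonality of pairs in a Gaussian space implies their independence. -/
theorem indepFun (hE : IsGaussianSpace E P) {N M : Ω → ℝ} (hU : U ∈ E) (hV : V ∈ E) (hN : N ∈ E)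
    (hM : M ∈ E) (hUN : ∫ ω, U ω * N ω ∂P = 0) (hUM : ∫ ω, U ω * M ω ∂P = 0)
    (hVN : ∫ ω, V ω * N ω ∂P = 0) (hVM : ∫ ω, V ω * M ω ∂P = 0) :
    IndepFun (fun ω => (U ω, V ω)) (fun ω => (N ω, M ω)) P := by
  let a : Fin 2 → E := ![⟨U, hU⟩, ⟨V, hV⟩]
  let b : Fin 2 → E := ![⟨N, hN⟩, ⟨M, hM⟩]
  have hG : IsGaussianProcess (Sum.elim (fun i ω => (a i : Ω → ℝ) ω)
      (fun i ω => (b i : Ω → ℝ) ω)) P := by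
    have e : Sum.elim (fun i ω => (a i : Ω → ℝ) ω) (fun i ω => (b i : Ω → ℝ) ω) =
        (fun (X : E) (ω : Ω) => (X : Ω → ℝ) ω) ∘ Sum.elim a b := by
      ext i ω
      cases i <;> rfl
    rw [e]
    exact hE.gaussian.comp_right _
  have h := hG.indepFun_of_covariance_eq_zero
    (fun i => (hE.hasGaussianLaw (a i).2).aemeasurable)
    (fun i => (hE.hasGaussianLaw (b i).2).aemeasurable) (fun i j => by
      rw [hE.covariance_eq (a i).2 (b j).2]
      fin_cases i <;> fin_cases j <;> simpa [a, b])
  exact h.comp (φ := fun x : Fin 2 → ℝ => (x 0, x 1)) (ψ := fun x : Fin 2 → ℝ => (x 0, x 1))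
    (by fun_prop) (by fun_prop)

end IsGaussianSpace

/-! ### Gaussian regression -/

namespace IsGaussianSpace

variable {E : Submodule ℝ (Ω → ℝ)} {X Y U V : Ω → ℝ}

theorem integral_linComb_mul (hE : IsGaussianSpace E P) (hX : X ∈ E) (hU : U ∈ E) (hV : V ∈ E)
    (hY : Y ∈ E) (a b : ℝ) :
    ∫ ω, (X ω - (a * U ω + b * V ω)) * Y ω ∂P =
      ∫ ω, X ω * Y ω ∂P - (a * ∫ ω, U ω * Y ω ∂P + b * ∫ ω, V ω * Y ω ∂P) := by
  have h1 := hE.integrable_mul hX hY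
  have h2 := hE.integrable_mul hU hY
  have h3 := hE.integrable_mul hV hY
  have e : ∀ ω, (X ω - (a * U ω + b * V ω)) * Y ω =
      X ω * Y ω - (a * (U ω * Y ω) + b * (V ω * Y ω)) := fun ω => by ring
  simp only [e]
  rw [integral_sub h1 ((h2.const_mul a).fun_add (h3.const_mul b)),
    integral_add (h2.const_mul a) (h3.const_mul b), integral_const_mul, integral_const_mul]

theorem integral_sq_linComb (hE : IsGaussianSpace E P) (hU : U ∈ E) (hV : V ∈ E) (a b : ℝ) :
    ∫ ω, (a * U ω + b * V ω) ^ 2 ∂P = a ^ 2 * ∫ ω, U ω ^ 2 ∂P +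
      2 * (a * b) * ∫ ω, U ω * V ω ∂P + b ^ 2 * ∫ ω, V ω ^ 2 ∂P := by
  have h1 := hE.integrable_pow hU 2
  have h2 := hE.integrable_mul hU hV
  have h3 := hE.integrable_pow hV 2
  have e : ∀ ω, (a * U ω + b * V ω) ^ 2 =
      a ^ 2 * U ω ^ 2 + 2 * (a * b) * (U ω * V ω) + b ^ 2 * V ω ^ 2 := fun ω => by ring
  simp only [e]
  rw [integral_add ((h1.const_mul _).fun_add (h2.const_mul _)) (h3.const_mul _),
    integral_add (h1.const_mul _) (h2.const_mul _), integral_const_mul, integral_const_mul,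
    integral_const_mul]

/-- The conditional expectation formula for a product of two Gaussian variables, written as sums of
a part `Lᵢ` in the span of `U, V` and a part `Nᵢ` orthogonal to `U, V`. -/
theorem integral_mul_regression (hE : IsGaussianSpace E P) {N M : Ω → ℝ} (hU : U ∈ E)
    (hV : V ∈ E) (hN : N ∈ E) (hM : M ∈ E) (hUN : ∫ ω, U ω * N ω ∂P = 0)
    (hUM : ∫ ω, U ω * M ω ∂P = 0) (hVN : ∫ ω, V ω * N ω ∂P = 0) (hVM : ∫ ω, V ω * M ω ∂P = 0)
    {ψ : ℝ × ℝ → ℝ} (hψ : Measurable ψ) {C : ℝ} (hC : ∀ x, |ψ x| ≤ C) (a b a' b' : ℝ) :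
    ∫ ω, ψ (U ω, V ω) * ((a * U ω + b * V ω + N ω) * (a' * U ω + b' * V ω + M ω)) ∂P =
      ∫ ω, ψ (U ω, V ω) * ((a * U ω + b * V ω) * (a' * U ω + b' * V ω)) ∂P +
        (∫ ω, ψ (U ω, V ω) ∂P) * ∫ ω, N ω * M ω ∂P := by
  have hUV : AEMeasurable (fun ω => (U ω, V ω)) P :=
    (hE.hasGaussianLaw hU).aemeasurable.prodMk (hE.hasGaussianLaw hV).aemeasurable
  have hNM : AEMeasurable (fun ω => (N ω, M ω)) P :=
    (hE.hasGaussianLaw hN).aemeasurable.prodMk (hE.hasGaussianLaw hM).aemeasurable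
  have hi := hE.indepFun hU hV hN hM hUN hUM hVN hVM
  have hL : (fun ω => a * U ω + b * V ω) ∈ E := E.add_mem (E.smul_mem a hU) (E.smul_mem b hV)
  have hL' : (fun ω => a' * U ω + b' * V ω) ∈ E :=
    E.add_mem (E.smul_mem a' hU) (E.smul_mem b' hV)
  have hb : ∀ {Z : Ω → ℝ}, Integrable Z P → Integrable (fun ω => ψ (U ω, V ω) * Z ω) P :=
    fun hZ => hZ.bdd_mul (hψ.comp_aemeasurable hUV).aestronglyMeasurable
      (ae_of_all _ fun ω => (Real.norm_eq_abs _).trans_le (hC _))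
  have m1 : Measurable fun x : ℝ × ℝ => ψ x * (a * x.1 + b * x.2) := by fun_prop
  have m2 : Measurable fun x : ℝ × ℝ => ψ x * (a' * x.1 + b' * x.2) := by fun_prop
  have e1 : ∫ ω, ψ (U ω, V ω) * ((a * U ω + b * V ω) * M ω) ∂P = 0 := by
    have := hi.integral_fun_comp_mul_comp hUV hNM (f := fun x => ψ x * (a * x.1 + b * x.2))
      (g := fun x => x.2) m1.aestronglyMeasurable measurable_snd.aestronglyMeasurable
    simp only [hE.mean M hM, mul_zero] at this
    simpa only [mul_assoc] using this
  have e2 : ∫ ω, ψ (U ω, V ω) * ((a' * U ω + b' * V ω) * N ω) ∂P = 0 := by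
    have := hi.integral_fun_comp_mul_comp hUV hNM (f := fun x => ψ x * (a' * x.1 + b' * x.2))
      (g := fun x => x.1) m2.aestronglyMeasurable measurable_fst.aestronglyMeasurable
    simp only [hE.mean N hN, mul_zero] at this
    simpa only [mul_assoc] using this
  have e3 : ∫ ω, ψ (U ω, V ω) * (N ω * M ω) ∂P =
      (∫ ω, ψ (U ω, V ω) ∂P) * ∫ ω, N ω * M ω ∂P :=
    hi.integral_fun_comp_mul_comp hUV hNM (f := ψ)
      (g := fun x => x.1 * x.2) hψ.aestronglyMeasurable
      (measurable_fst.mul measurable_snd).aestronglyMeasurable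
  have e : ∀ ω, ψ (U ω, V ω) * ((a * U ω + b * V ω + N ω) * (a' * U ω + b' * V ω + M ω)) =
      ψ (U ω, V ω) * ((a * U ω + b * V ω) * (a' * U ω + b' * V ω)) +
      ψ (U ω, V ω) * ((a * U ω + b * V ω) * M ω) + ψ (U ω, V ω) * ((a' * U ω + b' * V ω) * N ω) +
      ψ (U ω, V ω) * (N ω * M ω) := fun ω => by ring
  simp only [e]
  have i1 := hb (hE.integrable_mul hL hL')
  have i2 := hb (hE.integrable_mul hL hM)
  have i3 := hb (hE.integrable_mul hL' hN)
  have i4 := hb (hE.integrable_mul hN hM)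
  rw [integral_add ((i1.fun_add i2).fun_add i3) i4, integral_add (i1.fun_add i2) i3,
    integral_add i1 i2, e1, e2, e3, add_zero, add_zero]

theorem integral_pow_four_le (hE : IsGaussianSpace E P) (hX : X ∈ E) {β : ℝ}
    (h : ∫ ω, X ω ^ 2 ∂P ≤ β ^ 2) :
    ∫ ω, X ω ^ 4 ∂P ≤ ((gaussMoment 2 + 1) * β) ^ 4 := by
  have h0 := gaussMoment_nonneg 2
  have h1 : 0 ≤ ∫ ω, X ω ^ 2 ∂P := integral_nonneg fun ω => sq_nonneg _
  rw [hE.integral_pow_two_mul hX 2, mul_pow]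
  have h2 : (∫ ω, X ω ^ 2 ∂P) ^ 2 ≤ β ^ 4 := by
    calc _ ≤ (β ^ 2) ^ 2 := by gcongr
      _ = β ^ 4 := by ring
  have h3 : gaussMoment 2 ≤ (gaussMoment 2 + 1) ^ 4 :=
    (by linarith : gaussMoment 2 ≤ gaussMoment 2 + 1).trans
      (le_self_pow₀ (by linarith) (by norm_num))
  exact mul_le_mul h3 h2 (sq_nonneg _) (by positivity)

end IsGaussianSpace

/-- The constant in the regression estimate for products of Gaussian variables. -/
noncomputable def regressionConst : ℝ := 4 * (gaussMoment 2 + 1) ^ 2 + 4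

theorem regressionConst_pos : 0 < regressionConst := by unfold regressionConst; positivity

namespace IsGaussianSpace

variable {E : Submodule ℝ (Ω → ℝ)} {X Y U V : Ω → ℝ}

theorem exists_projection (hE : IsGaussianSpace E P) (hX : X ∈ E) (hU : U ∈ E) (hV : V ∈ E)
    {A D B : ℝ} (hA : 0 < A) (hD : 0 < D)
    (h : ∀ x y : ℝ, 1 / 2 * (x ^ 2 * A + y ^ 2 * D) ≤ x ^ 2 * ∫ ω, U ω ^ 2 ∂P +
      2 * (x * y) * ∫ ω, U ω * V ω ∂P + y ^ 2 * ∫ ω, V ω ^ 2 ∂P)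
    (hB : (∫ ω, X ω * U ω ∂P) ^ 2 / A + (∫ ω, X ω * V ω ∂P) ^ 2 / D ≤ B ^ 2) :
    ∃ a b : ℝ, ∫ ω, U ω * (X ω - (a * U ω + b * V ω)) ∂P = 0 ∧
      ∫ ω, V ω * (X ω - (a * U ω + b * V ω)) ∂P = 0 ∧
      ∫ ω, (a * U ω + b * V ω) ^ 2 ∂P ≤ (2 * B) ^ 2 := by
  obtain ⟨a, b, h1, h2, h3⟩ := exists_normalEquations hA hD h (∫ ω, X ω * U ω ∂P)
    (∫ ω, X ω * V ω ∂P)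
  refine ⟨a, b, ?_, ?_, ?_⟩
  · simp only [mul_comm (U _)]
    rw [hE.integral_linComb_mul hX hU hV hU]
    simp only [← sq, mul_comm (V _) (U _)]
    linarith
  · simp only [mul_comm (V _)]
    rw [hE.integral_linComb_mul hX hU hV hV]
    simp only [← sq]
    linarith
  · rw [hE.integral_sq_linComb hU hV]
    nlinarith [sq_nonneg B]

/-- Regression estimate: if the two variables `U, V` are quantitatively non-degenerate, then the
weak correlation of `X` and `Y` with `U` and `V` and with each other controls
`E[ψ₁(U, V) ψ₂(U, V) X Y]` without any regularity of `ψ₁` and `ψ₂`. -/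
theorem abs_integral_mul_mul_le_of_regression (hE : IsGaussianSpace E P) (hX : X ∈ E) (hY : Y ∈ E)
    (hU : U ∈ E) (hV : V ∈ E) {A D B₁ B₂ S e : ℝ} (hA : 0 < A) (hD : 0 < D)
    (h : ∀ x y : ℝ, 1 / 2 * (x ^ 2 * A + y ^ 2 * D) ≤ x ^ 2 * ∫ ω, U ω ^ 2 ∂P +
      2 * (x * y) * ∫ ω, U ω * V ω ∂P + y ^ 2 * ∫ ω, V ω ^ 2 ∂P)
    (hB₁0 : 0 < B₁) (hB₂0 : 0 < B₂)
    (hB₁ : (∫ ω, X ω * U ω ∂P) ^ 2 / A + (∫ ω, X ω * V ω ∂P) ^ 2 / D ≤ B₁ ^ 2)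
    (hB₂ : (∫ ω, Y ω * U ω ∂P) ^ 2 / A + (∫ ω, Y ω * V ω ∂P) ^ 2 / D ≤ B₂ ^ 2)
    (he : |∫ ω, X ω * Y ω ∂P| ≤ e) {ψ₁ ψ₂ : ℝ × ℝ → ℝ} (hψ₁ : Measurable ψ₁)
    (hψ₂ : Measurable ψ₂) {C : ℝ} (hC₁ : ∀ x, |ψ₁ x| ≤ C) (hC₂ : ∀ x, |ψ₂ x| ≤ C) (hS : 0 < S)
    (hS₁ : ∫ ω, ψ₁ (U ω, V ω) ^ 4 ∂P ≤ S ^ 4) (hS₂ : ∫ ω, ψ₂ (U ω, V ω) ^ 4 ∂P ≤ S ^ 4) :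
    |∫ ω, ψ₁ (U ω, V ω) * ψ₂ (U ω, V ω) * (X ω * Y ω) ∂P| ≤
      S ^ 2 * (e + regressionConst * (B₁ * B₂)) := by
  have hP := hE.gaussian.isProbabilityMeasure
  obtain ⟨a, b, hUN, hVN, hL⟩ := hE.exists_projection hX hU hV hA hD h hB₁
  obtain ⟨a', b', hUM, hVM, hL'⟩ := hE.exists_projection hY hU hV hA hD h hB₂
  have hC0 : 0 ≤ C := (abs_nonneg _).trans (hC₁ 0)
  have mL : (fun ω => a * U ω + b * V ω) ∈ E := E.add_mem (E.smul_mem a hU) (E.smul_mem b hV)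
  have mL' : (fun ω => a' * U ω + b' * V ω) ∈ E :=
    E.add_mem (E.smul_mem a' hU) (E.smul_mem b' hV)
  have mN : (fun ω => X ω - (a * U ω + b * V ω)) ∈ E := E.sub_mem hX mL
  have mM : (fun ω => Y ω - (a' * U ω + b' * V ω)) ∈ E := E.sub_mem hY mL'
  have key := fun (ψ : ℝ × ℝ → ℝ) (hψ : Measurable ψ) (C : ℝ) (hC : ∀ x, |ψ x| ≤ C) =>
    hE.integral_mul_regression hU hV mN mM hUN hUM hVN hVM hψ hC a b a' b'
  simp only [add_sub_cancel] at key
  have key1 := key (fun x => ψ₁ x * ψ₂ x) (hψ₁.mul hψ₂) (C * C) (fun x => by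
    rw [abs_mul]; exact mul_le_mul (hC₁ x) (hC₂ x) (abs_nonneg _) hC0)
  have key2 := key (fun _ => 1) measurable_const 1 (by simp)
  simp only [one_mul, integral_const, probReal_univ, smul_eq_mul] at key2
  rw [key1]
  have hUV : AEMeasurable (fun ω => (U ω, V ω)) P :=
    (hE.hasGaussianLaw hU).aemeasurable.prodMk (hE.hasGaussianLaw hV).aemeasurable
  have hbdd : ∀ {ψ : ℝ × ℝ → ℝ}, Measurable ψ → (∀ x, |ψ x| ≤ C) →
      Integrable (fun ω => ψ (U ω, V ω) ^ 4) P := fun {ψ} hψ hC =>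
    Integrable.of_bound ((hψ.comp_aemeasurable hUV).pow_const 4).aestronglyMeasurable (C ^ 4)
      (ae_of_all _ fun ω => by
        rw [norm_pow, Real.norm_eq_abs]; exact pow_le_pow_left₀ (abs_nonneg _) (hC _) 4)
  have hg := gaussMoment_nonneg 2
  set c := gaussMoment 2 + 1
  have hc : 0 < c := by positivity
  have t1 := abs_integral_mul_mul_mul_le hS hS (by positivity : 0 < c * (2 * B₁))
    (by positivity : 0 < c * (2 * B₂)) (hbdd hψ₁ hC₁) (hbdd hψ₂ hC₂) (hE.integrable_pow mL 4)
    (hE.integrable_pow mL' 4) hS₁ hS₂ (hE.integral_pow_four_le mL hL)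
    (hE.integral_pow_four_le mL' hL')
  have t2 := abs_integral_mul_mul_mul_le hS hS one_pos one_pos (hbdd hψ₁ hC₁) (hbdd hψ₂ hC₂)
    (Z := fun _ => 1) (W := fun _ => 1) (by simp) (by simp) hS₁ hS₂ (by simp) (by simp)
  have t3 := abs_integral_mul_le (by positivity : 0 < 2 * B₁) (by positivity : 0 < 2 * B₂)
    (hE.integrable_pow mL 2) (hE.integrable_pow mL' 2) hL hL'
  simp only [mul_one] at t2
  set I := ∫ ω, (X ω - (a * U ω + b * V ω)) * (Y ω - (a' * U ω + b' * V ω)) ∂P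
  have t4 : |I| ≤ e + 2 * B₁ * (2 * B₂) := by
    have : I = ∫ ω, X ω * Y ω ∂P - ∫ ω, (a * U ω + b * V ω) * (a' * U ω + b' * V ω) ∂P := by
      rw [key2]; ring
    rw [this]
    exact (abs_sub _ _).trans (add_le_add he t3)
  refine (abs_add_le _ _).trans ?_
  rw [abs_mul]
  have t5 := mul_le_mul t2 t4 (abs_nonneg _) (by positivity)
  refine (add_le_add t1 t5).trans (le_of_eq ?_)
  unfold regressionConst
  ring

/-- The covariance of the squares of two Gaussian variables is a multiple of the square of their
covariance. -/
theorem integral_sq_sub_mul_sq_sub (hE : IsGaussianSpace E P) (hX : X ∈ E) (hY : Y ∈ E)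
    (h0 : 0 < ∫ ω, X ω ^ 2 ∂P) :
    ∫ ω, (X ω ^ 2 - ∫ ω, X ω ^ 2 ∂P) * (Y ω ^ 2 - ∫ ω, Y ω ^ 2 ∂P) ∂P =
      (gaussMoment 2 - 1) * (∫ ω, X ω * Y ω ∂P) ^ 2 := by
  have hP := hE.gaussian.isProbabilityMeasure
  set v := ∫ ω, X ω ^ 2 ∂P with hv
  set w := ∫ ω, Y ω ^ 2 ∂P
  set β := (∫ ω, X ω * Y ω ∂P) / v
  have mN : (fun ω => Y ω - (β * X ω + 0 * X ω)) ∈ E :=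
    E.sub_mem hY (E.add_mem (E.smul_mem β hX) (E.smul_mem 0 hX))
  have hXN : ∫ ω, X ω * (Y ω - (β * X ω + 0 * X ω)) ∂P = 0 := by
    simp only [mul_comm (X _)]
    rw [hE.integral_linComb_mul hY hX hX hX]
    simp only [← sq, mul_comm (Y _)]
    rw [← hv]
    simp only [β]
    field_simp
    ring
  simp only [zero_mul, add_zero] at mN hXN
  set N := fun ω => Y ω - β * X ω
  have hYN : ∀ ω, Y ω = β * X ω + N ω := fun ω => by simp only [N]; ring
  have hi := hE.indepFun hX hX mN mN hXN hXN hXN hXN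
  have hXm := (hE.hasGaussianLaw hX).aemeasurable
  have hNm := (hE.hasGaussianLaw mN).aemeasurable
  have i1 : ∫ ω, (X ω ^ 2 - v) * X ω * N ω ∂P = 0 := by
    have := hi.integral_fun_comp_mul_comp (hXm.prodMk hXm) (hNm.prodMk hNm)
      (f := fun x => (x.1 ^ 2 - v) * x.1) (g := fun x => x.1)
      (Measurable.aestronglyMeasurable (by fun_prop))
      (Measurable.aestronglyMeasurable (by fun_prop))
    simpa only [hE.mean N mN, mul_zero] using this
  have i0 : ∫ ω, (X ω ^ 2 - v) ∂P = 0 := by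
    rw [integral_sub (hE.integrable_pow hX 2) (integrable_const _)]
    simp [hv]
  have i2 : ∫ ω, (X ω ^ 2 - v) * (N ω ^ 2 - w) ∂P = 0 := by
    have := hi.integral_fun_comp_mul_comp (hXm.prodMk hXm) (hNm.prodMk hNm)
      (f := fun x => x.1 ^ 2 - v) (g := fun x => x.1 ^ 2 - w)
      (Measurable.aestronglyMeasurable (by fun_prop))
      (Measurable.aestronglyMeasurable (by fun_prop))
    simpa only [i0, zero_mul] using this
  have i3 : ∫ ω, (X ω ^ 4 - v * X ω ^ 2) ∂P = (gaussMoment 2 - 1) * v ^ 2 := by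
    rw [integral_sub (hE.integrable_pow hX 4) ((hE.integrable_pow hX 2).const_mul _),
      integral_const_mul, hE.integral_pow_two_mul hX 2, ← hv]
    ring
  have g1 : Integrable (fun ω => X ω ^ 4 - v * X ω ^ 2) P :=
    (hE.integrable_pow hX 4).sub ((hE.integrable_pow hX 2).const_mul _)
  have mul4 : ∀ {Z W : Ω → ℝ}, MemLp Z 2 P → MemLp W 2 P → Integrable (fun ω => Z ω * W ω) P :=
    fun hZ hW => hZ.integrable_mul hW
  have l2 : ∀ {Z : Ω → ℝ}, Z ∈ E → ∀ c, MemLp (fun ω => Z ω ^ 2 - c) 2 P := fun {Z} hZ c => by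
    refine MemLp.sub ?_ (memLp_const c)
    refine (memLp_two_iff_integrable_sq
      ((hE.hasGaussianLaw hZ).aemeasurable.pow_const 2).aestronglyMeasurable).2 ?_
    simpa only [← pow_mul] using hE.integrable_pow hZ 4
  have g2 : Integrable (fun ω => (X ω ^ 2 - v) * X ω * N ω) P := by
    have : MemLp (fun ω => X ω * N ω) 2 P := by
      refine (memLp_two_iff_integrable_sq (hXm.mul hNm).aestronglyMeasurable).2 ?_
      have := mul4 (l2 hX 0) (l2 mN 0)
      simpa only [sub_zero, Pi.mul_apply, mul_pow] using this
    simpa only [mul_assoc] using mul4 (l2 hX v) this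
  have g3 : Integrable (fun ω => (X ω ^ 2 - v) * (N ω ^ 2 - w)) P := mul4 (l2 hX v) (l2 mN w)
  have e : ∀ ω, (X ω ^ 2 - v) * (Y ω ^ 2 - w) = β ^ 2 * (X ω ^ 4 - v * X ω ^ 2) +
      2 * β * ((X ω ^ 2 - v) * X ω * N ω) + (X ω ^ 2 - v) * (N ω ^ 2 - w) := fun ω => by
    rw [hYN ω]; ring
  simp only [e]
  rw [integral_add ((g1.const_mul _).fun_add (g2.const_mul _)) g3,
    integral_add (g1.const_mul _) (g2.const_mul _), integral_const_mul, integral_const_mul, i1, i2,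
    i3]
  simp only [β]
  field_simp
  ring

end IsGaussianSpace

/-! ### Second moments of integrals of random functions -/

section SecondMoment

variable {ν : Measure ℝ} [IsFiniteMeasure ν] [IsFiniteMeasure P] {X : ℝ → Ω → ℝ} {c : ℝ}

theorem integrable_mul_prod (hX : Measurable (Function.uncurry X))
    (hL : ∀ᵐ s ∂ν, MemLp (X s) 2 P) (hc : ∀ᵐ s ∂ν, ∫ ω, X s ω ^ 2 ∂P ≤ c) :
    Integrable (fun q : (ℝ × ℝ) × Ω => X q.1.1 q.2 * X q.1.2 q.2) ((ν.prod ν).prod P) := by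
  have hm : Measurable (fun q : (ℝ × ℝ) × Ω => X q.1.1 q.2 * X q.1.2 q.2) :=
    (hX.comp ((measurable_fst.comp measurable_fst).prodMk measurable_snd)).mul
      (hX.comp ((measurable_snd.comp measurable_fst).prodMk measurable_snd))
  have h1 : ∀ᵐ p ∂(ν.prod ν), MemLp (X p.1) 2 P ∧ ∫ ω, X p.1 ω ^ 2 ∂P ≤ c :=
    Measure.quasiMeasurePreserving_fst.ae (hL.and hc)
  have h2 : ∀ᵐ p ∂(ν.prod ν), MemLp (X p.2) 2 P ∧ ∫ ω, X p.2 ω ^ 2 ∂P ≤ c :=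
    Measure.quasiMeasurePreserving_snd.ae (hL.and hc)
  refine (integrable_prod_iff hm.aestronglyMeasurable).2 ⟨?_, ?_⟩
  · filter_upwards [h1, h2] with p hp1 hp2 using hp1.1.integrable_mul hp2.1
  · refine Integrable.of_bound
      hm.stronglyMeasurable.norm.integral_prod_right.aestronglyMeasurable c ?_
    filter_upwards [h1, h2] with p hp1 hp2
    have i1 := hp1.1.integrable_sq
    have i2 := hp2.1.integrable_sq
    rw [Real.norm_eq_abs, abs_of_nonneg (integral_nonneg fun ω => norm_nonneg _)]
    calc ∫ ω, ‖X p.1 ω * X p.2 ω‖ ∂P ≤ ∫ ω, (1 / 2 * X p.1 ω ^ 2 + 1 / 2 * X p.2 ω ^ 2) ∂P := by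
          refine integral_mono (hp1.1.integrable_mul hp2.1).norm
            ((i1.const_mul _).add (i2.const_mul _)) fun ω => ?_
          simp only [norm_mul, Real.norm_eq_abs]
          rw [← sq_abs (X p.1 ω), ← sq_abs (X p.2 ω)]
          nlinarith [sq_nonneg (|X p.1 ω| - |X p.2 ω|)]
      _ ≤ c := by
          rw [integral_add (i1.const_mul _) (i2.const_mul _), integral_const_mul,
            integral_const_mul]
          linarith [hp1.2, hp2.2]

theorem integral_sq_integral (hX : Measurable (Function.uncurry X))
    (hL : ∀ᵐ s ∂ν, MemLp (X s) 2 P) (hc : ∀ᵐ s ∂ν, ∫ ω, X s ω ^ 2 ∂P ≤ c) :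
    ∫ ω, (∫ s, X s ω ∂ν) ^ 2 ∂P = ∫ p, (∫ ω, X p.1 ω * X p.2 ω ∂P) ∂(ν.prod ν) := by
  have h := integrable_mul_prod hX hL hc
  rw [integral_integral_swap (f := fun (p : ℝ × ℝ) ω => X p.1 ω * X p.2 ω) h]
  refine integral_congr_ae (ae_of_all _ fun ω => ?_)
  simp only [sq]
  rw [integral_prod_mul (fun s => X s ω) (fun s => X s ω)]

theorem memLp_two_integral (hX : Measurable (Function.uncurry X))
    (hL : ∀ᵐ s ∂ν, MemLp (X s) 2 P) (hc : ∀ᵐ s ∂ν, ∫ ω, X s ω ^ 2 ∂P ≤ c) :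
    MemLp (fun ω => ∫ s, X s ω ∂ν) 2 P := by
  have h := (integrable_mul_prod hX hL hc).integral_prod_right
  refine (memLp_two_iff_integrable_sq
    hX.stronglyMeasurable.integral_prod_left.aestronglyMeasurable).2 ?_
  refine h.congr (ae_of_all _ fun ω => ?_)
  simp only [sq]
  rw [integral_prod_mul (fun s => X s ω) (fun s => X s ω)]

/-- A second moment bound in terms of a bound `k` on the covariance kernel below the diagonal. -/
theorem integral_sq_setIntegral_le_of_kernel {a b c' : ℝ} (hab : a ≤ b) (ha : 0 ≤ a)
    (hX : Measurable (Function.uncurry X))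
    (hL : ∀ s ∈ Set.Ioc a b, MemLp (X s) 2 P) (hc : ∀ s ∈ Set.Ioc a b, ∫ ω, X s ω ^ 2 ∂P ≤ c)
    {k : ℝ → ℝ → ℝ} (hk : Measurable (Function.uncurry k))
    (hXk : ∀ s ∈ Set.Ioc a b, ∀ r ∈ Set.Ioc a b, r ≤ s → |∫ ω, X s ω * X r ω ∂P| ≤ k s r)
    (hc' : 0 ≤ c')
    (hkc : ∀ s ∈ Set.Ioc a b, ∫⁻ r in Set.Ioc 0 s, ENNReal.ofReal (k s r) ≤ ENNReal.ofReal c') :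
    ∫ ω, (∫ s in Set.Ioc a b, X s ω) ^ 2 ∂P ≤ 2 * c' * (b - a) := by
  set ν := (volume : Measure ℝ).restrict (Set.Ioc a b) with hν
  have hmem : ∀ᵐ s ∂ν, s ∈ Set.Ioc a b := ae_restrict_mem measurableSet_Ioc
  rw [integral_sq_integral (hmem.mono hL) (c := c) (hmem.mono hc) (hX := hX)]
  have hset : MeasurableSet {p : ℝ × ℝ | p.2 ≤ p.1} :=
    measurableSet_le measurable_snd measurable_fst
  set F : ℝ × ℝ → ℝ≥0∞ :=
    Set.indicator {p : ℝ × ℝ | p.2 ≤ p.1} (fun p => ENNReal.ofReal (k p.1 p.2)) with hF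
  have hFm : Measurable F := hk.ennreal_ofReal.indicator hset
  have hFint : ∫⁻ p, F p ∂(ν.prod ν) ≤ ENNReal.ofReal (c' * (b - a)) := by
    rw [lintegral_prod _ hFm.aemeasurable]
    calc ∫⁻ s, ∫⁻ r, F (s, r) ∂ν ∂ν ≤ ∫⁻ _, ENNReal.ofReal c' ∂ν := by
          refine lintegral_mono_ae (hmem.mono fun s hs => ?_)
          refine le_trans ?_ (hkc s hs)
          have : ∀ r, F (s, r) = Set.indicator (Set.Iic s) (fun r => ENNReal.ofReal (k s r)) r :=
            fun r => by simp [hF, Set.indicator]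
          simp only [this]
          rw [lintegral_indicator measurableSet_Iic, hν,
            Measure.restrict_restrict measurableSet_Iic]
          exact lintegral_mono_set fun r hr => ⟨ha.trans_lt hr.2.1, hr.1⟩
      _ = ENNReal.ofReal (c' * (b - a)) := by
          rw [lintegral_const, hν, Measure.restrict_apply_univ, Real.volume_Ioc,
            ENNReal.ofReal_mul hc']
  have hmem2 : ∀ᵐ p ∂(ν.prod ν), p.1 ∈ Set.Ioc a b ∧ p.2 ∈ Set.Ioc a b :=
    (Measure.quasiMeasurePreserving_fst.ae hmem).and (Measure.quasiMeasurePreserving_snd.ae hmem)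
  have hb : 0 ≤ c' * (b - a) := mul_nonneg hc' (sub_nonneg.2 hab)
  have hn : ∫⁻ p, ‖∫ ω, X p.1 ω * X p.2 ω ∂P‖ₑ ∂(ν.prod ν) ≤ ENNReal.ofReal (2 * c' * (b - a)) := by
    calc _ ≤ ∫⁻ p, (F p + F p.swap) ∂(ν.prod ν) := by
          refine lintegral_mono_ae (hmem2.mono fun p hp => ?_)
          rw [← ofReal_norm, Real.norm_eq_abs]
          rcases le_total p.2 p.1 with h | h
          · refine le_trans ?_ le_self_add
            rw [hF, Set.indicator_of_mem (by exact h)]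
            exact ENNReal.ofReal_le_ofReal (hXk _ hp.1 _ hp.2 h)
          · refine le_trans ?_ le_add_self
            rw [hF, Set.indicator_of_mem (by exact h)]
            simp only [mul_comm (X p.1 _)]
            exact ENNReal.ofReal_le_ofReal (hXk _ hp.2 _ hp.1 h)
      _ = ∫⁻ p, F p ∂(ν.prod ν) + ∫⁻ p, F p ∂(ν.prod ν) := by
          rw [lintegral_add_left hFm, lintegral_prod_swap]
      _ ≤ ENNReal.ofReal (c' * (b - a)) + ENNReal.ofReal (c' * (b - a)) := add_le_add hFint hFint
      _ = ENNReal.ofReal (2 * c' * (b - a)) := by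
          rw [← ENNReal.ofReal_add hb hb]; congr 1; ring
  refine (le_abs_self _).trans ?_
  rw [← Real.norm_eq_abs]
  refine (ENNReal.ofReal_le_ofReal_iff (by linarith)).1 ?_
  rw [ofReal_norm]
  exact (enorm_integral_le_lintegral_enorm _).trans hn

/-- The bound without decorrelation, quadratic in the length of the interval. -/
theorem integral_sq_setIntegral_le {a b : ℝ} (hab : a ≤ b)
    (hX : Measurable (Function.uncurry X))
    (hL : ∀ s ∈ Set.Ioc a b, MemLp (X s) 2 P) (hc : ∀ s ∈ Set.Ioc a b, ∫ ω, X s ω ^ 2 ∂P ≤ c) :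
    ∫ ω, (∫ s in Set.Ioc a b, X s ω) ^ 2 ∂P ≤ c * (b - a) ^ 2 := by
  set ν := (volume : Measure ℝ).restrict (Set.Ioc a b) with hν
  have hmem : ∀ᵐ s ∂ν, s ∈ Set.Ioc a b := ae_restrict_mem measurableSet_Ioc
  rw [integral_sq_integral (hmem.mono hL) (c := c) (hmem.mono hc) (hX := hX)]
  have hmem2 : ∀ᵐ p ∂(ν.prod ν), p.1 ∈ Set.Ioc a b ∧ p.2 ∈ Set.Ioc a b :=
    (Measure.quasiMeasurePreserving_fst.ae hmem).and (Measure.quasiMeasurePreserving_snd.ae hmem)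
  refine (le_abs_self _).trans ?_
  rw [← Real.norm_eq_abs]
  refine (norm_integral_le_of_norm_le_const (C := c)
    (hmem2.mono fun p hp => ?_)).trans (le_of_eq ?_)
  · have i1 := (hL _ hp.1).integrable_sq
    have i2 := (hL _ hp.2).integrable_sq
    calc ‖∫ ω, X p.1 ω * X p.2 ω ∂P‖ ≤ ∫ ω, (1 / 2 * X p.1 ω ^ 2 + 1 / 2 * X p.2 ω ^ 2) ∂P := by
          refine norm_integral_le_of_norm_le ((i1.const_mul _).add (i2.const_mul _))
            (ae_of_all _ fun ω => ?_)
          simp only [norm_mul, Real.norm_eq_abs]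
          rw [← sq_abs (X p.1 ω), ← sq_abs (X p.2 ω)]
          nlinarith [sq_nonneg (|X p.1 ω| - |X p.2 ω|)]
      _ ≤ c := by
          rw [integral_add (i1.const_mul _) (i2.const_mul _), integral_const_mul,
            integral_const_mul]
          linarith [hc _ hp.1, hc _ hp.2]
  · rw [measureReal_def, ← Set.univ_prod_univ, Measure.prod_prod, hν, Measure.restrict_apply_univ,
      Real.volume_Ioc, ENNReal.toReal_mul, ENNReal.toReal_ofReal (sub_nonneg.2 hab)]
    ring

end SecondMoment

/-- The kernel dominating the covariances of the integrands: of order `1 / ε` on a strip of width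
`ε` along the diagonal, and homogeneous of degree `-1` away from it. -/
noncomputable def stripKernel (c₁ c₂ ε s r : ℝ) : ℝ :=
  (if s - r < ε then c₁ / ε else 0) + c₂ * (1 / √s * (1 / √r + 1 / √(s - r)))

theorem measurable_stripKernel (c₁ c₂ ε : ℝ) :
    Measurable (Function.uncurry (stripKernel c₁ c₂ ε)) := by
  unfold stripKernel Function.uncurry
  refine Measurable.add (Measurable.ite ?_ measurable_const measurable_const) (by fun_prop)
  exact measurableSet_lt (by fun_prop) measurable_const

theorem lintegral_one_div_sqrt {s : ℝ} (hs : 0 < s) :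
    ∫⁻ r in Set.Ioc 0 s, ENNReal.ofReal (1 / √r) = ENNReal.ofReal (2 * √s) := by
  have h1 : ∀ r : ℝ, 1 / √r = r ^ (-(1 / 2) : ℝ) := fun r => by
    rcases le_or_gt 0 r with h | h
    · rw [Real.sqrt_eq_rpow, Real.rpow_neg h, one_div]
    · rw [Real.sqrt_eq_zero_of_nonpos h.le, Real.rpow_def_of_neg h,
        show -(1 / 2 : ℝ) * Real.pi = -(Real.pi / 2) by ring, Real.cos_neg, Real.cos_pi_div_two]
      simp
  have hi : IntegrableOn (fun r : ℝ => 1 / √r) (Set.Ioc 0 s) := by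
    simp only [h1]
    exact (intervalIntegrable_iff_integrableOn_Ioc_of_le hs.le).1
      (intervalIntegral.intervalIntegrable_rpow' (by norm_num))
  rw [← ofReal_integral_eq_lintegral_ofReal hi (ae_of_all _ fun r => by positivity)]
  congr 1
  simp only [h1]
  rw [← intervalIntegral.integral_of_le hs.le, integral_rpow (Or.inl (by norm_num)),
    Real.zero_rpow (by norm_num), Real.sqrt_eq_rpow]
  norm_num
  ring

theorem lintegral_one_div_sqrt_sub {s : ℝ} (hs : 0 < s) :
    ∫⁻ r in Set.Ioc 0 s, ENNReal.ofReal (1 / √(s - r)) = ENNReal.ofReal (2 * √s) := by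
  rw [← lintegral_one_div_sqrt hs, ← setLIntegral_congr Ioo_ae_eq_Ioc,
    ← setLIntegral_congr Ioo_ae_eq_Ioc,
    ← lintegral_indicator measurableSet_Ioo, ← lintegral_indicator measurableSet_Ioo,
    ← lintegral_sub_left_eq_self _ s]
  refine lintegral_congr fun r => ?_
  have : s - r ∈ Set.Ioo 0 s ↔ r ∈ Set.Ioo 0 s := by
    simp only [Set.mem_Ioo]; constructor <;> rintro ⟨h1, h2⟩ <;> constructor <;> linarith
  by_cases h : r ∈ Set.Ioo 0 s
  · rw [Set.indicator_of_mem h, Set.indicator_of_mem (this.2 h), sub_sub_cancel]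
  · rw [Set.indicator_of_notMem h, Set.indicator_of_notMem (mt this.1 h)]

/-- The mass of the kernel is bounded uniformly in `ε` and `s`, since its second part is homogeneous
of degree `-1`. -/
theorem lintegral_stripKernel_le {c₁ c₂ ε s : ℝ} (h₁ : 0 ≤ c₁) (h₂ : 0 ≤ c₂) (hε : 0 < ε)
    (hs : 0 < s) :
    ∫⁻ r in Set.Ioc 0 s, ENNReal.ofReal (stripKernel c₁ c₂ ε s r) ≤
      ENNReal.ofReal (c₁ + 4 * c₂) := by
  have hsq : 0 < √s := Real.sqrt_pos.2 hs
  have m1 : Measurable fun r : ℝ => ENNReal.ofReal (1 / √r) := by fun_prop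
  have m2 : Measurable fun r : ℝ => ENNReal.ofReal (1 / √(s - r)) := by fun_prop
  have e : ∀ r, ENNReal.ofReal (stripKernel c₁ c₂ ε s r) ≤
      Set.indicator (Set.Ioi (s - ε)) (fun _ => ENNReal.ofReal (c₁ / ε)) r +
      ENNReal.ofReal (c₂ * (1 / √s)) *
        (ENNReal.ofReal (1 / √r) + ENNReal.ofReal (1 / √(s - r))) := by
    intro r
    rw [← ENNReal.ofReal_add (by positivity) (by positivity), ← ENNReal.ofReal_mul (by positivity),
      stripKernel]
    refine ENNReal.ofReal_add_le.trans (add_le_add ?_ (le_of_eq (by rw [mul_assoc])))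
    by_cases h : s - r < ε
    · rw [if_pos h, Set.indicator_of_mem (Set.mem_Ioi.2 (by linarith : s - ε < r))]
    · rw [if_neg h]; simp
  refine (lintegral_mono e).trans ?_
  rw [lintegral_add_right _ ((m1.fun_add m2).const_mul _), lintegral_const_mul _ (m1.fun_add m2),
    lintegral_add_left m1, lintegral_one_div_sqrt hs, lintegral_one_div_sqrt_sub hs,
    lintegral_indicator measurableSet_Ioi, Measure.restrict_restrict measurableSet_Ioi,
    setLIntegral_const, ← ENNReal.ofReal_add (by positivity) (by positivity),
    ← ENNReal.ofReal_mul (by positivity), ENNReal.ofReal_add h₁ (by positivity)]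
  refine add_le_add ?_ (ENNReal.ofReal_le_ofReal (le_of_eq ?_))
  · have hsub : Set.Ioi (s - ε) ∩ Set.Ioc 0 s ⊆ Set.Ioc (s - ε) s := fun r hr => ⟨hr.1, hr.2.2⟩
    calc _ ≤ ENNReal.ofReal (c₁ / ε) * volume (Set.Ioc (s - ε) s) := by gcongr
      _ = ENNReal.ofReal c₁ := by
          rw [Real.volume_Ioc, ← ENNReal.ofReal_mul (by positivity)]
          congr 1
          field_simp
          ring
  · field_simp
    ring

end

section

/-! ### Covariance estimates for the process -/

variable {Ω : Type*}

/-- The Gaussian space of a process indexed by `ℝ`, spanned by its values at times `t ≥ 0`. -/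
def processSpan (B : ℝ → Ω → ℝ) : Submodule ℝ (Ω → ℝ) :=
  Submodule.span ℝ (Set.range fun (t : ℝ≥0) (ω : Ω) => B t ω)

theorem mem_processSpan (B : ℝ → Ω → ℝ) {t : ℝ} (ht : 0 ≤ t) : B t ∈ processSpan B :=
  Submodule.subset_span ⟨⟨t, ht⟩, rfl⟩

theorem sub_mem_processSpan (B : ℝ → Ω → ℝ) {t u : ℝ} (ht : 0 ≤ t) (hu : 0 ≤ u) :
    (fun ω => B u ω - B t ω) ∈ processSpan B :=
  Submodule.sub_mem _ (mem_processSpan B hu) (mem_processSpan B ht)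

variable [MeasurableSpace Ω] {P : Measure Ω}

/-- A bi-fractional Brownian motion with critical indices, in a version that is jointly measurable
and has only continuous paths. -/
structure IsRegularBiFBm (P : Measure Ω) (H K : ℝ) (B : ℝ → Ω → ℝ) : Prop where
  indices : CriticalIndices H K
  isBiFBm : IsBiFBm P H K B
  measurable : Measurable (Function.uncurry B)
  continuous : ∀ ω, Continuous fun t => B t ω

theorem incrCov_comm (H K v₁ v₂ u₁ u₂ : ℝ) :
    incrCov H K v₁ v₂ u₁ u₂ = incrCov H K u₁ u₂ v₁ v₂ := by
  simp only [incrCov, biFBmCov_comm H K v₂, biFBmCov_comm H K v₁]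
  ring

theorem incrCov_add (H K x y z u₁ u₂ : ℝ) :
    incrCov H K u₁ u₂ x z = incrCov H K u₁ u₂ x y + incrCov H K u₁ u₂ y z := by
  simp only [incrCov]; ring

theorem abs_incrCov_self_le {H K : ℝ} (hc : CriticalIndices H K) {r s : ℝ} (hr : 0 ≤ r)
    (h : r ≤ s) : |incrCov H K r s r s| ≤ 2 * (s - r) := by
  rw [abs_of_nonneg ((sub_nonneg.2 h).trans (hc.sub_le_incrCov_self hr h))]
  exact hc.incrCov_self_le_two_mul hr h

theorem one_div_sqrt_mul_le {x y : ℝ} (hx : 0 < x) (hy : 0 < y) :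
    1 / √x * (1 / √y) ≤ 1 / √(x + y) * (1 / √x + 1 / √y) := by
  have h1 := Real.sqrt_pos.2 hx
  have h2 := Real.sqrt_pos.2 hy
  have h3 := Real.sqrt_pos.2 (add_pos hx hy)
  have h4 : √(x + y) ≤ √x + √y := by
    rw [Real.sqrt_le_left (by positivity), add_sq, Real.sq_sqrt hx.le, Real.sq_sqrt hy.le]
    nlinarith
  rw [show 1 / √x * (1 / √y) = 1 / √(x + y) * (√(x + y) / (√x * √y)) by field_simp,
    show 1 / √x + 1 / √y = (√x + √y) / (√x * √y) by field_simp; ring]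
  gcongr

namespace IsRegularBiFBm

variable {H K : ℝ} {B : ℝ → Ω → ℝ}

theorem isGaussianSpace (hB : IsRegularBiFBm P H K B) : IsGaussianSpace (processSpan B) P :=
  hB.isBiFBm.gaussian.isGaussianSpace_span fun t => hB.isBiFBm.mean t t.2

theorem isProbabilityMeasure (hB : IsRegularBiFBm P H K B) : IsProbabilityMeasure P :=
  hB.isBiFBm.gaussian.isProbabilityMeasure

theorem integral_incr_mul_incr (hB : IsRegularBiFBm P H K B) {a b c d : ℝ} (ha : 0 ≤ a)
    (hb : 0 ≤ b) (hc : 0 ≤ c) (hd : 0 ≤ d) :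
    ∫ ω, (B b ω - B a ω) * (B d ω - B c ω) ∂P = incrCov H K a b c d := by
  have hE := hB.isGaussianSpace
  have mem := fun {t : ℝ} (ht : 0 ≤ t) => mem_processSpan B ht
  have i := fun {x y : ℝ} (hx : 0 ≤ x) (hy : 0 ≤ y) => hE.integrable_mul (mem hx) (mem hy)
  have e : ∀ ω, (B b ω - B a ω) * (B d ω - B c ω) =
      B b ω * B d ω - B b ω * B c ω - B a ω * B d ω + B a ω * B c ω := fun ω => by ring
  simp only [e]
  have i2 : Integrable (fun ω => B b ω * B d ω - B b ω * B c ω) P := (i hb hd).sub (i hb hc)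
  have i3 : Integrable (fun ω => B b ω * B d ω - B b ω * B c ω - B a ω * B d ω) P :=
    i2.sub (i ha hd)
  rw [integral_add i3 (i ha hc), integral_sub i2 (i ha hd), integral_sub (i hb hd) (i hb hc),
    hB.isBiFBm.cov _ _ hb hd, hB.isBiFBm.cov _ _ hb hc, hB.isBiFBm.cov _ _ ha hd,
    hB.isBiFBm.cov _ _ ha hc, incrCov]

theorem integral_incr_mul (hB : IsRegularBiFBm P H K B) {a b t : ℝ} (ha : 0 ≤ a)
    (hb : 0 ≤ b) (ht : 0 ≤ t) :
    ∫ ω, (B b ω - B a ω) * B t ω ∂P = incrCov H K a b 0 t := by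
  have hE := hB.isGaussianSpace
  have mem := fun {t : ℝ} (ht : 0 ≤ t) => mem_processSpan B ht
  have i := fun {x y : ℝ} (hx : 0 ≤ x) (hy : 0 ≤ y) => hE.integrable_mul (mem hx) (mem hy)
  simp only [sub_mul]
  rw [integral_sub (i hb ht) (i ha ht), hB.isBiFBm.cov _ _ hb ht, hB.isBiFBm.cov _ _ ha ht,
    incrCov, hB.indices.biFBmCov_zero_right hb, hB.indices.biFBmCov_zero_right ha]
  ring

theorem integral_incr_sq (hB : IsRegularBiFBm P H K B) {a b : ℝ} (ha : 0 ≤ a) (hb : 0 ≤ b) :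
    ∫ ω, (B b ω - B a ω) ^ 2 ∂P = incrCov H K a b a b := by
  simp only [sq]; exact hB.integral_incr_mul_incr ha hb ha hb

theorem integral_sq (hB : IsRegularBiFBm P H K B) {t : ℝ} (ht : 0 ≤ t) :
    ∫ ω, B t ω ^ 2 ∂P = t := by
  simp only [sq]; rw [hB.isBiFBm.cov t t ht ht, hB.indices.biFBmCov_self ht]

/-- The regression estimate with respect to the values of the process at two times `x < y`. -/
theorem abs_integral_mul_le_of_regression (hB : IsRegularBiFBm P H K B) {X Y : Ω → ℝ}
    (hX : X ∈ processSpan B) (hY : Y ∈ processSpan B) {x y : ℝ} (hx : 0 < x) (hxy : x < y)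
    {B₁ B₂ S e : ℝ} (hB₁0 : 0 < B₁) (hB₂0 : 0 < B₂)
    (hB₁ : (∫ ω, X ω * B x ω ∂P) ^ 2 / x + (∫ ω, X ω * (B y ω - B x ω) ∂P) ^ 2 / (y - x) ≤ B₁ ^ 2)
    (hB₂ : (∫ ω, Y ω * B x ω ∂P) ^ 2 / x + (∫ ω, Y ω * (B y ω - B x ω) ∂P) ^ 2 / (y - x) ≤ B₂ ^ 2)
    (he : |∫ ω, X ω * Y ω ∂P| ≤ e) {g : ℝ → ℝ} (hg : Measurable g) {C : ℝ}
    (hC : ∀ x, |g x| ≤ C) (hS : 0 < S) (hSx : ∫ ω, g (B x ω) ^ 4 ∂P ≤ S ^ 4)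
    (hSy : ∫ ω, g (B y ω) ^ 4 ∂P ≤ S ^ 4) :
    |∫ ω, g (B y ω) * g (B x ω) * (X ω * Y ω) ∂P| ≤
      S ^ 2 * (e + regressionConst * (B₁ * B₂)) := by
  have h := hB.isGaussianSpace.abs_integral_mul_mul_le_of_regression hX hY
    (mem_processSpan B hx.le) (sub_mem_processSpan B hx.le (hx.trans hxy).le) hx
    (sub_pos.2 hxy) (fun p q => ?_) hB₁0 hB₂0 hB₁ hB₂ he
    (ψ₁ := fun z => g (z.1 + z.2)) (ψ₂ := fun z => g z.1) (by fun_prop) (by fun_prop)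
    (fun z => hC _) (fun z => hC _) hS (by simpa using hSy) (by simpa using hSx)
  · simpa using h
  · have h := hB.indices.half_le_quadraticForm hx.le hxy.le p q
    have e1 : ∫ ω, B x ω * (B y ω - B x ω) ∂P = biFBmCov H K y x - x := by
      simp only [mul_comm (B x _)]
      rw [hB.integral_incr_mul hx.le (hx.trans hxy).le hx.le, incrCov,
        hB.indices.biFBmCov_zero_right (hx.trans hxy).le, hB.indices.biFBmCov_zero_right hx.le,
        hB.indices.biFBmCov_self hx.le]
      ring
    rw [e1, hB.integral_sq hx.le, hB.integral_incr_sq hx.le (hx.trans hxy).le]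
    rwa [hB.indices.biFBmCov_self hx.le] at h

/-- The covariance kernel of the forward sums, with `g` evaluated at the left end points, away from
the diagonal. The increment over `[s, s + ε]` is nearly orthogonal to `B r` and `B s`; this gives
the factor `1 / √s`, which makes the kernel integrable. -/
theorem abs_integral_forward_le (hB : IsRegularBiFBm P H K B) {r s ε S C : ℝ} (hr : 0 < r)
    (hε : 0 < ε) (hrs : r + ε ≤ s) {g : ℝ → ℝ} (hg : Measurable g) (hC : ∀ x, |g x| ≤ C)
    (hS : 0 < S) (hSr : ∫ ω, g (B r ω) ^ 4 ∂P ≤ S ^ 4) (hSs : ∫ ω, g (B s ω) ^ 4 ∂P ≤ S ^ 4) :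
    |∫ ω, g (B s ω) * g (B r ω) * ((B (s + ε) ω - B s ω) * (B (r + ε) ω - B r ω)) ∂P| ≤
      S ^ 2 * (ε ^ 2 * ((1 + 16 * regressionConst) * (1 / √s * (1 / √r + 1 / √(s - r))))) := by
  have hc := hB.indices
  have hd : 0 < s - r := by linarith
  have hs : 0 < s := by linarith
  have q1 := Real.sqrt_pos.2 hr
  have q2 := Real.sqrt_pos.2 hs
  have q3 := Real.sqrt_pos.2 hd
  have hrc := regressionConst_pos
  have h1 : |incrCov H K s (s + ε) 0 r| ≤ ε * r / s := by
    rw [incrCov_comm]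
    simpa using hc.abs_incrCov_le_mul_div le_rfl hr.le (by linarith) hs (by linarith : s ≤ s + ε)
  have h2 : |incrCov H K s (s + ε) r s| ≤ ε * (s - r) / s := by
    rw [incrCov_comm]
    simpa using hc.abs_incrCov_le_mul_div hr.le (by linarith) le_rfl hs (by linarith : s ≤ s + ε)
  have h3 : |incrCov H K r (r + ε) 0 r| ≤ ε := by
    rw [incrCov_comm]
    simpa using (hc.abs_incrCov_le le_rfl hr.le le_rfl (by linarith : r ≤ r + ε)).2
  have h4 : |incrCov H K r (r + ε) r s| ≤ 3 * ε := by
    rw [incrCov_add H K r (r + ε) s]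
    have t1 := abs_incrCov_self_le hc hr.le (by linarith : r ≤ r + ε)
    have t2 := (hc.abs_incrCov_le hr.le (by linarith : r ≤ r + ε) le_rfl hrs).1
    refine (abs_add_le _ _).trans ?_
    linarith
  have h5 : |incrCov H K s (s + ε) r (r + ε)| ≤ ε * ε / s := by
    rw [incrCov_comm]
    simpa using hc.abs_incrCov_le_mul_div hr.le (by linarith : r ≤ r + ε) hrs hs
      (by linarith : s ≤ s + ε)
  have hsn : 0 ≤ s + ε := by linarith
  have hrn : 0 ≤ r + ε := by linarith
  have main := hB.abs_integral_mul_le_of_regression (sub_mem_processSpan B hs.le hsn)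
    (sub_mem_processSpan B hr.le hrn) hr (by linarith : r < s)
    (B₁ := ε / √s) (B₂ := 3 * ε * (1 / √r + 1 / √(s - r))) (e := ε * ε / s)
    (by positivity) (by positivity) ?_ ?_ ?_ hg hC hS hSr hSs
  · refine main.trans ?_
    refine mul_le_mul_of_nonneg_left ?_ (sq_nonneg S)
    set w := 1 / √s * (1 / √r + 1 / √(s - r)) with hw
    have hw0 : 0 ≤ w := by positivity
    have hsw : 1 / s ≤ w := by
      rw [hw, mul_add]
      have : 1 / s = 1 / √s * (1 / √s) := by
        rw [div_mul_div_comm, one_mul, Real.mul_self_sqrt hs.le]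
      have h6 : 1 / √s * (1 / √s) ≤ 1 / √s * (1 / √r) := by
        gcongr
        linarith
      have h7 : 0 ≤ 1 / √s * (1 / √(s - r)) := by positivity
      linarith
    have e1 : ε * ε / s = ε ^ 2 * (1 / s) := by ring
    have e2 : ε / √s * (3 * ε * (1 / √r + 1 / √(s - r))) = ε ^ 2 * (3 * w) := by
      rw [hw]; ring
    rw [e1, e2]
    have : 1 / s + regressionConst * (3 * w) ≤ (1 + 16 * regressionConst) * w := by nlinarith
    calc ε ^ 2 * (1 / s) + regressionConst * (ε ^ 2 * (3 * w))
        = ε ^ 2 * (1 / s + regressionConst * (3 * w)) := by ring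
      _ ≤ _ := by gcongr
  · rw [hB.integral_incr_mul hs.le hsn hr.le, hB.integral_incr_mul_incr hs.le hsn hr.le hs.le,
      ← sq_abs (incrCov H K s (s + ε) 0 r), ← sq_abs (incrCov H K s (s + ε) r s)]
    calc _ ≤ (ε * r / s) ^ 2 / r + (ε * (s - r) / s) ^ 2 / (s - r) := by gcongr
      _ = (ε / √s) ^ 2 := by
        rw [div_pow ε, Real.sq_sqrt hs.le]
        field_simp
        ring
  · rw [hB.integral_incr_mul hr.le hrn hr.le, hB.integral_incr_mul_incr hr.le hrn hr.le hs.le,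
      ← sq_abs (incrCov H K r (r + ε) 0 r), ← sq_abs (incrCov H K r (r + ε) r s)]
    calc _ ≤ ε ^ 2 / r + (3 * ε) ^ 2 / (s - r) := by gcongr
      _ ≤ (3 * ε * (1 / √r + 1 / √(s - r))) ^ 2 := by
        have e1 : (1 / √r) ^ 2 = 1 / r := by rw [div_pow, Real.sq_sqrt hr.le, one_pow]
        have e2 : (1 / √(s - r)) ^ 2 = 1 / (s - r) := by
          rw [div_pow, Real.sq_sqrt hd.le, one_pow]
        have e3 : 0 ≤ 1 / √r * (1 / √(s - r)) := by positivity
        have e4 : 0 ≤ 1 / r := by positivity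
        rw [mul_pow _ (1 / √r + 1 / √(s - r)), add_sq, e1, e2]
        have : ε ^ 2 / r + (3 * ε) ^ 2 / (s - r) = ε ^ 2 * (1 / r + 9 * (1 / (s - r))) := by ring
        rw [this]
        have : (3 * ε) ^ 2 * (1 / r + 2 * (1 / √r) * (1 / √(s - r)) + 1 / (s - r)) =
          ε ^ 2 * (9 * (1 / r) + 18 * (1 / √r * (1 / √(s - r))) + 9 * (1 / (s - r))) := by ring
        rw [this]
        gcongr
        linarith
  · rwa [hB.integral_incr_mul_incr hs.le hsn hr.le hrn]

/-- The covariance kernel of the backward sums, with `g` evaluated at the right end points. Here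
neither increment is nearly orthogonal to both regressors, and the product `1 / √r * (1 / √(s - r))`
of the two regression bounds is brought to the same form by `one_div_sqrt_mul_le`. -/
theorem abs_integral_backward_le (hB : IsRegularBiFBm P H K B) {r s ε S C : ℝ} (hr : 0 < r)
    (hε : 0 < ε) (hrs : r + ε ≤ s) {g : ℝ → ℝ} (hg : Measurable g) (hC : ∀ x, |g x| ≤ C)
    (hS : 0 < S) (hSr : ∫ ω, g (B (r + ε) ω) ^ 4 ∂P ≤ S ^ 4)
    (hSs : ∫ ω, g (B (s + ε) ω) ^ 4 ∂P ≤ S ^ 4) :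
    |∫ ω, g (B (s + ε) ω) * g (B (r + ε) ω) *
        ((B (s + ε) ω - B s ω) * (B (r + ε) ω - B r ω)) ∂P| ≤
      S ^ 2 * (ε ^ 2 * ((1 + 16 * regressionConst) * (1 / √s * (1 / √r + 1 / √(s - r))))) := by
  have hc := hB.indices
  have hd : 0 < s - r := by linarith
  have hs : 0 < s := by linarith
  have hrε : 0 < r + ε := by linarith
  have q1 := Real.sqrt_pos.2 hr
  have q2 := Real.sqrt_pos.2 hs
  have q3 := Real.sqrt_pos.2 hd
  have hrc := regressionConst_pos
  have h1 : |incrCov H K s (s + ε) 0 (r + ε)| ≤ ε * (r + ε) / s := by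
    rw [incrCov_comm]
    simpa using hc.abs_incrCov_le_mul_div le_rfl hrε.le hrs hs (by linarith : s ≤ s + ε)
  have h2 : |incrCov H K s (s + ε) (r + ε) (s + ε)| ≤ 3 * ε := by
    rw [incrCov_add H K (r + ε) s (s + ε), incrCov_comm H K s (s + ε) (r + ε) s]
    have t1 := abs_incrCov_self_le hc hs.le (by linarith : s ≤ s + ε)
    have t2 := (hc.abs_incrCov_le hrε.le hrs le_rfl (by linarith : s ≤ s + ε)).2
    refine (abs_add_le _ _).trans ?_
    linarith
  have h3 : |incrCov H K r (r + ε) 0 (r + ε)| ≤ 3 * ε := by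
    rw [incrCov_add H K 0 r (r + ε), incrCov_comm H K r (r + ε) 0 r]
    have t1 := abs_incrCov_self_le hc hr.le (by linarith : r ≤ r + ε)
    have t2 := (hc.abs_incrCov_le le_rfl hr.le le_rfl (by linarith : r ≤ r + ε)).2
    refine (abs_add_le _ _).trans ?_
    linarith
  have h4 : |incrCov H K r (r + ε) (r + ε) (s + ε)| ^ 2 ≤ ε ^ 2 * (s - r) / r := by
    have t1 := (hc.abs_incrCov_le hr.le (by linarith : r ≤ r + ε) le_rfl
      (by linarith : r + ε ≤ s + ε)).1
    have t2 := hc.abs_incrCov_le_mul_div hr.le (by linarith : r ≤ r + ε) le_rfl hrε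
      (by linarith : r + ε ≤ s + ε)
    simp only [add_sub_cancel_left, add_sub_add_right_eq_sub] at t1 t2
    have t3 : (s - r) * ε / (r + ε) ≤ (s - r) * ε / r := by gcongr; linarith
    calc _ = |incrCov H K r (r + ε) (r + ε) (s + ε)| * |incrCov H K r (r + ε) (r + ε) (s + ε)| :=
          sq _
      _ ≤ ε * ((s - r) * ε / r) := mul_le_mul t1 (t2.trans t3) (abs_nonneg _) hε.le
      _ = _ := by ring
  have h5 : |incrCov H K s (s + ε) r (r + ε)| ≤ ε * ε / s := by
    rw [incrCov_comm]
    simpa using hc.abs_incrCov_le_mul_div hr.le (by linarith : r ≤ r + ε) hrs hs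
      (by linarith : s ≤ s + ε)
  have hsn : 0 ≤ s + ε := by linarith
  have main := hB.abs_integral_mul_le_of_regression (sub_mem_processSpan B hs.le hsn)
    (sub_mem_processSpan B hr.le hrε.le) hrε (by linarith : r + ε < s + ε)
    (B₁ := 4 * ε * (1 / √(s - r))) (B₂ := 4 * ε * (1 / √r)) (e := ε * ε / s)
    (by positivity) (by positivity) ?_ ?_ ?_ hg hC hS hSr hSs
  · refine main.trans ?_
    refine mul_le_mul_of_nonneg_left ?_ (sq_nonneg S)
    set w := 1 / √s * (1 / √r + 1 / √(s - r)) with hw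
    have hw0 : 0 ≤ w := by positivity
    have hsw : 1 / s ≤ w := by
      rw [hw, mul_add]
      have : 1 / s = 1 / √s * (1 / √s) := by
        rw [div_mul_div_comm, one_mul, Real.mul_self_sqrt hs.le]
      have h6 : 1 / √s * (1 / √s) ≤ 1 / √s * (1 / √r) := by
        gcongr
        linarith
      have h7 : 0 ≤ 1 / √s * (1 / √(s - r)) := by positivity
      linarith
    have hpw : 1 / √r * (1 / √(s - r)) ≤ w := by
      have := one_div_sqrt_mul_le hr hd
      rwa [add_sub_cancel] at this
    have e1 : ε * ε / s = ε ^ 2 * (1 / s) := by ring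
    have e2 : 4 * ε * (1 / √(s - r)) * (4 * ε * (1 / √r)) =
      ε ^ 2 * (16 * (1 / √r * (1 / √(s - r)))) := by ring
    rw [e1, e2]
    calc ε ^ 2 * (1 / s) + regressionConst * (ε ^ 2 * (16 * (1 / √r * (1 / √(s - r)))))
        ≤ ε ^ 2 * w + regressionConst * (ε ^ 2 * (16 * w)) := by gcongr
      _ = _ := by ring
  · rw [hB.integral_incr_mul hs.le hsn hrε.le, hB.integral_incr_mul_incr hs.le hsn hrε.le hsn,
      ← sq_abs (incrCov H K s (s + ε) 0 (r + ε)), ← sq_abs (incrCov H K s (s + ε) _ (s + ε)),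
      add_sub_add_right_eq_sub]
    calc _ ≤ (ε * (r + ε) / s) ^ 2 / (r + ε) + (3 * ε) ^ 2 / (s - r) := by gcongr
      _ = ε ^ 2 * ((r + ε) / s * (1 / s)) + 9 * ε ^ 2 * (1 / (s - r)) := by field_simp; norm_num
      _ ≤ ε ^ 2 * (1 * (1 / (s - r))) + 9 * ε ^ 2 * (1 / (s - r)) := by
        gcongr
        · exact (div_le_one hs).2 hrs
        · linarith
      _ ≤ (4 * ε * (1 / √(s - r))) ^ 2 := by
        rw [mul_pow, div_pow 1, Real.sq_sqrt hd.le]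
        have : 0 ≤ ε ^ 2 * (1 / (s - r)) := by positivity
        linarith
  · rw [hB.integral_incr_mul hr.le hrε.le hrε.le, hB.integral_incr_mul_incr hr.le hrε.le hrε.le hsn,
      ← sq_abs (incrCov H K r (r + ε) 0 (r + ε)), ← sq_abs (incrCov H K r (r + ε) (r + ε) _),
      add_sub_add_right_eq_sub]
    calc _ ≤ (3 * ε) ^ 2 / r + ε ^ 2 * (s - r) / r / (s - r) := by
          gcongr
          linarith
      _ = 10 * (ε ^ 2 * (1 / r)) := by field_simp; norm_num
      _ ≤ (4 * ε * (1 / √r)) ^ 2 := by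
        rw [mul_pow, div_pow 1, Real.sq_sqrt hr.le]
        have : 0 ≤ ε ^ 2 * (1 / r) := by positivity
        linarith
  · rwa [hB.integral_incr_mul_incr hs.le hsn hr.le hrε.le]

end IsRegularBiFBm

/-! ### The uniform second moment bound -/

/-- The approximation of the quadratic covariation over a time interval `[a, b]`. -/
noncomputable def covApproxOn (B : ℝ → Ω → ℝ) (f : ℝ → ℝ) (a b ε : ℝ) (ω : Ω) : ℝ :=
  1 / ε * ∫ s in a..b, (f (B (s + ε) ω) - f (B s ω)) * (B (s + ε) ω - B s ω)

/-- The constant of the kernel on the strip along the diagonal. -/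
noncomputable def diagConst : ℝ := 2 * (gaussMoment 2 + 1) ^ 2

/-- The constant of the kernel away from the diagonal. -/
noncomputable def offDiagConst : ℝ := 1 + 16 * regressionConst

/-- The constant in the uniform second moment bound. -/
noncomputable def covConst : ℝ := 8 * (diagConst + 4 * offDiagConst)

theorem diagConst_pos : 0 < diagConst := by
  have := gaussMoment_nonneg 2
  unfold diagConst; positivity

theorem offDiagConst_pos : 0 < offDiagConst := by
  have := regressionConst_pos
  unfold offDiagConst; positivity

theorem covConst_pos : 0 < covConst := by
  have := diagConst_pos
  have := offDiagConst_pos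
  unfold covConst; positivity

theorem integral_add_sq_le {X Y : Ω → ℝ} (hX : MemLp X 2 P) (hY : MemLp Y 2 P) :
    ∫ ω, (X ω + Y ω) ^ 2 ∂P ≤ 2 * ∫ ω, X ω ^ 2 ∂P + 2 * ∫ ω, Y ω ^ 2 ∂P := by
  rw [← integral_const_mul, ← integral_const_mul,
    ← integral_add (hX.integrable_sq.const_mul 2) (hY.integrable_sq.const_mul 2)]
  refine integral_mono (hX.add hY).integrable_sq
    ((hX.integrable_sq.const_mul 2).add (hY.integrable_sq.const_mul 2)) fun ω => ?_
  simp only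
  nlinarith [sq_nonneg (X ω - Y ω)]

namespace IsRegularBiFBm

variable {H K : ℝ} {B : ℝ → Ω → ℝ}

theorem measurable_shift (hB : IsRegularBiFBm P H K B) (τ : ℝ) :
    Measurable fun p : ℝ × Ω => B (p.1 + τ) p.2 :=
  hB.measurable.comp ((measurable_fst.add_const τ).prodMk measurable_snd)

theorem measurable_apply (hB : IsRegularBiFBm P H K B) (t : ℝ) : Measurable (B t) :=
  hB.measurable.comp measurable_prodMk_left

theorem measurable_weighted (hB : IsRegularBiFBm P H K B) {g : ℝ → ℝ} (hg : Measurable g)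
    (τ ε : ℝ) :
    Measurable (Function.uncurry fun s ω => g (B (s + τ) ω) * (B (s + ε) ω - B s ω)) := by
  have h0 := hB.measurable_shift 0
  simp only [add_zero] at h0
  exact (hg.comp (hB.measurable_shift τ)).mul ((hB.measurable_shift ε).sub h0)

theorem integral_incr_sq_le (hB : IsRegularBiFBm P H K B) {s ε : ℝ} (hs : 0 ≤ s) (hε : 0 ≤ ε) :
    ∫ ω, (B (s + ε) ω - B s ω) ^ 2 ∂P ≤ 2 * ε := by
  rw [hB.integral_incr_sq hs (by linarith)]
  simpa using hB.indices.incrCov_self_le_two_mul hs (by linarith : s ≤ s + ε)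

theorem memLp_weighted (hB : IsRegularBiFBm P H K B) {g : ℝ → ℝ} (hg : Measurable g) {C : ℝ}
    (hC : ∀ x, |g x| ≤ C) {τ ε s : ℝ} (hs : 0 ≤ s) (hε : 0 ≤ ε) :
    MemLp (fun ω => g (B (s + τ) ω) * (B (s + ε) ω - B s ω)) 2 P := by
  have h1 := hB.isGaussianSpace.memLp (sub_mem_processSpan B hs (by linarith : 0 ≤ s + ε))
    (p := 2) ENNReal.ofNat_ne_top
  refine h1.of_le_mul (c := C) ((hB.measurable_weighted hg τ ε).comp
    measurable_prodMk_left).aestronglyMeasurable (ae_of_all _ fun ω => ?_)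
  rw [norm_mul]
  exact mul_le_mul_of_nonneg_right (hC _) (norm_nonneg _)

theorem integral_weighted_sq_le (hB : IsRegularBiFBm P H K B) {g : ℝ → ℝ} (hg : Measurable g)
    {C : ℝ} (hC : ∀ x, |g x| ≤ C) {τ ε s : ℝ} (hs : 0 ≤ s) (hε : 0 ≤ ε) :
    ∫ ω, (g (B (s + τ) ω) * (B (s + ε) ω - B s ω)) ^ 2 ∂P ≤ C ^ 2 * (2 * ε) := by
  have h1 := hB.isGaussianSpace.integrable_pow
    (sub_mem_processSpan B hs (by linarith : 0 ≤ s + ε)) 2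
  calc _ ≤ ∫ ω, C ^ 2 * (B (s + ε) ω - B s ω) ^ 2 ∂P := by
        refine integral_mono (hB.memLp_weighted hg hC hs hε).integrable_sq (h1.const_mul _)
          fun ω => ?_
        simp only [mul_pow]
        refine mul_le_mul_of_nonneg_right ?_ (sq_nonneg _)
        rw [← sq_abs]
        exact pow_le_pow_left₀ (abs_nonneg _) (hC _) 2
    _ ≤ C ^ 2 * (2 * ε) := by
        rw [integral_const_mul]
        exact mul_le_mul_of_nonneg_left (hB.integral_incr_sq_le hs hε) (sq_nonneg _)

theorem abs_integral_weighted_le_strip (hB : IsRegularBiFBm P H K B) {g : ℝ → ℝ}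
    (hg : Measurable g) {C : ℝ} (hC : ∀ x, |g x| ≤ C) {r s u v ε S : ℝ} (hr : 0 ≤ r) (hs : 0 ≤ s)
    (hε : 0 < ε) (hS : 0 < S)
    (hSu : ∫ ω, g (B u ω) ^ 4 ∂P ≤ S ^ 4) (hSv : ∫ ω, g (B v ω) ^ 4 ∂P ≤ S ^ 4) :
    |∫ ω, g (B v ω) * g (B u ω) * ((B (s + ε) ω - B s ω) * (B (r + ε) ω - B r ω)) ∂P| ≤
      S ^ 2 * (diagConst * ε) := by
  have hP := hB.isProbabilityMeasure
  have hE := hB.isGaussianSpace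
  have h0 := gaussMoment_nonneg 2
  have hbdd : ∀ t, Integrable (fun ω => g (B t ω) ^ 4) P := fun t =>
    Integrable.of_bound ((hg.comp (hB.measurable_apply t)).pow_const 4).aestronglyMeasurable (C ^ 4)
      (ae_of_all _ fun ω => by
        rw [norm_pow, Real.norm_eq_abs]; exact pow_le_pow_left₀ (abs_nonneg _) (hC _) 4)
  have hm := fun {t : ℝ} (ht : 0 ≤ t) => sub_mem_processSpan B ht (by linarith : 0 ≤ t + ε)
  have hsq : √(2 * ε) ^ 2 = 2 * ε := Real.sq_sqrt (by linarith)
  have hsp : 0 < √(2 * ε) := Real.sqrt_pos.2 (by linarith)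
  have h4 := fun {t : ℝ} (ht : 0 ≤ t) => hE.integral_pow_four_le (hm ht) (β := √(2 * ε))
    (by rw [hsq]; exact hB.integral_incr_sq_le ht hε.le)
  refine (abs_integral_mul_mul_mul_le hS hS (by positivity) (by positivity) (hbdd v) (hbdd u)
    (hE.integrable_pow (hm hs) 4) (hE.integrable_pow (hm hr) 4) hSv hSu (h4 hs) (h4 hr)).trans
    (le_of_eq ?_)
  have e : S * S * ((gaussMoment 2 + 1) * √(2 * ε)) * ((gaussMoment 2 + 1) * √(2 * ε)) =
    S ^ 2 * (gaussMoment 2 + 1) ^ 2 * √(2 * ε) ^ 2 := by ring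
  rw [e, hsq, diagConst]
  ring

/-- The bound for the forward (`τ = 0`) and the backward (`τ = ε`) stochastic integral sums. -/
theorem integral_sq_weighted_le (hB : IsRegularBiFBm P H K B) {g : ℝ → ℝ} (hg : Measurable g)
    {C : ℝ} (hC : ∀ x, |g x| ≤ C) {a b ε S τ : ℝ} (ha : 0 ≤ a) (hab : a ≤ b) (hε : 0 < ε)
    (hτ : τ = 0 ∨ τ = ε) (hS : 0 < S)
    (hSu : ∀ u ∈ Set.Ioc a (b + ε), ∫ ω, g (B u ω) ^ 4 ∂P ≤ S ^ 4) :
    ∫ ω, (∫ s in Set.Ioc a b, g (B (s + τ) ω) * (B (s + ε) ω - B s ω)) ^ 2 ∂P ≤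
      2 * (S ^ 2 * ε ^ 2 * (diagConst + 4 * offDiagConst)) * (b - a) := by
  have hP := hB.isProbabilityMeasure
  have hd := diagConst_pos
  have ho := offDiagConst_pos
  have hτu : ∀ u ∈ Set.Ioc a b, u + τ ∈ Set.Ioc a (b + ε) := by
    rintro u ⟨h1, h2⟩
    rcases hτ with rfl | rfl <;> constructor <;> linarith
  refine integral_sq_setIntegral_le_of_kernel hab ha (hB.measurable_weighted hg τ ε)
    (fun s hs => hB.memLp_weighted hg hC (ha.trans hs.1.le) hε.le)
    (fun s hs => hB.integral_weighted_sq_le hg hC (ha.trans hs.1.le) hε.le)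
    (measurable_stripKernel (S ^ 2 * ε ^ 2 * diagConst) (S ^ 2 * ε ^ 2 * offDiagConst) ε)
    (fun s hs r hr hrs => ?_) (by positivity) (fun s hs => ?_)
  · have hr0 : 0 < r := ha.trans_lt hr.1
    have hs0 : 0 < s := ha.trans_lt hs.1
    have e : ∀ ω, g (B (s + τ) ω) * (B (s + ε) ω - B s ω) *
        (g (B (r + τ) ω) * (B (r + ε) ω - B r ω)) = g (B (s + τ) ω) * g (B (r + τ) ω) *
        ((B (s + ε) ω - B s ω) * (B (r + ε) ω - B r ω)) := fun ω => by ring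
    simp only [e]
    have hw : 0 ≤ 1 / √s * (1 / √r + 1 / √(s - r)) := by positivity
    rw [stripKernel]
    by_cases hst : s - r < ε
    · rw [if_pos hst]
      refine (hB.abs_integral_weighted_le_strip hg hC hr0.le hs0.le hε hS (hSu _ (hτu r hr))
        (hSu _ (hτu s hs))).trans ?_
      have : S ^ 2 * ε ^ 2 * diagConst / ε = S ^ 2 * (diagConst * ε) := by field_simp
      rw [this]
      have : 0 ≤ S ^ 2 * ε ^ 2 * offDiagConst * (1 / √s * (1 / √r + 1 / √(s - r))) := by positivity
      linarith
    · rw [if_neg hst, zero_add]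
      have hrs' : r + ε ≤ s := by linarith
      have key : |∫ ω, g (B (s + τ) ω) * g (B (r + τ) ω) *
          ((B (s + ε) ω - B s ω) * (B (r + ε) ω - B r ω)) ∂P| ≤
          S ^ 2 * (ε ^ 2 * (offDiagConst * (1 / √s * (1 / √r + 1 / √(s - r))))) := by
        have h1 := hSu _ (hτu r hr)
        have h2 := hSu _ (hτu s hs)
        rcases hτ with rfl | rfl
        · simp only [add_zero] at h1 h2 ⊢
          exact hB.abs_integral_forward_le hr0 hε hrs' hg hC hS h1 h2
        · exact hB.abs_integral_backward_le hr0 hε hrs' hg hC hS h1 h2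
      exact key.trans (le_of_eq (by ring))
  · refine (lintegral_stripKernel_le (by positivity) (by positivity) hε (ha.trans_lt hs.1)).trans
      (ENNReal.ofReal_le_ofReal (le_of_eq (by ring)))

theorem integrable_weighted (hB : IsRegularBiFBm P H K B) {g : ℝ → ℝ} (hg : Measurable g) {C : ℝ}
    (hC : ∀ x, |g x| ≤ C) (a b τ ε : ℝ) (ω : Ω) :
    IntegrableOn (fun s => g (B (s + τ) ω) * (B (s + ε) ω - B s ω)) (Set.Ioc a b) := by
  have hc := hB.continuous ω
  have h1 : Continuous fun s => B (s + ε) ω - B s ω :=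
    (hc.comp (continuous_id.add continuous_const)).sub hc
  have h2 : IntegrableOn (fun s => B (s + ε) ω - B s ω) (Set.Ioc a b) :=
    h1.locallyIntegrable.integrableOn_isCompact isCompact_Icc |>.mono_set Set.Ioc_subset_Icc_self
  have h3 : Measurable fun s => g (B (s + τ) ω) :=
    hg.comp (hc.comp (continuous_id.add continuous_const)).measurable
  exact h2.bdd_mul h3.aestronglyMeasurable (ae_of_all _ fun s => hC _)

theorem covApproxOn_eq (hB : IsRegularBiFBm P H K B) {g : ℝ → ℝ} (hg : Measurable g) {C : ℝ}
    (hC : ∀ x, |g x| ≤ C) {a b : ℝ} (hab : a ≤ b) (ε : ℝ) (ω : Ω) :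
    covApproxOn B g a b ε ω =
      1 / ε * (∫ s in Set.Ioc a b, g (B (s + ε) ω) * (B (s + ε) ω - B s ω)) -
      1 / ε * ∫ s in Set.Ioc a b, g (B (s + 0) ω) * (B (s + ε) ω - B s ω) := by
  rw [covApproxOn, intervalIntegral.integral_of_le hab, ← mul_sub,
    ← integral_sub (hB.integrable_weighted hg hC a b ε ε ω)
      (hB.integrable_weighted hg hC a b 0 ε ω)]
  simp only [add_zero, sub_mul]

theorem memLp_setIntegral_weighted (hB : IsRegularBiFBm P H K B) {g : ℝ → ℝ} (hg : Measurable g)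
    {C : ℝ} (hC : ∀ x, |g x| ≤ C) {a b ε : ℝ} (ha : 0 ≤ a) (hε : 0 < ε) (τ : ℝ) :
    MemLp (fun ω => ∫ s in Set.Ioc a b, g (B (s + τ) ω) * (B (s + ε) ω - B s ω)) 2 P := by
  have hP := hB.isProbabilityMeasure
  have hmem : ∀ᵐ s ∂volume.restrict (Set.Ioc a b), s ∈ Set.Ioc a b :=
    ae_restrict_mem measurableSet_Ioc
  exact memLp_two_integral (hB.measurable_weighted hg τ ε)
    (hmem.mono fun s hs => hB.memLp_weighted hg hC (ha.trans hs.1.le) hε.le)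
    (hmem.mono fun s hs => hB.integral_weighted_sq_le hg hC (ha.trans hs.1.le) hε.le)

theorem memLp_covApproxOn (hB : IsRegularBiFBm P H K B) {g : ℝ → ℝ} (hg : Measurable g) {C : ℝ}
    (hC : ∀ x, |g x| ≤ C) {a b ε : ℝ} (ha : 0 ≤ a) (hab : a ≤ b) (hε : 0 < ε) :
    MemLp (covApproxOn B g a b ε) 2 P := by
  have e : covApproxOn B g a b ε = _ := funext (hB.covApproxOn_eq hg hC hab ε)
  rw [e]
  exact ((hB.memLp_setIntegral_weighted hg hC ha hε ε).const_mul _).sub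
    ((hB.memLp_setIntegral_weighted hg hC ha hε 0).const_mul _)

/-- The uniform bound: the second moment of the approximation over `[a, b]` is controlled by the
fourth moments of `g (B u)`, with no regularity of `g` involved. -/
theorem integral_covApproxOn_sq_le (hB : IsRegularBiFBm P H K B) {g : ℝ → ℝ} (hg : Measurable g)
    {C : ℝ} (hC : ∀ x, |g x| ≤ C) {a b ε S : ℝ} (ha : 0 ≤ a) (hab : a ≤ b) (hε : 0 < ε)
    (hS : 0 < S) (hSu : ∀ u ∈ Set.Ioc a (b + ε), ∫ ω, g (B u ω) ^ 4 ∂P ≤ S ^ 4) :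
    ∫ ω, covApproxOn B g a b ε ω ^ 2 ∂P ≤ covConst * S ^ 2 * (b - a) := by
  have h1 := hB.integral_sq_weighted_le hg hC ha hab hε (Or.inr rfl) hS hSu
  have h2 := hB.integral_sq_weighted_le hg hC ha hab hε (Or.inl rfl) hS hSu
  have m1 := (hB.memLp_setIntegral_weighted hg hC ha hε (b := b) ε).const_mul (1 / ε)
  have m2 := (hB.memLp_setIntegral_weighted hg hC ha hε (b := b) 0).const_mul (-(1 / ε))
  have h3 := integral_add_sq_le m1 m2
  simp only [mul_pow, integral_const_mul] at h3
  have e : ∀ ω, covApproxOn B g a b ε ω ^ 2 =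
      (1 / ε * (∫ s in Set.Ioc a b, g (B (s + ε) ω) * (B (s + ε) ω - B s ω)) +
      -(1 / ε) * ∫ s in Set.Ioc a b, g (B (s + 0) ω) * (B (s + ε) ω - B s ω)) ^ 2 := fun ω => by
    rw [hB.covApproxOn_eq hg hC hab]; ring
  simp only [e]
  refine h3.trans ?_
  have hε2 : 0 ≤ (1 / ε) ^ 2 := sq_nonneg _
  have e2 : (-(1 / ε)) ^ 2 = (1 / ε) ^ 2 := by ring
  rw [e2]
  calc _ ≤ 2 * ((1 / ε) ^ 2 * (2 * (S ^ 2 * ε ^ 2 * (diagConst + 4 * offDiagConst)) * (b - a))) +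
        2 * ((1 / ε) ^ 2 * (2 * (S ^ 2 * ε ^ 2 * (diagConst + 4 * offDiagConst)) * (b - a))) := by
        gcongr
    _ = _ := by unfold covConst; field_simp; ring

end IsRegularBiFBm

/-! ### Smooth integrands -/

/-- A bounded function `φ` with bounded Lipschitz derivative `g`, all bounds being given by `M`. -/
structure IsSmoothPair (φ g : ℝ → ℝ) (M : ℝ) : Prop where
  pos : 0 < M
  continuous_fun : Continuous φ
  continuous_deriv : Continuous g
  abs_fun_le : ∀ x, |φ x| ≤ M
  abs_deriv_le : ∀ x, |g x| ≤ M
  lipschitz : ∀ x y, |g y - g x| ≤ M * |y - x|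
  taylor : ∀ x y, |φ y - φ x - g x * (y - x)| ≤ M * (y - x) ^ 2

theorem ContDiff.exists_isSmoothPair {φ : ℝ → ℝ} (hφ : ContDiff ℝ 2 φ) (hc : HasCompactSupport φ) :
    ∃ M, IsSmoothPair φ (deriv φ) M := by
  have h1 : ContDiff ℝ 1 (deriv φ) := hφ.deriv' (n := 1)
  have h2 : Continuous (deriv (deriv φ)) := (h1.continuous_deriv le_rfl)
  obtain ⟨M0, hM0⟩ := hc.exists_bound_of_continuous hφ.continuous
  obtain ⟨M1, hM1⟩ := hc.deriv.exists_bound_of_continuous h1.continuous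
  obtain ⟨M2, hM2⟩ := hc.deriv.deriv.exists_bound_of_continuous h2
  set M := max (max M0 M1) (max M2 1)
  have hlip : ∀ x y, |deriv φ y - deriv φ x| ≤ M * |y - x| := fun x y =>
    convex_univ.norm_image_sub_le_of_norm_deriv_le (fun z _ => (h1.differentiable one_ne_zero) z)
      (fun z _ => (hM2 z).trans ((le_max_left _ _).trans (le_max_right _ _)))
      (Set.mem_univ x) (Set.mem_univ y)
  have hM : 0 < M := one_pos.trans_le ((le_max_right _ _).trans (le_max_right _ _))
  refine ⟨M, hM, hφ.continuous, h1.continuous,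
    fun x => (hM0 x).trans ((le_max_left _ _).trans (le_max_left _ _)),
    fun x => (hM1 x).trans ((le_max_right _ _).trans (le_max_left _ _)), hlip, fun x y => ?_⟩
  have hd : ∀ z, HasDerivAt (fun z => φ z - deriv φ x * z) (deriv φ z - deriv φ x) z := fun z => by
    simpa using ((hφ.differentiable two_ne_zero) z).hasDerivAt.fun_sub
      ((hasDerivAt_id z).const_mul (deriv φ x))
  have hb : ∀ z ∈ Set.uIcc x y, ‖deriv φ z - deriv φ x‖ ≤ M * |y - x| := fun z hz =>
    (hlip x z).trans (mul_le_mul_of_nonneg_left (Set.abs_sub_left_of_mem_uIcc hz) hM.le)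
  have := (convex_uIcc x y).norm_image_sub_le_of_norm_hasDerivWithin_le
    (fun z _ => (hd z).hasDerivWithinAt) hb Set.left_mem_uIcc Set.right_mem_uIcc
  rw [Real.norm_eq_abs, Real.norm_eq_abs, mul_assoc, ← sq, sq_abs] at this
  convert this using 2
  ring

/-- The asymptotic variance `2^{1-K}` of the increments of the process per unit of time. -/
noncomputable def qvRate (K : ℝ) : ℝ := 2 * (1 / (2 : ℝ) ^ K)

theorem qvRate_nonneg (K : ℝ) : 0 ≤ qvRate K := by unfold qvRate; positivity

/-- The deviation of the square of an increment from its asymptotic mean. -/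
noncomputable def sqDev (B : ℝ → Ω → ℝ) (K ε s : ℝ) (ω : Ω) : ℝ :=
  (B (s + ε) ω - B s ω) ^ 2 - qvRate K * ε

/-- The constant in the fourth moment bound of the deviations `sqDev`. -/
noncomputable def devConst : ℝ := 128 * (gaussMoment 4 + 1)

theorem one_le_devConst : 1 ≤ devConst := by
  have := gaussMoment_nonneg 4
  unfold devConst; linarith

namespace IsRegularBiFBm

variable {H K : ℝ} {B : ℝ → Ω → ℝ}

theorem qvRate_le (hB : IsRegularBiFBm P H K B) : qvRate K ≤ 2 := by
  have := hB.indices.coeff_le_one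
  unfold qvRate; linarith

theorem measurable_sqDev (hB : IsRegularBiFBm P H K B) (ε : ℝ) :
    Measurable (Function.uncurry (sqDev B K ε)) := by
  have h0 := hB.measurable_shift 0
  simp only [add_zero] at h0
  exact (((hB.measurable_shift ε).sub h0).pow_const 2).sub_const _

theorem continuous_sqDev (hB : IsRegularBiFBm P H K B) (ε : ℝ) (ω : Ω) :
    Continuous fun s => sqDev B K ε s ω := by
  have hc := hB.continuous ω
  exact (((hc.comp (continuous_id.add continuous_const)).sub hc).pow 2).sub continuous_const

theorem integrable_sqDev_pow_four (hB : IsRegularBiFBm P H K B) {s ε : ℝ} (hs : 0 ≤ s)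
    (hε : 0 ≤ ε) :
    Integrable (fun ω => sqDev B K ε s ω ^ 4) P ∧
      ∫ ω, sqDev B K ε s ω ^ 4 ∂P ≤ (devConst * ε) ^ 4 := by
  have hP := hB.isProbabilityMeasure
  have hE := hB.isGaussianSpace
  have hm := sub_mem_processSpan B hs (by linarith : 0 ≤ s + ε)
  have h8 := hE.integrable_pow hm 8
  have hκ := qvRate_nonneg K
  have hκ2 := hB.qvRate_le
  have hg := gaussMoment_nonneg 4
  have hi : Integrable (fun ω => 8 * (B (s + ε) ω - B s ω) ^ 8 + 8 * (2 * ε) ^ 4) P :=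
    (h8.const_mul 8).add (integrable_const _)
  have hle : ∀ ω, sqDev B K ε s ω ^ 4 ≤ 8 * (B (s + ε) ω - B s ω) ^ 8 + 8 * (2 * ε) ^ 4 := by
    intro ω
    have key : ∀ x y : ℝ, (x - y) ^ 4 ≤ 8 * x ^ 4 + 8 * y ^ 4 := fun x y => by
      nlinarith [sq_nonneg (x ^ 2 - y ^ 2), sq_nonneg (x + y), sq_nonneg ((x + y) * (x - y)),
        sq_nonneg ((x + y) ^ 2), mul_nonneg (sq_nonneg (x + y)) (sq_nonneg (x - y)),
        mul_nonneg (sq_nonneg x) (sq_nonneg (x + y)), mul_nonneg (sq_nonneg y) (sq_nonneg (x + y))]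
    have h1 := key ((B (s + ε) ω - B s ω) ^ 2) (qvRate K * ε)
    have h2 : (qvRate K * ε) ^ 4 ≤ (2 * ε) ^ 4 := by gcongr
    have e : ((B (s + ε) ω - B s ω) ^ 2) ^ 4 = (B (s + ε) ω - B s ω) ^ 8 := by ring
    rw [e] at h1
    unfold sqDev
    linarith
  have hsm : AEStronglyMeasurable (fun ω => sqDev B K ε s ω ^ 4) P :=
    (((hB.measurable_sqDev ε).comp measurable_prodMk_left).pow_const 4).aestronglyMeasurable
  have hint : Integrable (fun ω => sqDev B K ε s ω ^ 4) P :=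
    hi.mono' hsm (ae_of_all _ fun ω => by
      rw [Real.norm_eq_abs, abs_of_nonneg (by positivity)]; exact hle ω)
  refine ⟨hint, ?_⟩
  calc _ ≤ ∫ ω, (8 * (B (s + ε) ω - B s ω) ^ 8 + 8 * (2 * ε) ^ 4) ∂P := integral_mono hint hi hle
    _ = 8 * (gaussMoment 4 * (∫ ω, (B (s + ε) ω - B s ω) ^ 2 ∂P) ^ 4) + 8 * (2 * ε) ^ 4 := by
        rw [integral_add (h8.const_mul 8) (integrable_const _), integral_const_mul,
          hE.integral_pow_two_mul hm 4]
        simp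
    _ ≤ 8 * (gaussMoment 4 * (2 * ε) ^ 4) + 8 * (2 * ε) ^ 4 := by
        have h0 : 0 ≤ ∫ ω, (B (s + ε) ω - B s ω) ^ 2 ∂P := integral_nonneg fun ω => sq_nonneg _
        have := hB.integral_incr_sq_le hs hε
        gcongr
    _ = devConst * ε ^ 4 := by unfold devConst; ring
    _ ≤ devConst ^ 4 * ε ^ 4 := by
        gcongr
        exact le_self_pow₀ one_le_devConst (by norm_num)
    _ = _ := by ring

theorem memLp_sqDev (hB : IsRegularBiFBm P H K B) {s ε : ℝ} (hs : 0 ≤ s) (hε : 0 < ε) :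
    MemLp (sqDev B K ε s) 2 P ∧ ∫ ω, sqDev B K ε s ω ^ 2 ∂P ≤ (devConst * ε) ^ 2 := by
  have hP := hB.isProbabilityMeasure
  obtain ⟨h1, h2⟩ := hB.integrable_sqDev_pow_four hs hε.le
  have hsm : Measurable (sqDev B K ε s) := (hB.measurable_sqDev ε).comp measurable_prodMk_left
  have hd : 0 < devConst := one_pos.trans_le one_le_devConst
  have hi : Integrable (fun ω => sqDev B K ε s ω ^ 2) P := by
    refine (h1.add (integrable_const 1)).mono' (hsm.pow_const 2).aestronglyMeasurable
      (ae_of_all _ fun ω => ?_)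
    rw [Real.norm_eq_abs, abs_of_nonneg (sq_nonneg _)]
    simp only [Pi.add_apply]
    nlinarith [sq_nonneg (sqDev B K ε s ω ^ 2 - 1)]
  refine ⟨(memLp_two_iff_integrable_sq hsm.aestronglyMeasurable).2 hi, ?_⟩
  have := abs_integral_mul_mul_mul_le (P := P) (X := fun _ => 1) (Y := fun _ => 1)
    one_pos one_pos (by positivity : 0 < devConst * ε) (by positivity : 0 < devConst * ε)
    (by simp) (by simp) h1 h1 (by simp) (by simp) h2 h2
  simp only [one_mul] at this
  refine (le_of_eq ?_).trans ((le_abs_self _).trans (this.trans (le_of_eq (by ring))))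
  simp only [sq]

/-- The deviations of the squared increments are weakly correlated. -/
theorem abs_integral_sqDev_mul_le (hB : IsRegularBiFBm P H K B) {a r s ε : ℝ} (ha : 0 < a)
    (hr : a ≤ r) (hrs : r ≤ s) (hε : 0 < ε) :
    |∫ ω, sqDev B K ε s ω * sqDev B K ε r ω ∂P| ≤
      (if s - r < ε then 4 * (gaussMoment 2 + 1) * ε ^ 2 else 0) +
        (gaussMoment 2 + 2) * (ε ^ 2 / a) ^ 2 := by
  have hP := hB.isProbabilityMeasure
  have hE := hB.isGaussianSpace
  have hc := hB.indices
  have hg := gaussMoment_nonneg 2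
  have hr0 : 0 < r := ha.trans_le hr
  have hs0 : 0 < s := hr0.trans_le hrs
  have hrn : 0 ≤ r + ε := by linarith
  have hsn : 0 ≤ s + ε := by linarith
  have mr := sub_mem_processSpan B hr0.le hrn
  have ms := sub_mem_processSpan B hs0.le hsn
  set v := ∫ ω, (B (s + ε) ω - B s ω) ^ 2 ∂P with hv
  set w := ∫ ω, (B (r + ε) ω - B r ω) ^ 2 ∂P with hw
  have hv1 : v = incrCov H K s (s + ε) s (s + ε) := hB.integral_incr_sq hs0.le hsn
  have hw1 : w = incrCov H K r (r + ε) r (r + ε) := hB.integral_incr_sq hr0.le hrn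
  have hv0 : 0 < v := by
    rw [hv1]
    refine lt_of_lt_of_le ?_ (hc.sub_le_incrCov_self hs0.le (by linarith))
    linarith
  have hve : |v - qvRate K * ε| ≤ ε ^ 2 / a := by
    rw [hv1]
    refine (hc.abs_incrCov_self_sub_le hs0 hε.le).trans ?_
    gcongr
    linarith
  have hwe : |w - qvRate K * ε| ≤ ε ^ 2 / a := by
    rw [hw1]
    refine (hc.abs_incrCov_self_sub_le hr0 hε.le).trans ?_
    gcongr
    linarith
  have key := hE.integral_sq_sub_mul_sq_sub ms mr hv0
  rw [← hv, ← hw, hB.integral_incr_mul_incr hs0.le hsn hr0.le hrn] at key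
  -- Centring each square at its exact mean splits off the product of the two biases.
  have i1 := hE.integrable_pow ms 2
  have i2 := hE.integrable_pow mr 2
  have i12 : Integrable (fun ω => ((B (s + ε) ω - B s ω) ^ 2 - v) *
      ((B (r + ε) ω - B r ω) ^ 2 - w)) P := by
    have l : ∀ {Z : Ω → ℝ}, Z ∈ processSpan B → ∀ c, MemLp (fun ω => Z ω ^ 2 - c) 2 P :=
      fun {Z} hZ c => by
        refine MemLp.sub ?_ (memLp_const c)
        refine (memLp_two_iff_integrable_sq
          ((hE.hasGaussianLaw hZ).aemeasurable.pow_const 2).aestronglyMeasurable).2 ?_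
        simpa only [← pow_mul] using hE.integrable_pow hZ 4
    exact (l ms v).integrable_mul (l mr w)
  have e : ∀ ω, sqDev B K ε s ω * sqDev B K ε r ω =
      ((B (s + ε) ω - B s ω) ^ 2 - v) * ((B (r + ε) ω - B r ω) ^ 2 - w) +
      ((w - qvRate K * ε) * ((B (s + ε) ω - B s ω) ^ 2 - v) +
      (v - qvRate K * ε) * ((B (r + ε) ω - B r ω) ^ 2 - w)) +
      (v - qvRate K * ε) * (w - qvRate K * ε) := fun ω => by unfold sqDev; ring
  have j1 : Integrable (fun ω => (w - qvRate K * ε) * ((B (s + ε) ω - B s ω) ^ 2 - v)) P :=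
    (i1.sub (integrable_const v)).const_mul _
  have j2 : Integrable (fun ω => (v - qvRate K * ε) * ((B (r + ε) ω - B r ω) ^ 2 - w)) P :=
    (i2.sub (integrable_const w)).const_mul _
  have hI : ∫ ω, sqDev B K ε s ω * sqDev B K ε r ω ∂P =
      (gaussMoment 2 - 1) * incrCov H K s (s + ε) r (r + ε) ^ 2 +
      (v - qvRate K * ε) * (w - qvRate K * ε) := by
    simp only [e]
    rw [integral_add (i12.fun_add (j1.fun_add j2)) (integrable_const _),
      integral_add i12 (j1.fun_add j2), integral_add j1 j2, key, integral_const_mul,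
      integral_const_mul, integral_sub i1 (integrable_const v),
      integral_sub i2 (integrable_const w), ← hv, ← hw]
    simp
  set q := incrCov H K s (s + ε) r (r + ε) with hq
  have hbias : |(v - qvRate K * ε) * (w - qvRate K * ε)| ≤ (ε ^ 2 / a) ^ 2 := by
    rw [abs_mul, sq]
    exact mul_le_mul hve hwe (abs_nonneg _) (by positivity)
  have hcov : q ^ 2 ≤ (if s - r < ε then 4 * ε ^ 2 else 0) + (ε ^ 2 / a) ^ 2 := by
    by_cases h : s - r < ε
    · rw [if_pos h]
      have hp : 0 < √(2 * ε) := Real.sqrt_pos.2 (by linarith)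
      have hsq : √(2 * ε) ^ 2 = 2 * ε := Real.sq_sqrt (by linarith)
      have := abs_integral_mul_le hp hp (hE.integrable_pow ms 2) (hE.integrable_pow mr 2)
        (by rw [hsq]; exact hB.integral_incr_sq_le hs0.le hε.le)
        (by rw [hsq]; exact hB.integral_incr_sq_le hr0.le hε.le)
      rw [hB.integral_incr_mul_incr hs0.le hsn hr0.le hrn, ← hq, ← sq, hsq] at this
      have h2 : q ^ 2 ≤ (2 * ε) ^ 2 := by
        rw [← sq_abs]; exact pow_le_pow_left₀ (abs_nonneg _) this 2
      have h3 : 0 ≤ (ε ^ 2 / a) ^ 2 := by positivity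
      linarith
    · rw [if_neg h, zero_add, ← sq_abs]
      refine pow_le_pow_left₀ (abs_nonneg _) ?_ 2
      rw [hq, incrCov_comm]
      refine (hc.abs_incrCov_le_mul_div hr0.le (by linarith : r ≤ r + ε) (by linarith) hs0
        (by linarith : s ≤ s + ε)).trans ?_
      rw [add_sub_cancel_left, add_sub_cancel_left, ← sq]
      gcongr
      linarith
  rw [hI]
  refine (abs_add_le _ _).trans ?_
  rw [abs_mul, abs_of_nonneg (sq_nonneg q)]
  have h1 : |gaussMoment 2 - 1| ≤ gaussMoment 2 + 1 := abs_le.2 ⟨by linarith, by linarith⟩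
  have h2 := mul_le_mul h1 hcov (sq_nonneg q) (by linarith)
  refine (add_le_add h2 hbias).trans (le_of_eq ?_)
  split_ifs <;> ring

/-- The quadratic variation over `[c, d]` away from `0`: the mean square error is of order `ε`. -/
theorem exists_integral_sq_setIntegral_sqDev_le (hB : IsRegularBiFBm P H K B) {c d : ℝ}
    (hc : 0 < c) (hcd : c ≤ d) :
    ∃ C, 0 ≤ C ∧ ∀ ε, 0 < ε → ε ≤ 1 →
      ∫ ω, (∫ s in Set.Ioc c d, sqDev B K ε s ω) ^ 2 ∂P ≤ C * ε ^ 3 := by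
  have hP := hB.isProbabilityMeasure
  have hg := gaussMoment_nonneg 2
  have hd : 0 < d := hc.trans_le hcd
  refine ⟨2 * (4 * (gaussMoment 2 + 1) + 4 * (d * (gaussMoment 2 + 2) / c ^ 2)) * (d - c),
    mul_nonneg (by positivity) (sub_nonneg.2 hcd), fun ε hε hε1 => ?_⟩
  have h := integral_sq_setIntegral_le_of_kernel hcd hc.le (hB.measurable_sqDev ε)
    (fun s hs => (hB.memLp_sqDev (hc.trans hs.1).le hε).1)
    (fun s hs => (hB.memLp_sqDev (hc.trans hs.1).le hε).2)
    (c' := 4 * (gaussMoment 2 + 1) * ε ^ 3 + 4 * (d * (gaussMoment 2 + 2) / c ^ 2 * ε ^ 3))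
    (measurable_stripKernel (4 * (gaussMoment 2 + 1) * ε ^ 3)
      (d * (gaussMoment 2 + 2) / c ^ 2 * ε ^ 3) ε)
    (fun s hs r hr hrs => ?_) (by positivity)
    (fun s hs => lintegral_stripKernel_le (by positivity) (by positivity) hε (hc.trans hs.1))
  · refine h.trans (le_of_eq (by ring))
  · refine (hB.abs_integral_sqDev_mul_le hc hr.1.le hrs hε).trans ?_
    have hr0 : 0 < r := hc.trans hr.1
    have hs0 : 0 < s := hc.trans hs.1
    rw [stripKernel]
    refine add_le_add (le_of_eq ?_) ?_
    · split_ifs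
      · field_simp
      · rfl
    · have q1 := Real.sqrt_pos.2 hr0
      have q2 := Real.sqrt_pos.2 hs0
      have h1 : 1 / d ≤ 1 / √s * (1 / √r + 1 / √(s - r)) := by
        calc 1 / d ≤ 1 / s := one_div_le_one_div_of_le hs0 hs.2
          _ = 1 / √s * (1 / √s) := by
            rw [div_mul_div_comm, one_mul, Real.mul_self_sqrt hs0.le]
          _ ≤ 1 / √s * (1 / √r + 1 / √(s - r)) := by
            have h2 : 1 / √s ≤ 1 / √r := by gcongr
            have h3 : 0 ≤ 1 / √(s - r) := by positivity
            gcongr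
            linarith
      have h4 : ε ^ 4 ≤ ε ^ 3 := pow_le_pow_of_le_one hε.le hε1 (by norm_num)
      calc (gaussMoment 2 + 2) * (ε ^ 2 / c) ^ 2
          = d * (gaussMoment 2 + 2) / c ^ 2 * ε ^ 4 * (1 / d) := by field_simp
        _ ≤ _ := by gcongr

end IsRegularBiFBm

/-! ### Weighted quadratic variations and the limit for smooth integrands -/

/-- The integral of the deviations `sqDev` against the process `g (B_s)`, divided by `ε`. -/
noncomputable def devSum (B : ℝ → Ω → ℝ) (K : ℝ) (g : ℝ → ℝ) (c d ε : ℝ) (ω : Ω) : ℝ :=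
  1 / ε * ∫ s in Set.Ioc c d, g (B s ω) * sqDev B K ε s ω

namespace IsRegularBiFBm

variable {H K : ℝ} {B : ℝ → Ω → ℝ}

theorem measurable_comp_mul_sqDev (hB : IsRegularBiFBm P H K B) {g : ℝ → ℝ} (hg : Measurable g)
    (ε : ℝ) : Measurable (Function.uncurry fun s ω => g (B s ω) * sqDev B K ε s ω) :=
  (hg.comp hB.measurable).mul (hB.measurable_sqDev ε)

theorem memLp_bdd_mul_sqDev (hB : IsRegularBiFBm P H K B) {G : Ω → ℝ} (hG : Measurable G) {M : ℝ}
    (hM : ∀ ω, |G ω| ≤ M) {s ε : ℝ} (hs : 0 ≤ s) (hε : 0 < ε) :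
    MemLp (fun ω => G ω * sqDev B K ε s ω) 2 P ∧
      ∫ ω, (G ω * sqDev B K ε s ω) ^ 2 ∂P ≤ M ^ 2 * (devConst * ε) ^ 2 := by
  obtain ⟨h1, h2⟩ := hB.memLp_sqDev hs hε
  have hsm : Measurable (sqDev B K ε s) := (hB.measurable_sqDev ε).comp measurable_prodMk_left
  have h3 : MemLp (fun ω => G ω * sqDev B K ε s ω) 2 P :=
    h1.of_le_mul (c := M) (hG.mul hsm).aestronglyMeasurable (ae_of_all _ fun ω => by
      rw [norm_mul]; exact mul_le_mul_of_nonneg_right (hM ω) (norm_nonneg _))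
  refine ⟨h3, ?_⟩
  calc _ ≤ ∫ ω, M ^ 2 * sqDev B K ε s ω ^ 2 ∂P := by
        refine integral_mono h3.integrable_sq (h1.integrable_sq.const_mul _) fun ω => ?_
        simp only [mul_pow]
        refine mul_le_mul_of_nonneg_right ?_ (sq_nonneg _)
        rw [← sq_abs]
        exact pow_le_pow_left₀ (abs_nonneg _) (hM _) 2
    _ ≤ _ := by
        rw [integral_const_mul]
        exact mul_le_mul_of_nonneg_left h2 (sq_nonneg _)

theorem memLp_devSum (hB : IsRegularBiFBm P H K B) {g : ℝ → ℝ} (hg : Measurable g) {M : ℝ}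
    (hM : ∀ x, |g x| ≤ M) {c d ε : ℝ} (hc : 0 ≤ c) (hε : 0 < ε) :
    MemLp (devSum B K g c d ε) 2 P := by
  have hP := hB.isProbabilityMeasure
  have hmem : ∀ᵐ s ∂volume.restrict (Set.Ioc c d), s ∈ Set.Ioc c d :=
    ae_restrict_mem measurableSet_Ioc
  have h := fun s (hs : s ∈ Set.Ioc c d) => hB.memLp_bdd_mul_sqDev
    (hg.comp (hB.measurable_apply s)) (fun ω => hM _) (hc.trans hs.1.le) hε
  exact (memLp_two_integral (hB.measurable_comp_mul_sqDev hg ε) (hmem.mono fun s hs => (h s hs).1)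
    (hmem.mono fun s hs => (h s hs).2)).const_mul _

/-- Replacing the coefficient `g (B_s)` by its value at the left end point of the interval costs
at most a multiple of the cube of the length of the interval, for small `ε`. -/
theorem eventually_integral_devSum_sq_le (hB : IsRegularBiFBm P H K B) {φ g : ℝ → ℝ} {M : ℝ}
    (hφ : IsSmoothPair φ g M) {c d : ℝ} (hc : 0 < c) (hcd : c ≤ d) {η : ℝ} (hη : 0 < η) :
    ∀ᶠ ε in 𝓝[>] (0 : ℝ), ∫ ω, devSum B K g c d ε ω ^ 2 ∂P ≤
      4 * (M * (gaussMoment 2 + 1) * devConst) ^ 2 * (d - c) ^ 3 + η := by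
  have hP := hB.isProbabilityMeasure
  have hE := hB.isGaussianSpace
  have hg0 := gaussMoment_nonneg 2
  have hdc0 : 0 < devConst := one_pos.trans_le one_le_devConst
  have hM := hφ.pos
  have hgm := hφ.continuous_deriv.measurable
  obtain ⟨C, hC0, hC⟩ := hB.exists_integral_sq_setIntegral_sqDev_le hc hcd
  have hlim : Tendsto (fun ε : ℝ => 2 * M ^ 2 * C * ε) (𝓝[>] 0) (𝓝 0) := by
    have : Tendsto (fun ε : ℝ => 2 * M ^ 2 * C * ε) (𝓝 0) (𝓝 (2 * M ^ 2 * C * 0)) :=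
      tendsto_id.const_mul _
    rw [mul_zero] at this
    exact this.mono_left nhdsWithin_le_nhds
  filter_upwards [self_mem_nhdsWithin, Ioc_mem_nhdsGT one_pos, hlim.eventually (gt_mem_nhds hη)]
    with ε (hε : 0 < ε) hε1 hεη
  have hcont := fun ω => (hB.continuous_sqDev ε ω)
  -- The coefficient frozen at the left end point, and the remainder.
  set A₁ : Ω → ℝ := fun ω => 1 / ε * (g (B c ω) * ∫ s in Set.Ioc c d, sqDev B K ε s ω) with hA₁
  set A₂ : Ω → ℝ := fun ω =>
    1 / ε * ∫ s in Set.Ioc c d, (g (B s ω) - g (B c ω)) * sqDev B K ε s ω with hA₂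
  have hsplit : ∀ ω, devSum B K g c d ε ω = A₁ ω + A₂ ω := by
    intro ω
    have i1 : IntegrableOn (fun s => g (B c ω) * sqDev B K ε s ω) (Set.Ioc c d) :=
      (continuous_const.mul (hcont ω)).integrableOn_Ioc
    have i2 : IntegrableOn (fun s => (g (B s ω) - g (B c ω)) * sqDev B K ε s ω) (Set.Ioc c d) :=
      (((hφ.continuous_deriv.comp (hB.continuous ω)).sub continuous_const).mul
        (hcont ω)).integrableOn_Ioc
    simp only [hA₁, hA₂, devSum]
    have e1 : g (B c ω) * ∫ s in Set.Ioc c d, sqDev B K ε s ω =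
        ∫ s in Set.Ioc c d, g (B c ω) * sqDev B K ε s ω := (integral_const_mul _ _).symm
    rw [← mul_add, e1, ← integral_add i1 i2]
    congr 2
    ext s
    ring
  have hmem : ∀ᵐ s ∂volume.restrict (Set.Ioc c d), s ∈ Set.Ioc c d :=
    ae_restrict_mem measurableSet_Ioc
  have hZ : MemLp (fun ω => ∫ s in Set.Ioc c d, sqDev B K ε s ω) 2 P :=
    memLp_two_integral (hB.measurable_sqDev ε)
      (hmem.mono fun s hs => (hB.memLp_sqDev (hc.trans hs.1).le hε).1)
      (hmem.mono fun s hs => (hB.memLp_sqDev (hc.trans hs.1).le hε).2)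
  have hgc : Measurable fun ω => g (B c ω) := hgm.comp (hB.measurable_apply c)
  have m1' : MemLp (fun ω => g (B c ω) * ∫ s in Set.Ioc c d, sqDev B K ε s ω) 2 P :=
    hZ.of_le_mul (c := M) (hgc.aestronglyMeasurable.mul hZ.1) (ae_of_all _ fun ω => by
      rw [norm_mul]; exact mul_le_mul_of_nonneg_right (hφ.abs_deriv_le _) (norm_nonneg _))
  have m1 : MemLp A₁ 2 P := m1'.const_mul _
  have hRm : Measurable (Function.uncurry fun s ω =>
      (g (B s ω) - g (B c ω)) * sqDev B K ε s ω) :=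
    ((hgm.comp hB.measurable).sub (hgc.comp measurable_snd)).mul (hB.measurable_sqDev ε)
  have hR := fun s (hs : s ∈ Set.Ioc c d) => hB.memLp_bdd_mul_sqDev (ε := ε)
    ((hgm.comp (hB.measurable_apply s)).sub hgc) (M := M + M) (fun ω => (abs_sub _ _).trans
      (add_le_add (hφ.abs_deriv_le _) (hφ.abs_deriv_le _))) (hc.trans hs.1).le hε
  have m2 : MemLp A₂ 2 P := (memLp_two_integral hRm (hmem.mono fun s hs => (hR s hs).1)
    (hmem.mono fun s hs => (hR s hs).2)).const_mul _
  have b1 : ∫ ω, A₁ ω ^ 2 ∂P ≤ M ^ 2 * C * ε := by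
    simp only [hA₁, mul_pow (1 / ε), integral_const_mul]
    have : ∫ ω, (g (B c ω) * ∫ s in Set.Ioc c d, sqDev B K ε s ω) ^ 2 ∂P ≤ M ^ 2 * (C * ε ^ 3) := by
      refine le_trans ?_ (mul_le_mul_of_nonneg_left (hC ε hε hε1.2) (sq_nonneg M))
      rw [← integral_const_mul]
      refine integral_mono m1'.integrable_sq (hZ.integrable_sq.const_mul _) fun ω => ?_
      simp only [mul_pow]
      refine mul_le_mul_of_nonneg_right ?_ (sq_nonneg _)
      rw [← sq_abs]
      exact pow_le_pow_left₀ (abs_nonneg _) (hφ.abs_deriv_le _) 2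
    calc _ ≤ (1 / ε) ^ 2 * (M ^ 2 * (C * ε ^ 3)) := by gcongr
      _ = _ := by field_simp
  have b2 : ∫ ω, A₂ ω ^ 2 ∂P ≤ 2 * (M * (gaussMoment 2 + 1) * devConst) ^ 2 * (d - c) ^ 3 := by
    simp only [hA₂, mul_pow (1 / ε), integral_const_mul]
    have hbound : ∀ s ∈ Set.Ioc c d, ∫ ω, ((g (B s ω) - g (B c ω)) * sqDev B K ε s ω) ^ 2 ∂P ≤
        M ^ 2 * ((gaussMoment 2 + 1) ^ 2 * (2 * (d - c)) * (devConst * ε) ^ 2) := by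
      intro s hs
      have hsc : 0 < s - c := sub_pos.2 hs.1
      have hs0 := (hc.trans hs.1).le
      have hm := sub_mem_processSpan B hc.le hs0
      have hq : √(2 * (s - c)) ^ 2 = 2 * (s - c) := Real.sq_sqrt (by linarith)
      have hq0 : 0 < √(2 * (s - c)) := Real.sqrt_pos.2 (by linarith)
      have h4 := hE.integral_pow_four_le hm (β := √(2 * (s - c))) (by
        rw [hq, hB.integral_incr_sq hc.le hs0]
        exact hB.indices.incrCov_self_le_two_mul hc.le hs.1.le)
      obtain ⟨d1, d2⟩ := hB.integrable_sqDev_pow_four hs0 hε.le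
      have hH := abs_integral_mul_mul_mul_le (by positivity) (by positivity)
        (by positivity : 0 < devConst * ε) (by positivity : 0 < devConst * ε)
        (hE.integrable_pow hm 4) (hE.integrable_pow hm 4) d1 d1 h4 h4 d2 d2
      have hint : Integrable (fun ω => (B s ω - B c ω) * (B s ω - B c ω) *
          (sqDev B K ε s ω * sqDev B K ε s ω)) P := by
        have hsm : Measurable (sqDev B K ε s) :=
          (hB.measurable_sqDev ε).comp measurable_prodMk_left
        have hsd := (hB.measurable_apply s).sub (hB.measurable_apply c)
        refine ((hE.integrable_pow hm 4).add d1).mono'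
          ((hsd.mul hsd).mul (hsm.mul hsm)).aestronglyMeasurable (ae_of_all _ fun ω => ?_)
        rw [Real.norm_eq_abs, abs_of_nonneg (mul_nonneg (mul_self_nonneg _) (mul_self_nonneg _))]
        simp only [Pi.add_apply]
        nlinarith [sq_nonneg ((B s ω - B c ω) ^ 2 - sqDev B K ε s ω ^ 2),
          sq_nonneg ((B s ω - B c ω) ^ 2), sq_nonneg (sqDev B K ε s ω ^ 2)]
      calc ∫ ω, ((g (B s ω) - g (B c ω)) * sqDev B K ε s ω) ^ 2 ∂P
          ≤ ∫ ω, M ^ 2 * ((B s ω - B c ω) * (B s ω - B c ω) *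
            (sqDev B K ε s ω * sqDev B K ε s ω)) ∂P := by
            refine integral_mono (hR s hs).1.integrable_sq (hint.const_mul _) fun ω => ?_
            have h := hφ.lipschitz (B c ω) (B s ω)
            have h2 : (g (B s ω) - g (B c ω)) ^ 2 ≤ M ^ 2 * (B s ω - B c ω) ^ 2 := by
              rw [← sq_abs, ← sq_abs (B s ω - B c ω), ← mul_pow]
              exact pow_le_pow_left₀ (abs_nonneg _) h 2
            have := mul_le_mul_of_nonneg_right h2 (sq_nonneg (sqDev B K ε s ω))
            simp only [mul_pow]
            linarith
        _ ≤ M ^ 2 * ((gaussMoment 2 + 1) * √(2 * (s - c)) * ((gaussMoment 2 + 1) *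
            √(2 * (s - c))) * (devConst * ε) * (devConst * ε)) := by
            rw [integral_const_mul]
            exact mul_le_mul_of_nonneg_left ((le_abs_self _).trans hH) (sq_nonneg M)
        _ = M ^ 2 * ((gaussMoment 2 + 1) ^ 2 * √(2 * (s - c)) ^ 2 * (devConst * ε) ^ 2) := by ring
        _ ≤ _ := by
            rw [hq]
            have := hs.2
            gcongr
    have := integral_sq_setIntegral_le (P := P) hcd hRm (fun s hs => (hR s hs).1) hbound
    calc _ ≤ (1 / ε) ^ 2 * (M ^ 2 * ((gaussMoment 2 + 1) ^ 2 * (2 * (d - c)) *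
          (devConst * ε) ^ 2) * (d - c) ^ 2) := by gcongr
      _ = _ := by field_simp
  simp only [hsplit]
  have := integral_add_sq_le m1 m2
  linarith

/-- Halving the interval `n` times gains a factor `2⁻ⁿ` in the bound of
`eventually_integral_devSum_sq_le`, because the bound is cubic in the length while the second
moment of a sum of two terms at most doubles. -/
theorem eventually_integral_devSum_sq_le_pow (hB : IsRegularBiFBm P H K B) {φ g : ℝ → ℝ} {M : ℝ}
    (hφ : IsSmoothPair φ g M) (n : ℕ) :
    ∀ {c d : ℝ}, 0 < c → c ≤ d → ∀ {η : ℝ}, 0 < η →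
    ∀ᶠ ε in 𝓝[>] (0 : ℝ), ∫ ω, devSum B K g c d ε ω ^ 2 ∂P ≤
      4 * (M * (gaussMoment 2 + 1) * devConst) ^ 2 * (1 / 2) ^ n * (d - c) ^ 3 + η := by
  induction n with
  | zero =>
    intro c d hc hcd η hη
    simpa using hB.eventually_integral_devSum_sq_le hφ hc hcd hη
  | succ n ih =>
    intro c d hc hcd η hη
    have hcm : c ≤ (c + d) / 2 := by linarith
    have hmd : (c + d) / 2 ≤ d := by linarith
    filter_upwards [ih hc hcm (by positivity : 0 < η / 4),
      ih (hc.trans_le hcm) hmd (by positivity : 0 < η / 4), self_mem_nhdsWithin]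
      with ε h1 h2 (hε : 0 < ε)
    have hgm := hφ.continuous_deriv.measurable
    have e : ∀ ω, devSum B K g c d ε ω =
        devSum B K g c ((c + d) / 2) ε ω + devSum B K g ((c + d) / 2) d ε ω := by
      intro ω
      have hcont : Continuous fun s => g (B s ω) * sqDev B K ε s ω :=
        (hφ.continuous_deriv.comp (hB.continuous ω)).mul (hB.continuous_sqDev ε ω)
      simp only [devSum]
      rw [← mul_add, ← intervalIntegral.integral_of_le hcd, ← intervalIntegral.integral_of_le hcm,
        ← intervalIntegral.integral_of_le hmd, intervalIntegral.integral_add_adjacent_intervals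
        (hcont.intervalIntegrable _ _) (hcont.intervalIntegrable _ _)]
    simp only [e]
    have h3 := integral_add_sq_le
      (hB.memLp_devSum hgm hφ.abs_deriv_le (d := (c + d) / 2) hc.le hε)
      (hB.memLp_devSum hgm hφ.abs_deriv_le (d := d) (hc.trans_le hcm).le hε)
    have e1 : (c + d) / 2 - c = (d - c) / 2 := by ring
    have e2 : d - (c + d) / 2 = (d - c) / 2 := by ring
    rw [e1] at h1
    rw [e2] at h2
    have e3 : 4 * (M * (gaussMoment 2 + 1) * devConst) ^ 2 * (1 / 2) ^ (n + 1) * (d - c) ^ 3 =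
      4 * (4 * (M * (gaussMoment 2 + 1) * devConst) ^ 2 * (1 / 2) ^ n * ((d - c) / 2) ^ 3) := by
      rw [pow_succ]; ring
    linarith

/-- The remainder of the first order Taylor expansion in the approximation. -/
theorem integral_sq_taylorRemainder_le (hB : IsRegularBiFBm P H K B) {φ g : ℝ → ℝ} {M : ℝ}
    (hφ : IsSmoothPair φ g M) {c d ε : ℝ} (hc : 0 ≤ c) (hcd : c ≤ d) (hε : 0 < ε) :
    MemLp (fun ω => 1 / ε * ∫ s in Set.Ioc c d, (φ (B (s + ε) ω) - φ (B s ω) -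
      g (B s ω) * (B (s + ε) ω - B s ω)) * (B (s + ε) ω - B s ω)) 2 P ∧
    ∫ ω, (1 / ε * ∫ s in Set.Ioc c d, (φ (B (s + ε) ω) - φ (B s ω) -
      g (B s ω) * (B (s + ε) ω - B s ω)) * (B (s + ε) ω - B s ω)) ^ 2 ∂P ≤
      8 * M ^ 2 * gaussMoment 3 * (d - c) ^ 2 * ε := by
  have hP := hB.isProbabilityMeasure
  have hE := hB.isGaussianSpace
  have hM := hφ.pos
  have h3 := gaussMoment_nonneg 3
  set X : ℝ → Ω → ℝ := fun s ω => (φ (B (s + ε) ω) - φ (B s ω) -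
      g (B s ω) * (B (s + ε) ω - B s ω)) * (B (s + ε) ω - B s ω) with hX
  have hφm := hφ.continuous_fun.measurable
  have hgm := hφ.continuous_deriv.measurable
  have hXm : Measurable (Function.uncurry X) := by
    have h0 := hB.measurable_shift 0
    simp only [add_zero] at h0
    have h1 := hB.measurable_shift ε
    exact (((hφm.comp h1).sub (hφm.comp h0)).sub ((hgm.comp h0).mul (h1.sub h0))).mul (h1.sub h0)
  have hle : ∀ s ω, X s ω ^ 2 ≤ M ^ 2 * (B (s + ε) ω - B s ω) ^ 6 := by
    intro s ω
    have h := hφ.taylor (B s ω) (B (s + ε) ω)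
    have h1 : (φ (B (s + ε) ω) - φ (B s ω) - g (B s ω) * (B (s + ε) ω - B s ω)) ^ 2 ≤
        (M * (B (s + ε) ω - B s ω) ^ 2) ^ 2 := by
      rw [← sq_abs]; exact pow_le_pow_left₀ (abs_nonneg _) h 2
    simp only [hX, mul_pow]
    calc _ ≤ (M * (B (s + ε) ω - B s ω) ^ 2) ^ 2 * (B (s + ε) ω - B s ω) ^ 2 := by gcongr
      _ = _ := by ring
  have hL : ∀ s ∈ Set.Ioc c d, MemLp (X s) 2 P ∧
      ∫ ω, X s ω ^ 2 ∂P ≤ M ^ 2 * (gaussMoment 3 * (2 * ε) ^ 3) := by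
    intro s hs
    have hs0 : 0 ≤ s := hc.trans hs.1.le
    have hm := sub_mem_processSpan B hs0 (by linarith : 0 ≤ s + ε)
    have h6 := (hE.integrable_pow hm 6).const_mul (M ^ 2)
    have hsm : Measurable (X s) := hXm.comp measurable_prodMk_left
    have hi : Integrable (fun ω => X s ω ^ 2) P :=
      h6.mono' (hsm.pow_const 2).aestronglyMeasurable (ae_of_all _ fun ω => by
        rw [Real.norm_eq_abs, abs_of_nonneg (sq_nonneg _)]; exact hle s ω)
    refine ⟨(memLp_two_iff_integrable_sq hsm.aestronglyMeasurable).2 hi, ?_⟩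
    refine (integral_mono hi h6 (hle s)).trans ?_
    rw [integral_const_mul, hE.integral_pow_two_mul hm 3]
    have h0 : 0 ≤ ∫ ω, (B (s + ε) ω - B s ω) ^ 2 ∂P := integral_nonneg fun ω => sq_nonneg _
    have := hB.integral_incr_sq_le hs0 hε.le
    gcongr
  have hmem : ∀ᵐ s ∂volume.restrict (Set.Ioc c d), s ∈ Set.Ioc c d :=
    ae_restrict_mem measurableSet_Ioc
  refine ⟨(memLp_two_integral hXm (hmem.mono fun s hs => (hL s hs).1)
    (hmem.mono fun s hs => (hL s hs).2)).const_mul _, ?_⟩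
  have := integral_sq_setIntegral_le (P := P) hcd hXm (fun s hs => (hL s hs).1)
    (fun s hs => (hL s hs).2)
  simp only [mul_pow (1 / ε), integral_const_mul]
  calc _ ≤ (1 / ε) ^ 2 * (M ^ 2 * (gaussMoment 3 * (2 * ε) ^ 3) * (d - c) ^ 2) := by gcongr
    _ = _ := by field_simp; ring

theorem memLp_two_setIntegral_comp (hB : IsRegularBiFBm P H K B) {g : ℝ → ℝ} (hg : Measurable g)
    {M : ℝ} (hM : ∀ x, |g x| ≤ M) (c d : ℝ) :
    MemLp (fun ω => ∫ s in Set.Ioc c d, g (B s ω)) 2 P := by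
  have hP := hB.isProbabilityMeasure
  have hm : ∀ s, Measurable fun ω => g (B s ω) := fun s => hg.comp (hB.measurable_apply s)
  have hL : ∀ s, MemLp (fun ω => g (B s ω)) 2 P := fun s =>
    MemLp.of_bound (hm s).aestronglyMeasurable M (ae_of_all _ fun ω => hM _)
  refine memLp_two_integral (X := fun s ω => g (B s ω)) (c := M ^ 2) (hg.comp hB.measurable)
    (ae_of_all _ hL) (ae_of_all _ fun s => ?_)
  calc ∫ ω, g (B s ω) ^ 2 ∂P ≤ ∫ _, M ^ 2 ∂P := by
        refine integral_mono (hL s).integrable_sq (integrable_const _) fun ω => ?_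
        simp only
        rw [← sq_abs]
        exact pow_le_pow_left₀ (abs_nonneg _) (hM _) 2
    _ = M ^ 2 := by simp

/-- For smooth `φ` and on an interval away from `0`, the quadratic covariation exists in `L²` and
is the integral of `φ' (B_s)` with respect to `2^{1-K} ds`. -/
theorem eventually_integral_covApproxOn_sub_sq_le (hB : IsRegularBiFBm P H K B) {φ g : ℝ → ℝ}
    {M : ℝ} (hφ : IsSmoothPair φ g M) {c d : ℝ} (hc : 0 < c) (hcd : c ≤ d) {η : ℝ} (hη : 0 < η) :
    ∀ᶠ ε in 𝓝[>] (0 : ℝ), ∫ ω, (covApproxOn B φ c d ε ω -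
      qvRate K * ∫ s in Set.Ioc c d, g (B s ω)) ^ 2 ∂P ≤ η := by
  have hM := hφ.pos
  have hgm := hφ.continuous_deriv.measurable
  set D := 4 * (M * (gaussMoment 2 + 1) * devConst) ^ 2 * (d - c) ^ 3 with hD
  obtain ⟨n, hn⟩ : ∃ n : ℕ, D * (1 / 2) ^ n < η / 8 := by
    have : Tendsto (fun n : ℕ => D * (1 / 2 : ℝ) ^ n) atTop (𝓝 (D * 0)) :=
      (tendsto_pow_atTop_nhds_zero_of_lt_one (by norm_num) (by norm_num)).const_mul D
    rw [mul_zero] at this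
    exact (this.eventually (gt_mem_nhds (by positivity))).exists
  have hlim : Tendsto (fun ε : ℝ => 8 * M ^ 2 * gaussMoment 3 * (d - c) ^ 2 * ε)
      (𝓝[>] 0) (𝓝 0) := by
    have : Tendsto (fun ε : ℝ => 8 * M ^ 2 * gaussMoment 3 * (d - c) ^ 2 * ε) (𝓝 0)
        (𝓝 (8 * M ^ 2 * gaussMoment 3 * (d - c) ^ 2 * 0)) := tendsto_id.const_mul _
    rw [mul_zero] at this
    exact this.mono_left nhdsWithin_le_nhds
  filter_upwards [self_mem_nhdsWithin,
    hB.eventually_integral_devSum_sq_le_pow hφ n hc hcd (by positivity : 0 < η / 8),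
    hlim.eventually (gt_mem_nhds (by positivity : 0 < η / 4))] with ε (hε : 0 < ε) h1 h2
  obtain ⟨m1, b1⟩ := hB.integral_sq_taylorRemainder_le hφ hc.le hcd hε
  have e : ∀ ω, covApproxOn B φ c d ε ω - qvRate K * ∫ s in Set.Ioc c d, g (B s ω) =
      1 / ε * (∫ s in Set.Ioc c d, (φ (B (s + ε) ω) - φ (B s ω) -
      g (B s ω) * (B (s + ε) ω - B s ω)) * (B (s + ε) ω - B s ω)) + devSum B K g c d ε ω := by
    intro ω
    have hb := hB.continuous ω
    have hb' : Continuous fun s => B (s + ε) ω := hb.comp (continuous_id.add continuous_const)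
    have hgc : Continuous fun s => g (B s ω) := hφ.continuous_deriv.comp hb
    have hφc : Continuous fun s => φ (B s ω) := hφ.continuous_fun.comp hb
    have hφc' : Continuous fun s => φ (B (s + ε) ω) := hφ.continuous_fun.comp hb'
    have hdev := hB.continuous_sqDev ε ω
    have i1 : IntegrableOn (fun s => (φ (B (s + ε) ω) - φ (B s ω) -
        g (B s ω) * (B (s + ε) ω - B s ω)) * (B (s + ε) ω - B s ω)) (Set.Ioc c d) :=
      (((hφc'.sub hφc).sub (hgc.mul (hb'.sub hb))).mul (hb'.sub hb)).integrableOn_Ioc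
    have i2 : IntegrableOn (fun s => g (B s ω) * sqDev B K ε s ω) (Set.Ioc c d) :=
      (hgc.mul hdev).integrableOn_Ioc
    have i3 : IntegrableOn (fun s => (φ (B (s + ε) ω) - φ (B s ω)) * (B (s + ε) ω - B s ω))
        (Set.Ioc c d) := ((hφc'.sub hφc).mul (hb'.sub hb)).integrableOn_Ioc
    have i4 : IntegrableOn (fun s => (qvRate K * ε) * g (B s ω)) (Set.Ioc c d) :=
      (continuous_const.mul hgc).integrableOn_Ioc
    have h4 : qvRate K * ∫ s in Set.Ioc c d, g (B s ω) =
        1 / ε * ∫ s in Set.Ioc c d, (qvRate K * ε) * g (B s ω) := by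
      rw [integral_const_mul]; field_simp
    rw [covApproxOn, devSum, h4, intervalIntegral.integral_of_le hcd, ← mul_sub, ← mul_add,
      ← integral_sub i3 i4, ← integral_add i1 i2]
    congr 2
    ext s
    simp only [sqDev]
    ring
  simp only [e]
  have h3 := integral_add_sq_le m1 (hB.memLp_devSum hgm hφ.abs_deriv_le (d := d) hc.le hε)
  have e2 : 4 * (M * (gaussMoment 2 + 1) * devConst) ^ 2 * (1 / 2) ^ n * (d - c) ^ 3 =
    D * (1 / 2) ^ n := by rw [hD]; ring
  rw [e2] at h1
  linarith

end IsRegularBiFBm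

/-! ### Regular versions -/

/-- On a measurable set of full measure the paths are continuous and agree at rational times with
measurable random variables; setting the paths to `0` off this set gives a regular version. -/
theorem IsBiFBm.exists_isRegularBiFBm {H K : ℝ} {B : ℝ → Ω → ℝ} (h : IsBiFBm P H K B)
    (hi : CriticalIndices H K) :
    ∃ B' : ℝ → Ω → ℝ, IsRegularBiFBm P H K B' ∧ ∀ᵐ ω ∂P, ∀ t, 0 ≤ t → B' t ω = B t ω := by
  have hX : ∀ t : ℝ, AEMeasurable (fun ω => B (max t 0) ω) P := fun t =>
    (h.gaussian.hasGaussianLaw_eval (⟨max t 0, le_max_right _ _⟩ : ℝ≥0)).aemeasurable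
  have hae : ∀ᵐ ω ∂P, (Continuous fun t : ℝ => B (max t 0) ω) ∧
      ∀ q : ℚ, B (max (q : ℝ) 0) ω = (hX q).mk _ ω := by
    filter_upwards [h.continuous_paths, ae_all_iff.2 fun q : ℚ => (hX q).ae_eq_mk] with ω h1 h2
    exact ⟨h1.comp_continuous (continuous_id.max continuous_const) fun t =>
      Set.mem_Ici.2 (le_max_right t 0), h2⟩
  obtain ⟨S, hS, hSm, hSp⟩ := hae.exists_measurable_mem
  set B' : ℝ → Ω → ℝ := fun t => S.indicator fun ω => B (max t 0) ω with hB'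
  have hcont : ∀ ω, Continuous fun t => B' t ω := by
    intro ω
    by_cases hω : ω ∈ S
    · simpa only [hB', Set.indicator_of_mem hω] using (hSp ω hω).1
    · simpa only [hB', Set.indicator_of_notMem hω] using continuous_const
  have hrat : ∀ q : ℚ, Measurable (B' q) := by
    intro q
    have e : B' q = S.indicator ((hX q).mk _) := by
      ext ω
      by_cases hω : ω ∈ S
      · simp only [hB', Set.indicator_of_mem hω, (hSp ω hω).2 q]
      · simp only [hB', Set.indicator_of_notMem hω]
    rw [e]
    exact (hX q).measurable_mk.indicator hSm
  have hmeas : ∀ t, Measurable (B' t) := by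
    intro t
    obtain ⟨u, -, -, hu⟩ := Real.exists_seq_rat_strictMono_tendsto t
    exact measurable_of_tendsto_metrizable (fun n => hrat (u n))
      (tendsto_pi_nhds.2 fun ω => ((hcont ω).tendsto t).comp hu)
  have hEq : ∀ᵐ ω ∂P, ∀ t, 0 ≤ t → B' t ω = B t ω := by
    filter_upwards [hS] with ω hω t ht
    simp only [hB', Set.indicator_of_mem hω, max_eq_left ht]
  have hEq' : ∀ t, 0 ≤ t → B' t =ᵐ[P] B t := fun t ht => hEq.mono fun ω hω => hω t ht
  refine ⟨B', ⟨hi, ⟨h.gaussian.congr fun t => (hEq' t t.2).symm, ?_, fun t ht => ?_,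
    fun t s ht hs => ?_, ?_⟩, measurable_uncurry_of_continuous_of_measurable hcont hmeas, hcont⟩,
    hEq⟩
  · filter_upwards [h.zero, hEq' 0 le_rfl] with ω h1 h2
    rw [h2, h1]
  · rw [integral_congr_ae (hEq' t ht), h.mean t ht]
  · rw [← h.cov t s ht hs]
    exact integral_congr_ae ((hEq' t ht).mul (hEq' s hs))
  · exact ae_of_all _ fun ω => (hcont ω).continuousOn

theorem covApprox_ae_eq {B B' : ℝ → Ω → ℝ} (h : ∀ᵐ ω ∂P, ∀ t, 0 ≤ t → B' t ω = B t ω)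
    (f : ℝ → ℝ) {t ε : ℝ} (ht : 0 ≤ t) (hε : 0 < ε) :
    covApproxOn B' f 0 t ε =ᵐ[P] covApprox B f t ε := by
  filter_upwards [h] with ω hω
  simp only [covApprox, covApproxOn]
  congr 1
  refine intervalIntegral.integral_congr fun s hs => ?_
  rw [Set.uIcc_of_le ht] at hs
  simp only [hω s hs.1, hω (s + ε) (by linarith [hs.1])]

/-! ### One-dimensional marginals -/

theorem gaussianPDFReal_le_mul {s T : ℝ≥0} (hs : 0 < s) (hsT : s ≤ T) (x : ℝ) :
    gaussianPDFReal 0 s x ≤ √(T / s) * gaussianPDFReal 0 T x := by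
  have hs' : (0 : ℝ) < s := hs
  have hsT' : (s : ℝ) ≤ T := hsT
  have hT' : (0 : ℝ) < T := hs'.trans_le hsT'
  have e : √(T / s : ℝ) * (√(2 * Real.pi * T))⁻¹ = (√(2 * Real.pi * s))⁻¹ := by
    have h1 := Real.sqrt_pos.2 hT'
    have h2 := Real.sqrt_pos.2 hs'
    have h3 := Real.sqrt_pos.2 Real.two_pi_pos
    rw [Real.sqrt_div' _ hs'.le, Real.sqrt_mul Real.two_pi_pos.le,
      Real.sqrt_mul Real.two_pi_pos.le]
    field_simp
  rw [gaussianPDFReal, gaussianPDFReal, ← mul_assoc, e]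
  refine mul_le_mul_of_nonneg_left (Real.exp_le_exp.2 ?_) (by positivity)
  rw [neg_div, neg_div, neg_le_neg_iff]
  gcongr

theorem integral_gaussianReal_le_mul {s T : ℝ≥0} (hs : 0 < s) (hsT : s ≤ T) {h : ℝ → ℝ}
    (hm : Measurable h) (h0 : ∀ x, 0 ≤ h x) {C : ℝ} (hC : ∀ x, h x ≤ C) :
    ∫ x, h x ∂gaussianReal 0 s ≤ √(T / s) * ∫ x, h x ∂gaussianReal 0 T := by
  have i : ∀ v : ℝ≥0, Integrable (fun x => gaussianPDFReal 0 v x * h x) := fun v =>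
    (integrable_gaussianPDFReal 0 v).mul_bdd (c := C) hm.aestronglyMeasurable
      (ae_of_all _ fun x => by rw [Real.norm_eq_abs, abs_of_nonneg (h0 x)]; exact hC x)
  rw [integral_gaussianReal_eq_integral_smul hs.ne',
    integral_gaussianReal_eq_integral_smul (hs.trans_le hsT).ne', ← integral_const_mul]
  simp only [smul_eq_mul]
  refine integral_mono (i s) ((i T).const_mul _) fun x => ?_
  simp only
  rw [← mul_assoc]
  exact mul_le_mul_of_nonneg_right (gaussianPDFReal_le_mul hs hsT x) (h0 x)

namespace IsRegularBiFBm

variable {H K : ℝ} {B : ℝ → Ω → ℝ}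

/-- On `[δ, T]` with `δ > 0` the laws of the process are dominated by a single Gaussian law, so that
approximation in `L⁴` of that law is uniform in time. -/
theorem integral_comp_le (hB : IsRegularBiFBm P H K B) {h : ℝ → ℝ} (hm : Measurable h)
    (h0 : ∀ x, 0 ≤ h x) {C : ℝ} (hC : ∀ x, h x ≤ C) {δ s T : ℝ} (hδ : 0 < δ) (hs : δ ≤ s)
    (hsT : s ≤ T) :
    ∫ ω, h (B s ω) ∂P ≤ √(T / δ) * ∫ x, h x ∂gaussianReal 0 T.toNNReal := by
  have hs0 : 0 < s := hδ.trans_le hs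
  have hT0 : 0 < T := hs0.trans_le hsT
  have e : ∫ ω, h (B s ω) ∂P = ∫ x, h x ∂gaussianReal 0 s.toNNReal := by
    have hl := hB.isGaussianSpace.map_eq (mem_processSpan B hs0.le)
    rw [hB.integral_sq hs0.le] at hl
    rw [← hl, integral_map (hB.measurable_apply s).aemeasurable hm.aestronglyMeasurable]
  rw [e]
  refine (integral_gaussianReal_le_mul (Real.toNNReal_pos.2 hs0) (Real.toNNReal_mono hsT) hm h0
    hC).trans ?_
  rw [Real.coe_toNNReal _ hs0.le, Real.coe_toNNReal _ hT0.le]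
  refine mul_le_mul_of_nonneg_right (Real.sqrt_le_sqrt ?_) (integral_nonneg h0)
  gcongr

end IsRegularBiFBm

/-! ### Convergence in `L²` -/

theorem eLpNorm_pow_eq_ofReal_integral {α : Type*} [MeasurableSpace α] {μ : Measure α} {f : α → ℝ}
    {n : ℕ} (hn : Even n) (hn0 : n ≠ 0) (hf : MemLp f n μ) :
    eLpNorm f n μ ^ n = ENNReal.ofReal (∫ x, f x ^ n ∂μ) := by
  have h0 : 0 ≤ ∫ x, f x ^ n ∂μ := integral_nonneg fun x => hn.pow_nonneg _
  rw [hf.eLpNorm_eq_integral_rpow_norm (by exact_mod_cast hn0) (ENNReal.natCast_ne_top n)]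
  simp only [ENNReal.toReal_natCast, Real.rpow_natCast, Real.norm_eq_abs, hn.pow_abs]
  rw [← ENNReal.ofReal_pow (by positivity), Real.rpow_inv_natCast_pow h0 hn0]

theorem eLpNorm_two_eq_ofReal_sqrt {f : Ω → ℝ} (hf : MemLp f 2 P) :
    eLpNorm f 2 P = ENNReal.ofReal √(∫ ω, f ω ^ 2 ∂P) := by
  have h := eLpNorm_pow_eq_ofReal_integral (n := 2) even_two two_ne_zero hf
  have h0 : 0 ≤ ∫ ω, f ω ^ 2 ∂P := integral_nonneg fun ω => sq_nonneg _
  rw [← Real.sq_sqrt h0, ENNReal.ofReal_pow (Real.sqrt_nonneg _)] at h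
  simpa using (ENNReal.pow_right_strictMono two_ne_zero).injective h

/-- Completeness of `L²` in the form used here: a family that comes arbitrarily close to elements
of `L²` along a filter converges in `L²`. -/
theorem exists_tendsto_eLpNorm_sub {ι : Type*} {l : Filter ι} [l.NeBot] {J : ι → Ω → ℝ}
    (hJ : ∀ᶠ i in l, MemLp (J i) 2 P)
    (h : ∀ η : ℝ, 0 < η → ∃ Q : Ω → ℝ, MemLp Q 2 P ∧ ∀ᶠ i in l, ∫ ω, (J i ω - Q ω) ^ 2 ∂P ≤ η) :
    ∃ Q : Ω → ℝ, MemLp Q 2 P ∧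
      Tendsto (fun i => eLpNorm (fun ω => J i ω - Q ω) 2 P) l (𝓝 0) := by
  classical
  set F : ι → Lp ℝ 2 P := fun i => if hi : MemLp (J i) 2 P then hi.toLp else 0 with hF
  have hFJ : ∀ i, MemLp (J i) 2 P → F i =ᵐ[P] J i := fun i hi => by
    simp only [hF, dif_pos hi]; exact hi.coeFn_toLp
  have hC : Cauchy (map F l) := by
    refine Metric.cauchy_iff.2 ⟨inferInstance, fun r hr => ?_⟩
    obtain ⟨Q, hQ, hev⟩ := h ((r / 3) ^ 2) (by positivity)
    refine ⟨Metric.closedBall hQ.toLp (r / 3), ?_, fun x hx y hy => ?_⟩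
    · rw [mem_map]
      filter_upwards [hJ, hev] with i hi hle
      have e : eLpNorm (⇑(F i) - ⇑hQ.toLp) 2 P = eLpNorm (J i - Q) 2 P :=
        eLpNorm_congr_ae ((hFJ i hi).sub hQ.coeFn_toLp)
      rw [Set.mem_preimage, Metric.mem_closedBall, Lp.dist_def, e,
        eLpNorm_two_eq_ofReal_sqrt (hi.sub hQ), ENNReal.toReal_ofReal (Real.sqrt_nonneg _)]
      exact Real.sqrt_le_iff.2 ⟨by positivity, hle⟩
    · rw [Metric.mem_closedBall] at hx hy
      linarith [dist_triangle_right x y hQ.toLp]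
  obtain ⟨q, hq⟩ := CompleteSpace.complete hC
  refine ⟨q, Lp.memLp q, ?_⟩
  have ht : Tendsto (fun i => edist (F i) q) l (𝓝 0) := tendsto_iff_edist_tendsto_0.1 hq
  refine ht.congr' ?_
  filter_upwards [hJ] with i hi
  rw [Lp.edist_def]
  exact eLpNorm_congr_ae ((hFJ i hi).sub (ae_eq_refl _))

theorem integral_sq_le_of_tendsto {ι : Type*} {l : Filter ι} [l.NeBot] {J : ι → Ω → ℝ}
    {Q : Ω → ℝ} {c : ℝ} (hQ : MemLp Q 2 P)
    (hJ : ∀ᶠ i in l, MemLp (J i) 2 P ∧ ∫ ω, J i ω ^ 2 ∂P ≤ c)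
    (h : Tendsto (fun i => eLpNorm (fun ω => J i ω - Q ω) 2 P) l (𝓝 0)) :
    ∫ ω, Q ω ^ 2 ∂P ≤ c := by
  have hc : 0 ≤ c := by
    obtain ⟨i, -, hi⟩ := hJ.exists
    exact (integral_nonneg fun ω => sq_nonneg _).trans hi
  have key : eLpNorm Q 2 P ≤ ENNReal.ofReal √c := by
    have h1 : Tendsto (fun i => ENNReal.ofReal √c + eLpNorm (fun ω => J i ω - Q ω) 2 P) l
        (𝓝 (ENNReal.ofReal √c + 0)) := h.const_add _
    rw [add_zero] at h1
    refine ge_of_tendsto h1 (hJ.mono fun i hi => ?_)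
    have e : Q = J i - fun ω => J i ω - Q ω := by ext ω; simp
    calc eLpNorm Q 2 P = eLpNorm (J i - fun ω => J i ω - Q ω) 2 P := by rw [← e]
      _ ≤ eLpNorm (J i) 2 P + eLpNorm (fun ω => J i ω - Q ω) 2 P :=
        eLpNorm_sub_le hi.1.1 (hi.1.sub hQ).1 one_le_two
      _ ≤ _ := by
        rw [eLpNorm_two_eq_ofReal_sqrt hi.1]
        gcongr
        exact hi.2
  rw [eLpNorm_two_eq_ofReal_sqrt hQ, ENNReal.ofReal_le_ofReal_iff (Real.sqrt_nonneg _)] at key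
  exact (Real.sqrt_le_sqrt_iff hc).1 key

/-- A bounded function is approximated in `L⁴` of a Gaussian measure by test functions. -/
theorem exists_contDiff_integral_sub_pow_four_le {μ : Measure ℝ} [IsFiniteMeasure μ] {f : ℝ → ℝ}
    (hf : Measurable f) {M : ℝ} (hM : ∀ x, |f x| ≤ M) {r : ℝ} (hr : 0 < r) :
    ∃ φ : ℝ → ℝ, HasCompactSupport φ ∧ ContDiff ℝ 2 φ ∧ ∫ x, (f x - φ x) ^ 4 ∂μ ≤ r ^ 4 := by
  have hfL : MemLp f ((4 : ℕ) : ℝ≥0∞) μ := MemLp.of_bound hf.aestronglyMeasurable M (ae_of_all _ hM)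
  obtain ⟨φ, hc, hd, hle⟩ := hfL.exist_eLpNorm_sub_le (ENNReal.natCast_ne_top 4)
    (by exact_mod_cast (by norm_num : 1 ≤ 4)) hr
  obtain ⟨C, hC⟩ := hc.exists_bound_of_continuous hd.continuous
  have hφL : MemLp φ ((4 : ℕ) : ℝ≥0∞) μ :=
    MemLp.of_bound hd.continuous.aestronglyMeasurable C (ae_of_all _ hC)
  refine ⟨φ, hc, hd.of_le (WithTop.coe_le_coe.2 le_top), ?_⟩
  have h := eLpNorm_pow_eq_ofReal_integral (by decide) (by norm_num) (hfL.sub hφL)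
  have h2 := pow_le_pow_left₀ zero_le hle 4
  rw [h, ← ENNReal.ofReal_pow hr.le, ENNReal.ofReal_le_ofReal_iff (by positivity)] at h2
  exact h2

namespace IsRegularBiFBm

variable {H K : ℝ} {B : ℝ → Ω → ℝ}

theorem intervalIntegrable_covApproxOn (hB : IsRegularBiFBm P H K B) {f : ℝ → ℝ}
    (hf : Measurable f) {M : ℝ} (hM : ∀ x, |f x| ≤ M) {a b : ℝ} (hab : a ≤ b) (ε : ℝ) (ω : Ω) :
    IntervalIntegrable (fun s => (f (B (s + ε) ω) - f (B s ω)) * (B (s + ε) ω - B s ω))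
      volume a b := by
  rw [intervalIntegrable_iff_integrableOn_Ioc_of_le hab]
  have h := (hB.integrable_weighted hf hM a b ε ε ω).sub (hB.integrable_weighted hf hM a b 0 ε ω)
  refine h.congr (ae_of_all _ fun s => ?_)
  simp only [Pi.sub_apply, add_zero, sub_mul]

theorem covApproxOn_add_interval (hB : IsRegularBiFBm P H K B) {f : ℝ → ℝ} (hf : Measurable f)
    {M : ℝ} (hM : ∀ x, |f x| ≤ M) {a b c : ℝ} (hab : a ≤ b) (hbc : b ≤ c) (ε : ℝ) (ω : Ω) :
    covApproxOn B f a c ε ω = covApproxOn B f a b ε ω + covApproxOn B f b c ε ω := by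
  rw [covApproxOn, covApproxOn, covApproxOn, ← mul_add,
    intervalIntegral.integral_add_adjacent_intervals
      (hB.intervalIntegrable_covApproxOn hf hM hab ε ω)
      (hB.intervalIntegrable_covApproxOn hf hM hbc ε ω)]

theorem covApproxOn_sub (hB : IsRegularBiFBm P H K B) {f g : ℝ → ℝ} (hf : Measurable f)
    (hg : Measurable g) {M N : ℝ} (hM : ∀ x, |f x| ≤ M) (hN : ∀ x, |g x| ≤ N) {a b : ℝ}
    (hab : a ≤ b) (ε : ℝ) (ω : Ω) :
    covApproxOn B (fun x => f x - g x) a b ε ω =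
      covApproxOn B f a b ε ω - covApproxOn B g a b ε ω := by
  rw [covApproxOn, covApproxOn, covApproxOn, ← mul_sub,
    ← intervalIntegral.integral_sub
      (hB.intervalIntegrable_covApproxOn hf hM hab ε ω)
      (hB.intervalIntegrable_covApproxOn hg hN hab ε ω)]
  congr 1
  exact intervalIntegral.integral_congr fun s _ => by ring

theorem integral_covApproxOn_sq_le_of_bound (hB : IsRegularBiFBm P H K B) {f : ℝ → ℝ}
    (hf : Measurable f) {S : ℝ} (hS : 0 < S) (hM : ∀ x, |f x| ≤ S) {a b ε : ℝ} (ha : 0 ≤ a)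
    (hab : a ≤ b) (hε : 0 < ε) :
    ∫ ω, covApproxOn B f a b ε ω ^ 2 ∂P ≤ covConst * S ^ 2 * (b - a) := by
  have hP := hB.isProbabilityMeasure
  refine hB.integral_covApproxOn_sq_le hf hM ha hab hε hS fun u _ => ?_
  have h4 : ∀ x, f x ^ 4 ≤ S ^ 4 := fun x => by
    rw [← (by decide : Even 4).pow_abs]; exact pow_le_pow_left₀ (abs_nonneg _) (hM x) 4
  calc ∫ ω, f (B u ω) ^ 4 ∂P ≤ ∫ _, S ^ 4 ∂P :=
        integral_mono_of_nonneg (ae_of_all _ fun ω => (by decide : Even 4).pow_nonneg _)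
          (integrable_const _) (ae_of_all _ fun ω => h4 _)
    _ = S ^ 4 := by simp

/-- The approximations are arbitrarily close to elements of `L²`: near time `0` the uniform bound
makes them small, and away from `0` the function `f` is replaced by a test function `φ` at a small
cost, again by the uniform bound, the limit for `φ` being `qvRate K * ∫ φ' (B s) ds`. -/
theorem exists_eventually_integral_covApproxOn_sub_sq_le (hB : IsRegularBiFBm P H K B) {f : ℝ → ℝ}
    (hf : Measurable f) {M : ℝ} (hM0 : 0 < M) (hM : ∀ x, |f x| ≤ M) {t : ℝ} (ht : 0 ≤ t) {η : ℝ}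
    (hη : 0 < η) :
    ∃ Q : Ω → ℝ, MemLp Q 2 P ∧
      ∀ᶠ ε in 𝓝[>] (0 : ℝ), ∫ ω, (covApproxOn B f 0 t ε ω - Q ω) ^ 2 ∂P ≤ η := by
  have hc := covConst_pos
  set δ : ℝ := η / (6 * (covConst * M ^ 2)) with hδ
  have hδ0 : 0 < δ := by positivity
  have hδη : covConst * M ^ 2 * δ = η / 6 := by rw [hδ]; field_simp
  -- An interval shorter than `δ`, including `t = 0`, is covered by the uniform bound alone.
  rcases le_or_gt t δ with htδ | htδ
  · refine ⟨0, MemLp.zero, ?_⟩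
    filter_upwards [self_mem_nhdsWithin] with ε (hε : 0 < ε)
    simp only [Pi.zero_apply, sub_zero]
    calc _ ≤ covConst * M ^ 2 * (t - 0) := hB.integral_covApproxOn_sq_le_of_bound hf hM0 hM le_rfl
          ht hε
      _ ≤ covConst * M ^ 2 * δ := by gcongr; linarith
      _ ≤ η := by linarith
  have ht0 : 0 < t := hδ0.trans htδ
  set S : ℝ := √(η / (12 * (covConst * t))) with hS
  have hS0 : 0 < S := Real.sqrt_pos.2 (by positivity)
  have hSη : covConst * S ^ 2 * t = η / 12 := by
    rw [hS, Real.sq_sqrt (by positivity)]; field_simp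
  -- `c` dominates the density of `B s`, `δ ≤ s ≤ t + 1`, relative to the law of `B (t + 1)`.
  set c : ℝ := 1 + √((t + 1) / δ) with hcdef
  have hc1 : 1 ≤ c := le_add_of_nonneg_right (Real.sqrt_nonneg _)
  have hc0 : 0 < c := by linarith
  obtain ⟨φ, hφc, hφd, hφ4⟩ := exists_contDiff_integral_sub_pow_four_le
    (μ := gaussianReal 0 (t + 1).toNNReal) hf hM (div_pos hS0 hc0)
  obtain ⟨N, hN⟩ := hφc.exists_bound_of_continuous hφd.continuous
  simp only [Real.norm_eq_abs] at hN
  obtain ⟨L, hL⟩ := hφd.exists_isSmoothPair hφc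
  have hφm := hφd.continuous.measurable
  have hdm : Measurable fun x => f x - φ x := hf.sub hφm
  have hdb : ∀ x, |f x - φ x| ≤ M + N := fun x =>
    (abs_sub _ _).trans (add_le_add (hM x) (hN x))
  have hQ : MemLp (fun ω => qvRate K * ∫ s in Set.Ioc δ t, deriv φ (B s ω)) 2 P :=
    (hB.memLp_two_setIntegral_comp hL.continuous_deriv.measurable hL.abs_deriv_le δ t).const_mul _
  refine ⟨_, hQ, ?_⟩
  filter_upwards [self_mem_nhdsWithin, Ioc_mem_nhdsGT one_pos,
    hB.eventually_integral_covApproxOn_sub_sq_le hL hδ0 htδ.le (by positivity : 0 < η / 12)]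
    with ε (hε : 0 < ε) hε1 h3
  have h1 := hB.integral_covApproxOn_sq_le_of_bound hf hM0 hM le_rfl hδ0.le hε
  have h2 : ∫ ω, covApproxOn B (fun x => f x - φ x) δ t ε ω ^ 2 ∂P ≤
      covConst * S ^ 2 * (t - δ) := by
    refine hB.integral_covApproxOn_sq_le hdm hdb hδ0.le htδ.le hε hS0 fun u hu => ?_
    have hd4 : ∀ x, (f x - φ x) ^ 4 ≤ (M + N) ^ 4 := fun x => by
      rw [← (by decide : Even 4).pow_abs]; exact pow_le_pow_left₀ (abs_nonneg _) (hdb x) 4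
    refine (hB.integral_comp_le (hdm.pow_const 4) (fun x => (by decide : Even 4).pow_nonneg _)
      hd4 hδ0 hu.1.le (hu.2.trans (by linarith [hε1.2] : t + ε ≤ t + 1))).trans ?_
    calc √((t + 1) / δ) * ∫ x, (f x - φ x) ^ 4 ∂gaussianReal 0 (t + 1).toNNReal
        ≤ c * (S / c) ^ 4 := by
          refine mul_le_mul (by rw [hcdef]; linarith) hφ4
            (integral_nonneg fun x => (by decide : Even 4).pow_nonneg _) hc0.le
      _ = S ^ 4 / c ^ 3 := by field_simp
      _ ≤ S ^ 4 := div_le_self (by positivity) (one_le_pow₀ hc1)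
  have m1 := hB.memLp_covApproxOn hf hM le_rfl hδ0.le hε
  have m2 := hB.memLp_covApproxOn hdm hdb hδ0.le htδ.le hε
  have m3 := (hB.memLp_covApproxOn hφm hN hδ0.le htδ.le hε).sub hQ
  have hsplit : ∀ ω, covApproxOn B f 0 t ε ω -
      qvRate K * (∫ s in Set.Ioc δ t, deriv φ (B s ω)) = covApproxOn B f 0 δ ε ω +
      (covApproxOn B (fun x => f x - φ x) δ t ε ω + (covApproxOn B φ δ t ε ω -
        qvRate K * ∫ s in Set.Ioc δ t, deriv φ (B s ω))) := fun ω => by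
    rw [hB.covApproxOn_add_interval hf hM hδ0.le htδ.le,
      hB.covApproxOn_sub hf hφm hM hN htδ.le]
    ring
  have a1 := integral_add_sq_le m1 (m2.add m3)
  have a2 := integral_add_sq_le m2 m3
  simp only [Pi.add_apply, Pi.sub_apply] at a1 a2
  simp only [hsplit]
  have h2' : covConst * S ^ 2 * (t - δ) ≤ η / 12 := by
    rw [← hSη]; gcongr; linarith
  rw [sub_zero, hδη] at h1
  linarith

end IsRegularBiFBm

end

theorem mainTheorem5 (H K : ℝ) (hH : 0 < H ∧ H < 1) (hK : 0 < K ∧ K ≤ 1) (hHK : 2 * H * K = 1) :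
    ∃ C : ℝ, 0 < C ∧
      ∀ (Ω : Type*) [MeasurableSpace Ω] (P : Measure Ω) [IsProbabilityMeasure P]
        (B : ℝ → Ω → ℝ), IsBiFBm P H K B →
      ∀ f : ℝ → ℝ, Measurable f → (∃ M : ℝ, ∀ x, |f x| ≤ M) →
      ∀ T : ℝ, 0 < T → ∀ t ∈ Set.Icc (0 : ℝ) T,
        (∃ Q : Ω → ℝ, IsL2QuadCov P B f t Q) ∧
        ∀ Q : Ω → ℝ, IsL2QuadCov P B f t Q →
          ∫ ω, |Q ω| ^ 2 ∂P ≤ (C * ⨆ x : ℝ, |f x|) ^ 2 * t := by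
  refine ⟨√covConst, Real.sqrt_pos.2 covConst_pos, ?_⟩
  intro Ω _ P _ B hB f hf ⟨M, hM⟩ T _ t ht
  obtain ⟨B', hB', hae⟩ := hB.exists_isRegularBiFBm
    ⟨hH.1, hH.2, hK.1, hK.2, hHK⟩
  have hM1 : ∀ x, |f x| ≤ |M| + 1 := fun x =>
    (hM x).trans ((le_abs_self M).trans (by linarith))
  have hpos : ∀ᶠ ε in 𝓝[>] (0 : ℝ), 0 < ε := self_mem_nhdsWithin
  have hev : ∀ᶠ ε in 𝓝[>] (0 : ℝ), covApproxOn B' f 0 t ε =ᵐ[P] covApprox B f t ε :=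
    hpos.mono fun ε hε => covApprox_ae_eq hae f ht.1 hε
  have hmem : ∀ᶠ ε in 𝓝[>] (0 : ℝ), MemLp (covApproxOn B' f 0 t ε) 2 P :=
    hpos.mono fun ε hε => hB'.memLp_covApproxOn hf hM1 le_rfl ht.1 hε
  refine ⟨?_, fun Q hQ => ?_⟩
  · obtain ⟨Q, hQ, hlim⟩ := exists_tendsto_eLpNorm_sub hmem fun η hη =>
      hB'.exists_eventually_integral_covApproxOn_sub_sq_le hf (by positivity) hM1 ht.1 hη
    refine ⟨Q, ⟨?_, hQ, hlim.congr' ?_⟩⟩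
    · filter_upwards [hmem, hev] with ε h1 h2 using h1.ae_eq h2
    · filter_upwards [hev] with ε h
      exact eLpNorm_congr_ae (h.sub (ae_eq_refl Q))
  · have hbdd : BddAbove (Set.range fun x => |f x|) := ⟨M, by rintro _ ⟨x, rfl⟩; exact hM x⟩
    have hsup : ∀ x, |f x| ≤ ⨆ x, |f x| := le_ciSup hbdd
    have h0 : 0 ≤ ⨆ x, |f x| := (abs_nonneg _).trans (hsup 0)
    simp only [sq_abs]
    -- The uniform bound needs a positive `S`, and the supremum may vanish: let `S` decrease to it.
    have hle : ∀ S, (⨆ x, |f x|) < S → ∫ ω, Q ω ^ 2 ∂P ≤ covConst * S ^ 2 * t := by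
      intro S hS
      refine integral_sq_le_of_tendsto hQ.memLp ?_ hQ.tendsto
      filter_upwards [hmem, hev, hpos] with ε h1 h2 h3
      refine ⟨h1.ae_eq h2, ?_⟩
      have e : ∫ ω, covApprox B f t ε ω ^ 2 ∂P = ∫ ω, covApproxOn B' f 0 t ε ω ^ 2 ∂P :=
        integral_congr_ae (h2.symm.pow_const 2)
      rw [e]
      simpa using hB'.integral_covApproxOn_sq_le_of_bound hf (h0.trans_lt hS)
        (fun x => (hsup x).trans hS.le) le_rfl ht.1 h3
    have hcont : Tendsto (fun S : ℝ => covConst * S ^ 2 * t) (𝓝[>] (⨆ x, |f x|))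
        (𝓝 (covConst * (⨆ x, |f x|) ^ 2 * t)) :=
      (Continuous.tendsto (by fun_prop) _).mono_left nhdsWithin_le_nhds
    rw [mul_pow, Real.sq_sqrt covConst_pos.le]
    refine ge_of_tendsto hcont ?_
    filter_upwards [self_mem_nhdsWithin] with S hS using hle S hS
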